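/- Let $k$ be a field. All comodules are left comodules, and Sweedler's notation $\Delta h=h_{(1)}\otimes h_{(2)}$ for coproducts and $v\mapsto v_{(1)}\otimes v_{(2)}\in H\otimes V$ for coactions is used. **Coquasitriangular coquasibialgebras.** A coquasitriangular coquasibialgebra over $k$ is a coalgebra $(H,\Delta,\epsilon)$ with a coalgebra map $H\otimes H\to H$, $a\otimes b\mapsto ab$, having a group-like two-sided unit element $1$, with a convolution invertible $\phi:H^{\otimes 3}\to k$ such that $\phi(a,1,b)=\epsilon(a)\epsilon(b)$, $$\phi(b_{(1)},c_{(1)},d_{(1)})\,\phi(a_{(1)},b_{(2)}c_{(2)},d_{(2)})\,\phi(a_{(2)},b_{(3)},c_{(3)})=\phi(a_{(1)},b_{(1)},c_{(1)}d_{(1)})\,\phi(a_{(2)}b_{(2)},c_{(2)},d_{(2)}),$$ $$a_{(1)}(b_{(1)}c_{(1)})\,\phi(a_{(2)},b_{(2)},c_{(2)})=\phi(a_{(1)},b_{(1)},c_{(1)})\,(a_{(2)}b_{(2)})c_{(2)},$$ and with a convolution invertible $\mathcal R:H\otimes H\to k$ such that $$\mathcal R(ab,c)=\phi(c_{(1)},a_{(1)},b_{(1)})\,\mathcal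 R(a_{(2)},c_{(2)})\,\phi^{-1}(a_{(3)},c_{(3)},b_{(2)})\,\mathcal R(b_{(3)},c_{(4)})\,\phi(a_{(4)},b_{(4)},c_{(5)}),$$ $$\mathcal R(a,bc)=\phi^{-1}(b_{(1)},c_{(1)},a_{(1)})\,\mathcal R(a_{(2)},c_{(2)})\,\phi(b_{(2)},a_{(3)},c_{(3)})\,\mathcal R(a_{(4)},b_{(3)})\,\phi^{-1}(a_{(5)},b_{(4)},c_{(4)}),$$ $$b_{(1)}a_{(1)}\,\mathcal R(a_{(2)},b_{(2)})=\mathcal R(a_{(1)},b_{(1)})\,a_{(2)}b_{(2)}.$$ The category $H\text{-Com}$ of $H$-comodules is then a $k$-linear braided monoidal category with unit object $k$, coaction $u\otimes v\mapsto u_{(1)}v_{(1)}\otimes u_{(2)}\otimes v_{(2)}$ on $U\otimes V$, associator $$\Phi:U\otimes(V\otimes W)\to(U\otimes V)\otimes W,\quad u\otimes v\otimes w\mapsto\phi(u_{(1)},v_{(1)},w_{(1)})\,u_{(2)}\otimes v_{(2)}\otimes w_{(2)},$$ and braiding $\Psi:U\otimes V\to V\otimes U$, $u\otimes v\mapsto\mathcal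 R(v_{(1)},u_{(1)})\,v_{(2)}\otimes u_{(2)}$. **Quasialgebras and ribbon structures.** An $H$-comodule quasialgebra is a unital associative algebra $(A,m,\eta)$ in the monoidal category $H\text{-Com}$; thus $a(bc)=\phi(a_{(1)},b_{(1)},c_{(1)})(a_{(2)}b_{(2)})c_{(2)}$. A ribbon structure on an algebra $A$ in a braided monoidal category is an automorphism $\sigma:A\to A$ of the object $A$ with $m(\sigma\otimes\sigma)\Psi_{A,A}^2=\sigma m$ and $\sigma\eta=\eta$. **Cocyclic module.** Let $A$ be an algebra with ribbon structure $\sigma$ in a $k$-linear braided monoidal category $\mathcal C$ with unit object $\mathbf 1$. A morphism $A^{\otimes m}\to A^{\otimes n}$ in the strictification $\bar{\mathcal C}$ is a family of morphisms in $\mathcal C$, one for each bracketing of the source and of the target, carried to each other by the canonical isomorphisms; its members are its representatives. For $n\ge0$ let $$\lambda=(-1)^n(\sigma\otimes\mathrm{id})\Psi_{A^{\otimes n},A}:A^{\otimes(n+1)}\to A^{\otimes(n+1)},$$ let $d_i:A^{\otimes(n+1)}\to A^{\otimes n}$ be the multiplication of the tensor factors number $i$ and $i+1$ (numbered from $0$)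 for $0\le i<n$, let $d_n=(m\otimes\mathrm{id})(\sigma\otimes\mathrm{id})\Psi_{A^{\otimes n},A}$ (for $n\geq 1$), and let $s_i:A^{\otimes(n+1)}\to A^{\otimes(n+2)}$, $0\le i\le n$, be the insertion of the unit after the factor number $i$. Put $$C^n(\mathcal C;A,\sigma)=\{\varphi\in\mathrm{Hom}_{\bar{\mathcal C}}(A^{\otimes(n+1)},\mathbf 1)\;:\;\varphi\lambda^{n+1}=\varphi\}.$$ Composition with $d_i$, $s_i$ and $\lambda$ makes $C^\bullet(\mathcal C;A,\sigma)$ a cocyclic module (with face maps $d_i$, degeneracies $s_i$ and cyclicity maps $\lambda$). An isomorphism of cocyclic modules is a family of linear isomorphisms, one in each degree, commuting with all $d_i$, $s_i$ and $\lambda$. **Cotwists.** A 2-cochain on $H$ is a convolution invertible $F:H\otimes H\to k$ with $F(a,1)=F(1,a)=\epsilon(a)$. Then $H^F$ denotes the coalgebra $H$ with the same unit element and $$a*b=F(a_{(1)},b_{(1)})\,a_{(2)}b_{(2)}\,F^{-1}(a_{(3)},b_{(3)}),\qquad \mathcal R_F(a,b)=F(b_{(1)},a_{(1)})\,\mathcal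 R(a_{(2)},b_{(2)})\,F^{-1}(a_{(3)},b_{(3)}),$$ $$\phi_F(a,b,c)=F(b_{(1)},c_{(1)})\,F(a_{(1)},b_{(2)}c_{(2)})\,\phi(a_{(2)},b_{(3)},c_{(3)})\,F^{-1}(a_{(3)}b_{(4)},c_{(4)})\,F^{-1}(a_{(4)},b_{(5)}),$$ which is again a coquasitriangular coquasibialgebra. For an $H$-comodule quasialgebra $A$, the $H^F$-comodule quasialgebra $A_F$ is the comodule $A$ with the same unit and the product $a\cdot b=F(a_{(1)},b_{(1)})\,a_{(2)}b_{(2)}$. **Theorem.** Let $F$ be a 2-cochain on a coquasitriangular coquasibialgebra $H$, and let $A$ be an $H$-comodule quasialgebra with ribbon structure $\sigma$ in $H\text{-Com}$. Then $\sigma$ is a ribbon structure on the algebra $A_F$ in $H^F\text{-Com}$, and there is an isomorphism of cocyclic modules $$C^n(H\text{-Com};A,\sigma)\;\xrightarrow{\ \cong\ }\;C^n(H^F\text{-Com};A_F,\sigma),\qquad\varphi\mapsto\varphi_F\qquad(n\ge0),$$ given on representatives as follows. For a bracketing $\alpha$ of $n+1$ factors, let $\varphi^\alpha$ and $\varphi_F^\alpha$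 be the representatives of $\varphi$ and $\varphi_F$ on the tensor power bracketed by $\alpha$. Define linear maps $S_\alpha$ on bracketed tensor powers of $A$ by $S=\mathrm{id}$ on $A$ and on $\mathbf 1$, and $$S_{(\alpha,\beta)}=\mathcal F\circ(S_\alpha\otimes S_\beta),\qquad \mathcal F(u\otimes v)=F(u_{(1)},v_{(1)})\,u_{(2)}\otimes v_{(2)},$$ where the coactions in $\mathcal F$ are those of $H\text{-Com}$. Then $\varphi_F^\alpha=\varphi^\alpha\circ S_\alpha$ for every $\alpha$. In particular, for the left-to-right bracketing $(\cdots((A\otimes A)\otimes A)\cdots)\otimes A$, $$\begin{aligned}\varphi_F^{lr}(a^0,\ldots,a^n)={}&F(a^0_{(1)},a^1_{(1)})\,F(a^0_{(2)}a^1_{(2)},a^2_{(1)})\,F((a^0_{(3)}a^1_{(3)})a^2_{(2)},a^3_{(1)})\cdots\\&F((\cdots((a^0_{(n)}a^1_{(n)})a^2_{(n-1)})\cdots)a^{n-1}_{(2)},a^n_{(1)})\;\varphi^{lr}(a^0_{(n+1)},a^1_{(n+1)},a^2_{(n)},\ldots,a^n_{(2)}).\end{aligned}$$ -/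

import Mathlib

open TensorProduct CategoryTheory MonoidalCategory

universe u v

set_option linter.all false

namespace QuasiCyclic

section Convolution

variable {k : Type*} [Field k]
  {C D E : Type*} [AddCommMonoid C] [Module k C] [Coalgebra k C]
  [AddCommMonoid D] [Module k D] [Coalgebra k D]
  [AddCommMonoid E] [Module k E] [Coalgebra k E]

/-- Linear functionals on a coalgebra with their convolution product
`(f * g) c = f c₍₁₎ * g c₍₂₎`; the unit `1` is the counit. -/
abbrev Functional (k C : Type*) [Field k] [AddCommMonoid C] [Module k C] : Type _ :=
  WithConv (C →ₗ[k] k)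

/-- Pull-back `f ↦ f ∘ h` of functionals along a coalgebra morphism. -/
noncomputable def pull (h : C →ₗc[k] D) : Functional k D →* Functional k C where
  toFun f := WithConv.toConv (f.ofConv ∘ₗ h.toLinearMap)
  map_one' := by
    ext x
    simp
  map_mul' f g := by
    apply WithConv.ext
    exact LinearMap.convMul_comp_coalgHom_distrib f g h

@[simp] lemma pull_apply (h : C →ₗc[k] D) (f : Functional k D) (x : C) :
    pull h f x = f (h x) := rfl

lemma pull_pull (h : C →ₗc[k] D) (h' : D →ₗc[k] E) (f : Functional k E) :
    pull h (pull h' f) = pull (h'.comp h) f := rfl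

/-- The flip `a ⊗ b ↦ b ⊗ a`. -/
noncomputable def flip (k C D : Type*) [Field k] [AddCommMonoid C] [Module k C] [Coalgebra k C]
    [AddCommMonoid D] [Module k D] [Coalgebra k D] : C ⊗[k] D →ₗc[k] D ⊗[k] C where
  toLinearMap := (TensorProduct.comm k C D).toLinearMap
  counit_comp := by ext a b; simp [mul_comm]
  map_comp_comul := by
    ext a b
    simp only [TensorProduct.AlgebraTensorModule.curry_apply, LinearMap.restrictScalars_self,
      TensorProduct.curry_apply, LinearMap.comp_apply, TensorProduct.comul_tmul,
      LinearEquiv.coe_coe, TensorProduct.comm_tmul]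
    generalize Coalgebra.comul (R := k) a = x
    generalize Coalgebra.comul (R := k) b = y
    induction x with
    | zero => simp
    | add x x' hx hx' => simp only [TensorProduct.add_tmul, TensorProduct.tmul_add, map_add, hx, hx']
    | tmul a₁ a₂ =>
      induction y with
      | zero => simp
      | add x x' hx hx' =>
        simp only [TensorProduct.add_tmul, TensorProduct.tmul_add, map_add, hx, hx']
      | tmul b₁ b₂ => simp

/-- `a ⊗ b ↦ h a ⊗ h' b`. -/
noncomputable abbrev tmap {C' D' : Type*} [AddCommMonoid C'] [Module k C'] [Coalgebra k C']
    [AddCommMonoid D'] [Module k D'] [Coalgebra k D'] (h : C →ₗc[k] C') (h' : D →ₗc[k] D') :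
    C ⊗[k] D →ₗc[k] C' ⊗[k] D' := Coalgebra.TensorProduct.map h h'

/-- `(a ⊗ b) ⊗ c ↦ a ⊗ (b ⊗ c)`. -/
noncomputable abbrev assocR (k C D E : Type*) [Field k]
    [AddCommMonoid C] [Module k C] [Coalgebra k C] [AddCommMonoid D] [Module k D] [Coalgebra k D]
    [AddCommMonoid E] [Module k E] [Coalgebra k E] :
    (C ⊗[k] D) ⊗[k] E →ₗc[k] C ⊗[k] (D ⊗[k] E) :=
  (Coalgebra.TensorProduct.assoc k k C D E : _ →ₗc[k] _)

/-- `a ⊗ (b ⊗ c) ↦ (a ⊗ b) ⊗ c`. -/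
noncomputable abbrev assocL (k C D E : Type*) [Field k]
    [AddCommMonoid C] [Module k C] [Coalgebra k C] [AddCommMonoid D] [Module k D] [Coalgebra k D]
    [AddCommMonoid E] [Module k E] [Coalgebra k E] :
    C ⊗[k] (D ⊗[k] E) →ₗc[k] (C ⊗[k] D) ⊗[k] E :=
  ((Coalgebra.TensorProduct.assoc k k C D E).symm : _ →ₗc[k] _)

/-- `a ⊗ b ↦ ε(a) b`. -/
noncomputable def dropL (k C D : Type*) [Field k] [AddCommMonoid C] [Module k C] [Coalgebra k C]
    [AddCommMonoid D] [Module k D] [Coalgebra k D] : C ⊗[k] D →ₗc[k] D :=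
  (Coalgebra.TensorProduct.lid k D : _ →ₗc[k] _).comp
    (tmap (Coalgebra.counitCoalgHom k C) (CoalgHom.id k D))

/-- `a ⊗ b ↦ ε(b) a`. -/
noncomputable def dropR (k C D : Type*) [Field k] [AddCommMonoid C] [Module k C] [Coalgebra k C]
    [AddCommMonoid D] [Module k D] [Coalgebra k D] : C ⊗[k] D →ₗc[k] C :=
  (Coalgebra.TensorProduct.rid k k C : _ →ₗc[k] _).comp
    (tmap (CoalgHom.id k C) (Coalgebra.counitCoalgHom k D))

@[simp] lemma flip_tmul (a : C) (b : D) : flip k C D (a ⊗ₜ b) = b ⊗ₜ a := rfl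
@[simp] lemma assocR_tmul (a : C) (b : D) (c : E) :
    assocR k C D E ((a ⊗ₜ b) ⊗ₜ c) = a ⊗ₜ (b ⊗ₜ c) := rfl
@[simp] lemma assocL_tmul (a : C) (b : D) (c : E) :
    assocL k C D E (a ⊗ₜ (b ⊗ₜ c)) = (a ⊗ₜ b) ⊗ₜ c := rfl
@[simp] lemma dropL_tmul (a : C) (b : D) :
    dropL k C D (a ⊗ₜ b) = Coalgebra.counit (R := k) a • b := rfl
@[simp] lemma dropR_tmul (a : C) (b : D) :
    dropR k C D (a ⊗ₜ b) = Coalgebra.counit (R := k) b • a := rfl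

/-- For `t : C → T` linear and a functional `f`: the map `c ↦ f(c₍₁₎) t(c₍₂₎)`. -/
noncomputable def convL {T : Type*} [AddCommMonoid T] [Module k T]
    (f : Functional k C) (t : C →ₗ[k] T) : C →ₗ[k] T :=
  (TensorProduct.lid k T).toLinearMap ∘ₗ TensorProduct.map f.ofConv t ∘ₗ Coalgebra.comul

/-- For `t : C → T` linear and a functional `f`: the map `c ↦ t(c₍₁₎) f(c₍₂₎)`. -/
noncomputable def convR {T : Type*} [AddCommMonoid T] [Module k T]
    (t : C →ₗ[k] T) (f : Functional k C) : C →ₗ[k] T :=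
  (TensorProduct.rid k T).toLinearMap ∘ₗ TensorProduct.map t f.ofConv ∘ₗ Coalgebra.comul

end Convolution

section Structure

/-- A coquasitriangular coquasibialgebra over `k`: a coalgebra `H` with a product `H ⊗ H → H` that
is a coalgebra morphism, a group-like unit element, a convolution invertible unital 3-cocycle
`φ : H ⊗ H ⊗ H → k` controlling the associativity of the product, and a convolution invertible
`R : H ⊗ H → k` controlling its commutativity.  The functionals `φinv`, `Rinv` are the (unique)
convolution inverses.  Products of functionals are convolution products. -/
structure CoquasitriangularCoquasibialgebra (k : Type u) (H : Type v) [Field k]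
    [AddCommGroup H] [Module k H] [Coalgebra k H] where
  /-- the product `a ⊗ b ↦ a b` -/
  mul : H ⊗[k] H →ₗc[k] H
  /-- the unit element -/
  one : H
  one_groupLike : IsGroupLikeElem k one
  one_mul : ∀ a, mul (one ⊗ₜ a) = a
  mul_one : ∀ a, mul (a ⊗ₜ one) = a
  /-- the 3-cocycle -/
  φ : Functional k (H ⊗[k] (H ⊗[k] H))
  /-- the convolution inverse of the 3-cocycle -/
  φinv : Functional k (H ⊗[k] (H ⊗[k] H))
  φ_φinv : φ * φinv = 1
  φinv_φ : φinv * φ = 1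
  /-- `φ(b₁,c₁,d₁) φ(a₁,b₂c₂,d₂) φ(a₂,b₃,c₃) = φ(a₁,b₁,c₁d₁) φ(a₂b₂,c₂,d₂)` -/
  cocycle :
    pull (dropL k H (H ⊗[k] (H ⊗[k] H))) φ *
      pull (tmap (.id k H) ((tmap mul (.id k H)).comp (assocL k H H H))) φ *
      pull (tmap (.id k H) (tmap (.id k H) (dropR k H H))) φ =
    pull (tmap (.id k H) (tmap (.id k H) mul)) φ *
      pull ((tmap mul (.id k (H ⊗[k] H))).comp (assocL k H H (H ⊗[k] H))) φ
  /-- `φ(a,1,b) = ε(a) ε(b)` -/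
  φ_one : ∀ a b, φ (a ⊗ₜ (one ⊗ₜ b)) = Coalgebra.counit (R := k) a * Coalgebra.counit (R := k) b
  /-- `a₁(b₁c₁) φ(a₂,b₂,c₂) = φ(a₁,b₁,c₁) (a₂b₂)c₂` -/
  quasi_assoc :
    convR (mul.comp (tmap (.id k H) mul)).toLinearMap φ =
      convL φ ((mul.comp (tmap mul (.id k H))).comp (assocL k H H H)).toLinearMap
  /-- the coquasitriangular structure -/
  R : Functional k (H ⊗[k] H)
  /-- the convolution inverse of the coquasitriangular structure -/
  Rinv : Functional k (H ⊗[k] H)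
  R_Rinv : R * Rinv = 1
  Rinv_R : Rinv * R = 1
  /-- `R(ab,c) = φ(c₁,a₁,b₁) R(a₂,c₂) φ⁻¹(a₃,c₃,b₂) R(b₃,c₄) φ(a₄,b₄,c₅)` -/
  R_mul_left :
    pull ((tmap mul (.id k H)).comp (assocL k H H H)) R =
      pull ((flip k (H ⊗[k] H) H).comp (assocL k H H H)) φ *
      pull (tmap (.id k H) (dropL k H H)) R *
      pull (tmap (.id k H) (flip k H H)) φinv *
      pull (dropL k H (H ⊗[k] H)) R *
      φ
  /-- `R(a,bc) = φ⁻¹(b₁,c₁,a₁) R(a₂,c₂) φ(b₂,a₃,c₃) R(a₄,b₃) φ⁻¹(a₅,b₄,c₄)` -/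
  R_mul_right :
    pull (tmap (.id k H) mul) R =
      pull ((assocR k H H H).comp (flip k H (H ⊗[k] H))) φinv *
      pull (tmap (.id k H) (dropL k H H)) R *
      pull (((assocR k H H H).comp (tmap (flip k H H) (.id k H))).comp (assocL k H H H)) φ *
      pull (tmap (.id k H) (dropR k H H)) R *
      φinv
  /-- `b₁a₁ R(a₂,b₂) = R(a₁,b₁) a₂b₂` -/
  quasi_comm :
    convR (mul.comp (flip k H H)).toLinearMap R = convL R mul.toLinearMap

end Structure


section Coaction

variable {k : Type*} [Field k]
  {C D E : Type*} [AddCommMonoid C] [Module k C] [Coalgebra k C]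
  [AddCommMonoid D] [Module k D] [Coalgebra k D]
  [AddCommMonoid E] [Module k E] [Coalgebra k E]
  {U V W : Type*} [AddCommMonoid U] [Module k U] [AddCommMonoid V] [Module k V]
  [AddCommMonoid W] [Module k W]

/-- A (left) coaction `v ↦ v₍₁₎ ⊗ v₍₂₎` of a coalgebra `C` on `V`. -/
structure Coaction (k C V : Type*) [Field k] [AddCommMonoid C] [Module k C] [Coalgebra k C]
    [AddCommMonoid V] [Module k V] where
  /-- the underlying linear map -/
  coact : V →ₗ[k] C ⊗[k] V
  coassoc : (TensorProduct.assoc k C C V).toLinearMap ∘ₗ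
    LinearMap.rTensor V (Coalgebra.comul (R := k) (A := C)) ∘ₗ coact =
      LinearMap.lTensor C coact ∘ₗ coact
  counit : (TensorProduct.lid k V).toLinearMap ∘ₗ
    LinearMap.rTensor V (Coalgebra.counit (R := k) (A := C)) ∘ₗ coact = LinearMap.id

namespace Coaction

/-- The linear map `v ↦ f(v₍₁₎) v₍₂₎`. -/
noncomputable def act (ρ : Coaction k C V) (f : Functional k C) : V →ₗ[k] V :=
  (TensorProduct.lid k V).toLinearMap ∘ₗ LinearMap.rTensor V f.ofConv ∘ₗ ρ.coact

/-- The linear map `v ↦ t(v₍₁₎) ⊗ v₍₂₎`. -/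
noncomputable def push (ρ : Coaction k C V) {T : Type*} [AddCommMonoid T] [Module k T]
    (t : C →ₗ[k] T) : V →ₗ[k] T ⊗[k] V :=
  LinearMap.rTensor V t ∘ₗ ρ.coact

lemma push_act (ρ : Coaction k C V) {T : Type*} [AddCommMonoid T] [Module k T]
    (t : C →ₗ[k] T) (f : Functional k C) :
    ρ.push t ∘ₗ ρ.act f = ρ.push (convL f t) := by
  have h := ρ.coassoc
  ext v
  have hv := LinearMap.congr_fun h v
  simp only [LinearMap.comp_apply, LinearEquiv.coe_coe] at hv
  let G : C ⊗[k] (C ⊗[k] V) →ₗ[k] T ⊗[k] V :=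
    (TensorProduct.lid k _).toLinearMap ∘ₗ TensorProduct.map f.ofConv (LinearMap.rTensor V t)
  have h1 : (ρ.push t ∘ₗ ρ.act f) v = G (LinearMap.lTensor C ρ.coact (ρ.coact v)) := by
    simp only [push, act, LinearMap.comp_apply, G, LinearEquiv.coe_coe]
    induction ρ.coact v with
    | zero => simp
    | add x y hx hy => simp only [map_add, hx, hy]
    | tmul c w => simp
  rw [h1, ← hv]
  simp only [push, convL, LinearMap.comp_apply, G, LinearEquiv.coe_coe]
  induction ρ.coact v with
  | zero => simp
  | add x y hx hy => simp only [map_add, hx, hy]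
  | tmul c w =>
    simp only [LinearMap.rTensor_tmul, LinearMap.comp_apply, LinearEquiv.coe_coe]
    induction Coalgebra.comul (R := k) c with
    | zero => simp
    | add x y hx hy => simp only [map_add, TensorProduct.add_tmul, hx, hy]
    | tmul a b => simp [TensorProduct.smul_tmul']

lemma lTensor_act_push (ρ : Coaction k C V) {T : Type*} [AddCommMonoid T] [Module k T]
    (t : C →ₗ[k] T) (f : Functional k C) :
    LinearMap.lTensor T (ρ.act f) ∘ₗ ρ.push t = ρ.push (convR t f) := by
  have h := ρ.coassoc
  ext v
  have hv := LinearMap.congr_fun h v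
  simp only [LinearMap.comp_apply, LinearEquiv.coe_coe] at hv
  let G : C ⊗[k] (C ⊗[k] V) →ₗ[k] T ⊗[k] V :=
    TensorProduct.map t ((TensorProduct.lid k V).toLinearMap ∘ₗ LinearMap.rTensor V f.ofConv)
  have h1 : (LinearMap.lTensor T (ρ.act f) ∘ₗ ρ.push t) v =
      G (LinearMap.lTensor C ρ.coact (ρ.coact v)) := by
    simp only [push, act, LinearMap.comp_apply, G]
    induction ρ.coact v with
    | zero => simp
    | add x y hx hy => simp only [map_add, hx, hy]
    | tmul c w => simp
  rw [h1, ← hv]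
  simp only [push, convR, LinearMap.comp_apply, G]
  induction ρ.coact v with
  | zero => simp
  | add x y hx hy => simp only [map_add, hx, hy]
  | tmul c w =>
    simp only [LinearMap.rTensor_tmul, LinearMap.comp_apply, LinearEquiv.coe_coe]
    induction Coalgebra.comul (R := k) c with
    | zero => simp
    | add x y hx hy => simp only [map_add, TensorProduct.add_tmul, hx, hy]
    | tmul a b => simp [TensorProduct.smul_tmul]

lemma act_eq_push (ρ : Coaction k C V) (f : Functional k C) :
    ρ.act f = (TensorProduct.lid k V).toLinearMap ∘ₗ ρ.push f.ofConv := rfl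

lemma convL_ofConv (f g : Functional k C) : convL f g.ofConv = (f * g).ofConv := by
  ext c
  simp only [convL, LinearMap.convMul_def, LinearMap.comp_apply]
  induction Coalgebra.comul (R := k) c with
  | zero => simp
  | add x y hx hy => simp only [map_add, hx, hy]
  | tmul a b => simp

lemma act_act (ρ : Coaction k C V) (f g : Functional k C) :
    ρ.act g ∘ₗ ρ.act f = ρ.act (f * g) := by
  rw [act_eq_push ρ g, LinearMap.comp_assoc, push_act, convL_ofConv, ← act_eq_push]

lemma act_one (ρ : Coaction k C V) : ρ.act 1 = LinearMap.id := ρ.counit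

/-- Corestriction of a coaction along a coalgebra morphism. -/
noncomputable def cores (ρ : Coaction k C V) (h : C →ₗc[k] D) : Coaction k D V where
  coact := LinearMap.rTensor V h.toLinearMap ∘ₗ ρ.coact
  coassoc := by
    have h1 := ρ.coassoc
    ext v
    have hv := LinearMap.congr_fun h1 v
    let G : C ⊗[k] (C ⊗[k] V) →ₗ[k] D ⊗[k] (D ⊗[k] V) :=
      TensorProduct.map h.toLinearMap (LinearMap.rTensor V h.toLinearMap)
    have hv' := congrArg G hv
    simp only [LinearMap.comp_apply, LinearEquiv.coe_coe, G] at hv' ⊢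
    convert hv' using 1
    · induction ρ.coact v with
      | zero => simp
      | add x y hx hy => simp only [map_add, hx, hy]
      | tmul c w =>
        simp only [LinearMap.rTensor_tmul]
        have := LinearMap.congr_fun h.map_comp_comul c
        simp only [LinearMap.comp_apply] at this
        rw [← this]
        induction Coalgebra.comul (R := k) c with
        | zero => simp
        | add x y hx hy => simp only [map_add, TensorProduct.add_tmul, hx, hy]
        | tmul a b => simp
    · induction ρ.coact v with
      | zero => simp
      | add x y hx hy => simp only [map_add, hx, hy]
      | tmul c w => simp
  counit := by
    have h1 := ρ.counit
    rw [← h.counit_comp, LinearMap.rTensor_comp] at h1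
    exact h1

/-- The coaction `v ⊗ w ↦ (v₍₁₎ ⊗ w₍₁₎) ⊗ (v₍₂₎ ⊗ w₍₂₎)` of `C ⊗ D` on `V ⊗ W`. -/
noncomputable def ext (ρ : Coaction k C V) (ρ' : Coaction k D W) :
    Coaction k (C ⊗[k] D) (V ⊗[k] W) where
  coact := (TensorProduct.tensorTensorTensorComm k C V D W).toLinearMap ∘ₗ
    TensorProduct.map ρ.coact ρ'.coact
  coassoc := by
    ext v w
    let G : (C ⊗[k] (C ⊗[k] V)) ⊗[k] (D ⊗[k] (D ⊗[k] W)) →ₗ[k]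
        (C ⊗[k] D) ⊗[k] ((C ⊗[k] D) ⊗[k] (V ⊗[k] W)) :=
      (LinearMap.lTensor _ (TensorProduct.tensorTensorTensorComm k C V D W).toLinearMap) ∘ₗ
        (TensorProduct.tensorTensorTensorComm k C (C ⊗[k] V) D (D ⊗[k] W)).toLinearMap
    have hv := LinearMap.congr_fun ρ.coassoc v
    have hw := LinearMap.congr_fun ρ'.coassoc w
    have h := congrArg₂ (fun x y => G (x ⊗ₜ[k] y)) hv hw
    simp only [LinearMap.comp_apply, LinearEquiv.coe_coe, G,
      TensorProduct.AlgebraTensorModule.curry_apply, LinearMap.restrictScalars_self,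
      TensorProduct.curry_apply, TensorProduct.map_tmul] at h ⊢
    convert h using 1
    · generalize ρ.coact v = x
      generalize ρ'.coact w = y
      induction x with
      | zero => simp
      | add x y hx hy => simp only [map_add, TensorProduct.add_tmul, hx, hy]
      | tmul c v =>
        induction y with
        | zero => simp
        | add x y hx hy => simp only [map_add, TensorProduct.tmul_add, hx, hy]
        | tmul d w =>
          simp only [TensorProduct.tensorTensorTensorComm_tmul, LinearMap.rTensor_tmul,
            TensorProduct.comul_tmul]
          generalize Coalgebra.comul (R := k) c = x
          generalize Coalgebra.comul (R := k) d = y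
          induction x with
          | zero => simp
          | add x y hx hy => simp only [map_add, TensorProduct.add_tmul, hx, hy]
          | tmul c v =>
            induction y with
            | zero => simp
            | add x y hx hy =>
              simp only [map_add, TensorProduct.tmul_add, TensorProduct.add_tmul, hx, hy]
            | tmul d w => simp
    · generalize ρ.coact v = x
      generalize ρ'.coact w = y
      induction x with
      | zero => simp
      | add x y hx hy => simp only [map_add, TensorProduct.add_tmul, hx, hy]
      | tmul c v =>
        induction y with
        | zero => simp
        | add x y hx hy => simp only [map_add, TensorProduct.tmul_add, hx, hy]
        | tmul d w =>
          simp only [TensorProduct.tensorTensorTensorComm_tmul, LinearMap.lTensor_tmul,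
            LinearMap.comp_apply, TensorProduct.map_tmul, LinearEquiv.coe_coe]
  counit := by
    ext v w
    have hv := LinearMap.congr_fun ρ.counit v
    have hw := LinearMap.congr_fun ρ'.counit w
    have h := congrArg₂ (fun x y => x ⊗ₜ[k] y) hv hw
    simp only [LinearMap.comp_apply, LinearEquiv.coe_coe,
      TensorProduct.AlgebraTensorModule.curry_apply, LinearMap.restrictScalars_self,
      TensorProduct.curry_apply, TensorProduct.map_tmul, LinearMap.id_apply] at h ⊢
    refine Eq.trans ?_ h
    generalize ρ.coact v = x
    generalize ρ'.coact w = y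
    induction x with
    | zero => simp
    | add x y hx hy => simp only [map_add, TensorProduct.add_tmul, hx, hy]
    | tmul c v =>
      induction y with
      | zero => simp
      | add x y hx hy => simp only [map_add, TensorProduct.tmul_add, hx, hy]
      | tmul d w => simp [TensorProduct.smul_tmul', TensorProduct.tmul_smul, smul_smul, mul_comm]

@[simp] lemma ext_coact_tmul (ρ : Coaction k C V) (ρ' : Coaction k D W) (v : V) (w : W) :
    (ρ.ext ρ').coact (v ⊗ₜ w) =
      TensorProduct.tensorTensorTensorComm k C V D W (ρ.coact v ⊗ₜ ρ'.coact w) := rfl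

/-- `L` is compatible with coactions along the coalgebra morphism `h`. -/
def Compat (ρ : Coaction k C V) (ρ' : Coaction k D W) (h : C →ₗc[k] D) (L : V →ₗ[k] W) : Prop :=
  ρ'.coact ∘ₗ L = TensorProduct.map h.toLinearMap L ∘ₗ ρ.coact

lemma Compat.push {ρ : Coaction k C V} {ρ' : Coaction k D W} {h : C →ₗc[k] D} {L : V →ₗ[k] W}
    (H : Compat ρ ρ' h L) {T : Type*} [AddCommMonoid T] [Module k T] (t : D →ₗ[k] T) :
    ρ'.push t ∘ₗ L = LinearMap.lTensor T L ∘ₗ ρ.push (t ∘ₗ h.toLinearMap) := by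
  unfold Coaction.push
  rw [LinearMap.comp_assoc, H, ← LinearMap.comp_assoc, ← LinearMap.comp_assoc]
  congr 1
  ext; simp

lemma Compat.act {ρ : Coaction k C V} {ρ' : Coaction k D W} {h : C →ₗc[k] D} {L : V →ₗ[k] W}
    (H : Compat ρ ρ' h L) (f : Functional k D) : ρ'.act f ∘ₗ L = L ∘ₗ ρ.act (pull h f) := by
  rw [act_eq_push, act_eq_push, LinearMap.comp_assoc, H.push, ← LinearMap.comp_assoc,
    ← LinearMap.comp_assoc]
  congr 1
  ext; simp

lemma Compat.ext {C' D' V' W' : Type*} [AddCommMonoid C'] [Module k C'] [Coalgebra k C']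
    [AddCommMonoid D'] [Module k D'] [Coalgebra k D'] [AddCommMonoid V'] [Module k V']
    [AddCommMonoid W'] [Module k W']
    {ρ : Coaction k C V} {ρ' : Coaction k D W} {h : C →ₗc[k] D} {L : V →ₗ[k] W}
    (H : Compat ρ ρ' h L) {τ : Coaction k C' V'} {τ' : Coaction k D' W'} {h' : C' →ₗc[k] D'}
    {L' : V' →ₗ[k] W'} (H' : Compat τ τ' h' L') :
    Compat (ρ.ext τ) (ρ'.ext τ') (tmap h h') (TensorProduct.map L L') := by
  unfold Compat at *
  ext v v'
  have hv := LinearMap.congr_fun H v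
  have hw := LinearMap.congr_fun H' v'
  simp only [LinearMap.comp_apply] at hv hw
  simp only [LinearMap.comp_apply, TensorProduct.AlgebraTensorModule.curry_apply,
    LinearMap.restrictScalars_self, TensorProduct.curry_apply, TensorProduct.map_tmul,
    ext_coact_tmul, hv, hw]
  generalize ρ.coact v = x
  generalize τ.coact v' = y
  induction x with
  | zero => simp
  | add x y hx hy => simp only [map_add, TensorProduct.add_tmul, hx, hy]
  | tmul c v =>
    induction y with
    | zero => simp
    | add x y hx hy => simp only [map_add, TensorProduct.tmul_add, hx, hy]
    | tmul d w => rfl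

lemma compat_cores (ρ : Coaction k C V) (h : C →ₗc[k] D) :
    Compat ρ (ρ.cores h) h LinearMap.id := by
  unfold Compat cores
  rfl

lemma compat_id (ρ : Coaction k C V) : Compat ρ ρ (.id k C) LinearMap.id := by
  unfold Compat
  ext v
  simp

lemma Compat.comp {ρ : Coaction k C U} {ρ' : Coaction k D V} {ρ'' : Coaction k E W}
    {h : C →ₗc[k] D} {h' : D →ₗc[k] E} {L : U →ₗ[k] V} {L' : V →ₗ[k] W}
    (H : Compat ρ ρ' h L) (H' : Compat ρ' ρ'' h' L') : Compat ρ ρ'' (h'.comp h) (L' ∘ₗ L) := by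
  unfold Compat at *
  rw [← LinearMap.comp_assoc, H', LinearMap.comp_assoc, H, ← LinearMap.comp_assoc,
    ← TensorProduct.map_comp]
  rfl

lemma compat_flip (ρ : Coaction k C V) (ρ' : Coaction k D W) :
    Compat (ρ.ext ρ') (ρ'.ext ρ) (flip k C D) (TensorProduct.comm k V W).toLinearMap := by
  unfold Compat
  ext v w
  simp only [LinearMap.comp_apply, TensorProduct.AlgebraTensorModule.curry_apply,
    LinearMap.restrictScalars_self, TensorProduct.curry_apply, LinearEquiv.coe_coe,
    TensorProduct.comm_tmul, ext_coact_tmul]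
  generalize ρ.coact v = x
  generalize ρ'.coact w = y
  induction x with
  | zero => simp
  | add x y hx hy => simp only [map_add, TensorProduct.add_tmul, TensorProduct.tmul_add, hx, hy]
  | tmul c v =>
    induction y with
    | zero => simp
    | add x y hx hy => simp only [map_add, TensorProduct.tmul_add, TensorProduct.add_tmul, hx, hy]
    | tmul d w => rfl

lemma compat_assocR (ρ : Coaction k C U) (ρ' : Coaction k D V) (ρ'' : Coaction k E W) :
    Compat ((ρ.ext ρ').ext ρ'') (ρ.ext (ρ'.ext ρ'')) (assocR k C D E)
      (TensorProduct.assoc k U V W).toLinearMap := by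
  unfold Compat
  ext u v w
  simp only [LinearMap.comp_apply, TensorProduct.AlgebraTensorModule.curry_apply,
    LinearMap.restrictScalars_self, TensorProduct.curry_apply, LinearEquiv.coe_coe,
    TensorProduct.assoc_tmul, ext_coact_tmul]
  generalize ρ.coact u = x
  generalize ρ'.coact v = y
  generalize ρ''.coact w = z
  induction x with
  | zero => simp
  | add x y hx hy => simp only [map_add, TensorProduct.add_tmul, hx, hy]
  | tmul c v =>
    induction y with
    | zero => simp
    | add x y hx hy => simp only [map_add, TensorProduct.tmul_add, TensorProduct.add_tmul, hx, hy]
    | tmul d w =>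
      induction z with
      | zero => simp
      | add x y hx hy => simp only [map_add, TensorProduct.tmul_add, hx, hy]
      | tmul d w => rfl

lemma compat_assocL (ρ : Coaction k C U) (ρ' : Coaction k D V) (ρ'' : Coaction k E W) :
    Compat (ρ.ext (ρ'.ext ρ'')) ((ρ.ext ρ').ext ρ'') (assocL k C D E)
      (TensorProduct.assoc k U V W).symm.toLinearMap := by
  unfold Compat
  ext u v w
  simp only [LinearMap.comp_apply, TensorProduct.AlgebraTensorModule.curry_apply,
    LinearMap.restrictScalars_self, TensorProduct.curry_apply, LinearEquiv.coe_coe,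
    TensorProduct.assoc_symm_tmul, ext_coact_tmul]
  generalize ρ.coact u = x
  generalize ρ'.coact v = y
  generalize ρ''.coact w = z
  induction x with
  | zero => simp
  | add x y hx hy => simp only [map_add, TensorProduct.add_tmul, hx, hy]
  | tmul c v =>
    induction y with
    | zero => simp
    | add x y hx hy => simp only [map_add, TensorProduct.tmul_add, TensorProduct.add_tmul, hx, hy]
    | tmul d w =>
      induction z with
      | zero => simp
      | add x y hx hy => simp only [map_add, TensorProduct.tmul_add, hx, hy]
      | tmul d w => rfl

lemma ext_act_dropL (ρ : Coaction k C V) (ρ' : Coaction k D W) (f : Functional k D) :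
    (ρ.ext ρ').act (pull (dropL k C D) f) = LinearMap.lTensor V (ρ'.act f) := by
  ext v w
  have hv := LinearMap.congr_fun ρ.counit v
  simp only [LinearMap.comp_apply, LinearEquiv.coe_coe, LinearMap.id_apply] at hv
  simp only [TensorProduct.AlgebraTensorModule.curry_apply,
    LinearMap.restrictScalars_self, TensorProduct.curry_apply, LinearMap.lTensor_tmul]
  conv_rhs => rw [← hv]
  simp only [act, LinearMap.comp_apply, ext_coact_tmul, LinearEquiv.coe_coe]
  generalize ρ.coact v = x
  generalize ρ'.coact w = y
  induction x with
  | zero => simp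
  | add x y hx hy => simp only [map_add, TensorProduct.add_tmul, hx, hy]
  | tmul c v =>
    induction y with
    | zero => simp
    | add x y hx hy => simp only [map_add, TensorProduct.tmul_add, hx, hy]
    | tmul d w =>
      simp only [TensorProduct.tensorTensorTensorComm_tmul, LinearMap.rTensor_tmul,
        TensorProduct.lid_tmul, TensorProduct.smul_tmul, TensorProduct.tmul_smul, smul_smul]
      congr 1
      change f.ofConv (Coalgebra.counit (R := k) c • d) = _
      simp [mul_comm]

lemma ext_act_dropR (ρ : Coaction k C V) (ρ' : Coaction k D W) (f : Functional k C) :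
    (ρ.ext ρ').act (pull (dropR k C D) f) = LinearMap.rTensor W (ρ.act f) := by
  ext v w
  have hw := LinearMap.congr_fun ρ'.counit w
  simp only [LinearMap.comp_apply, LinearEquiv.coe_coe, LinearMap.id_apply] at hw
  simp only [TensorProduct.AlgebraTensorModule.curry_apply,
    LinearMap.restrictScalars_self, TensorProduct.curry_apply, LinearMap.rTensor_tmul]
  conv_rhs => rw [← hw]
  simp only [act, LinearMap.comp_apply, ext_coact_tmul, LinearEquiv.coe_coe]
  generalize ρ.coact v = x
  generalize ρ'.coact w = y
  induction x with
  | zero => simp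
  | add x y hx hy => simp only [map_add, TensorProduct.add_tmul, hx, hy]
  | tmul c v =>
    induction y with
    | zero => simp
    | add x y hx hy => simp only [map_add, TensorProduct.tmul_add, hx, hy]
    | tmul d w =>
      simp only [TensorProduct.tensorTensorTensorComm_tmul, LinearMap.rTensor_tmul,
        TensorProduct.lid_tmul, TensorProduct.smul_tmul', TensorProduct.tmul_smul, smul_smul]
      change (f.ofConv (Coalgebra.counit (R := k) d • c) • v) ⊗ₜ[k] w = _
      simp

end Coaction

end Coaction


section Raw

variable {k : Type u} {H : Type v} [Field k] [AddCommGroup H] [Module k H] [Coalgebra k H]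
  (S : CoquasitriangularCoquasibialgebra k H)
  {T U V W : Type*} [AddCommMonoid T] [Module k T] [AddCommMonoid U] [Module k U]
  [AddCommMonoid V] [Module k V] [AddCommMonoid W] [Module k W]

namespace Coaction

/-- The coaction `u ⊗ v ↦ u₍₁₎v₍₁₎ ⊗ (u₍₂₎ ⊗ v₍₂₎)` on the tensor product of two comodules. -/
noncomputable def tens (ρ : Coaction k H U) (ρ' : Coaction k H V) : Coaction k H (U ⊗[k] V) :=
  (ρ.ext ρ').cores S.mul

/-- The coaction `c ↦ 1 ⊗ c` on `k`. -/
noncomputable def triv : Coaction k H k where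
  coact := TensorProduct.mk k H k S.one
  coassoc := by
    ext
    simp [S.one_groupLike.comul_eq_tmul_self]
  counit := by
    ext
    simp [S.one_groupLike.counit_eq_one]

lemma coact_eq_push {C : Type*} [AddCommMonoid C] [Module k C] [Coalgebra k C]
    (ρ : Coaction k C V) : ρ.coact = ρ.push LinearMap.id := by
  simp [Coaction.push]

lemma coact_tens_left (ρU : Coaction k H U) (ρV : Coaction k H V) (ρW : Coaction k H W) :
    (tens S (tens S ρU ρV) ρW).coact =
      ((ρU.ext ρV).ext ρW).push (S.mul.comp (tmap S.mul (.id k H))).toLinearMap := by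
  have h := (compat_cores (ρU.ext ρV) S.mul).ext (compat_id ρW)
  have h2 := (h.comp (compat_cores _ S.mul)).push LinearMap.id
  simp only [TensorProduct.map_id, LinearMap.comp_id, LinearMap.lTensor_id, LinearMap.id_comp,
    ← coact_eq_push] at h2
  exact h2

lemma coact_tens_right (ρU : Coaction k H U) (ρV : Coaction k H V) (ρW : Coaction k H W) :
    (tens S ρU (tens S ρV ρW)).coact =
      (ρU.ext (ρV.ext ρW)).push (S.mul.comp (tmap (.id k H) S.mul)).toLinearMap := by
  have h := (compat_id ρU).ext (compat_cores (ρV.ext ρW) S.mul)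
  have h2 := (h.comp (compat_cores _ S.mul)).push LinearMap.id
  simp only [TensorProduct.map_id, LinearMap.comp_id, LinearMap.lTensor_id, LinearMap.id_comp,
    ← coact_eq_push] at h2
  exact h2

/-- The associator `Φ : U ⊗ (V ⊗ W) → (U ⊗ V) ⊗ W`,
`u ⊗ (v ⊗ w) ↦ φ(u₍₁₎,v₍₁₎,w₍₁₎) (u₍₂₎ ⊗ v₍₂₎) ⊗ w₍₂₎`. -/
noncomputable def assocLin (ρU : Coaction k H U) (ρV : Coaction k H V) (ρW : Coaction k H W) :
    U ⊗[k] (V ⊗[k] W) →ₗ[k] (U ⊗[k] V) ⊗[k] W :=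
  (TensorProduct.assoc k U V W).symm.toLinearMap ∘ₗ (ρU.ext (ρV.ext ρW)).act S.φ

/-- The inverse of the associator. -/
noncomputable def assocInvLin (ρU : Coaction k H U) (ρV : Coaction k H V) (ρW : Coaction k H W) :
    (U ⊗[k] V) ⊗[k] W →ₗ[k] U ⊗[k] (V ⊗[k] W) :=
  (ρU.ext (ρV.ext ρW)).act S.φinv ∘ₗ (TensorProduct.assoc k U V W).toLinearMap

/-- The braiding `Ψ : U ⊗ V → V ⊗ U`, `u ⊗ v ↦ R(v₍₁₎,u₍₁₎) v₍₂₎ ⊗ u₍₂₎`. -/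
noncomputable def braidLin (ρU : Coaction k H U) (ρV : Coaction k H V) :
    U ⊗[k] V →ₗ[k] V ⊗[k] U :=
  (ρV.ext ρU).act S.R ∘ₗ (TensorProduct.comm k U V).toLinearMap

/-- The inverse of the braiding. -/
noncomputable def braidInvLin (ρU : Coaction k H U) (ρV : Coaction k H V) :
    V ⊗[k] U →ₗ[k] U ⊗[k] V :=
  (TensorProduct.comm k V U).toLinearMap ∘ₗ (ρV.ext ρU).act S.Rinv

section Lemmas

variable {S}
variable (ρT : Coaction k H T) (ρU : Coaction k H U) (ρV : Coaction k H V) (ρW : Coaction k H W)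

lemma act_act_apply {C : Type*} [AddCommMonoid C] [Module k C] [Coalgebra k C]
    (ρ : Coaction k C V) (f g : Functional k C) (x : V) :
    ρ.act g (ρ.act f x) = ρ.act (f * g) x := LinearMap.congr_fun (act_act ρ f g) x

lemma Compat.act_apply {C D : Type*} [AddCommMonoid C] [Module k C] [Coalgebra k C]
    [AddCommMonoid D] [Module k D] [Coalgebra k D] {ρ : Coaction k C V} {ρ' : Coaction k D W}
    {h : C →ₗc[k] D} {L : V →ₗ[k] W}
    (H : Compat ρ ρ' h L) (f : Functional k D) (x : V) : ρ'.act f (L x) = L (ρ.act (pull h f) x) :=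
  LinearMap.congr_fun (H.act f) x

lemma assocLin_inv : assocLin S ρU ρV ρW ∘ₗ assocInvLin S ρU ρV ρW = LinearMap.id := by
  ext u v w
  simp [assocLin, assocInvLin, act_act_apply, S.φinv_φ, act_one]

lemma assocInvLin_assocLin :
    assocInvLin S ρU ρV ρW ∘ₗ assocLin S ρU ρV ρW = LinearMap.id := by
  ext u v w
  simp [assocLin, assocInvLin, act_act_apply, S.φ_φinv, act_one]

lemma braidLin_inv : braidLin S ρU ρV ∘ₗ braidInvLin S ρU ρV = LinearMap.id := by
  ext u v
  simp [braidLin, braidInvLin, act_act_apply, S.Rinv_R, act_one]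

lemma braidInvLin_braidLin : braidInvLin S ρU ρV ∘ₗ braidLin S ρU ρV = LinearMap.id := by
  ext u v
  simp [braidLin, braidInvLin, act_act_apply, S.R_Rinv, act_one]

lemma colinear_inv {ρ : Coaction k H U} {ρ' : Coaction k H V} {L : U →ₗ[k] V} {L' : V →ₗ[k] U}
    (h : ρ'.coact ∘ₗ L = LinearMap.lTensor H L ∘ₗ ρ.coact)
    (h1 : L ∘ₗ L' = LinearMap.id) (h2 : L' ∘ₗ L = LinearMap.id) :
    ρ.coact ∘ₗ L' = LinearMap.lTensor H L' ∘ₗ ρ'.coact := by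
  calc ρ.coact ∘ₗ L' = (LinearMap.lTensor H (L' ∘ₗ L)) ∘ₗ ρ.coact ∘ₗ L' := by rw [h2]; simp
    _ = LinearMap.lTensor H L' ∘ₗ (LinearMap.lTensor H L ∘ₗ ρ.coact) ∘ₗ L' := by
        rw [LinearMap.lTensor_comp]; simp only [LinearMap.comp_assoc]
    _ = _ := by rw [← h, LinearMap.comp_assoc, h1, LinearMap.comp_id]

lemma assocLin_colinear : (tens S (tens S ρU ρV) ρW).coact ∘ₗ assocLin S ρU ρV ρW =
    LinearMap.lTensor H (assocLin S ρU ρV ρW) ∘ₗ (tens S ρU (tens S ρV ρW)).coact := by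
  rw [coact_tens_left, coact_tens_right]
  unfold assocLin
  rw [← LinearMap.comp_assoc, (compat_assocL ρU ρV ρW).push, LinearMap.comp_assoc,
    push_act, LinearMap.lTensor_comp, LinearMap.comp_assoc, lTensor_act_push, S.quasi_assoc]
  rfl

lemma braidLin_colinear : (tens S ρV ρU).coact ∘ₗ braidLin S ρU ρV =
    LinearMap.lTensor H (braidLin S ρU ρV) ∘ₗ (tens S ρU ρV).coact := by
  change (ρV.ext ρU).push S.mul.toLinearMap ∘ₗ _ = _ ∘ₗ (ρU.ext ρV).push S.mul.toLinearMap
  unfold braidLin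
  have h := (compat_flip ρU ρV).push (S.mul.comp (flip k H H)).toLinearMap
  have h2 : (S.mul.comp (flip k H H)).toLinearMap ∘ₗ (flip k H H).toLinearMap =
      S.mul.toLinearMap := by ext; rfl
  rw [h2] at h
  rw [← LinearMap.comp_assoc, push_act, ← S.quasi_comm, LinearMap.lTensor_comp,
    LinearMap.comp_assoc, ← h, ← LinearMap.comp_assoc, lTensor_act_push]

lemma leftUnit_colinear : ρV.coact ∘ₗ (TensorProduct.lid k V).toLinearMap =
    LinearMap.lTensor H (TensorProduct.lid k V).toLinearMap ∘ₗ (tens S (triv S) ρV).coact := by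
  ext v
  simp only [tens, cores, TensorProduct.AlgebraTensorModule.curry_apply,
    LinearMap.restrictScalars_self, TensorProduct.curry_apply, LinearMap.comp_apply,
    ext_coact_tmul, LinearEquiv.coe_coe, TensorProduct.lid_tmul, one_smul, triv,
    TensorProduct.mk_apply]
  induction ρV.coact v with
  | zero => simp
  | add x y hx hy =>
    simp only [TensorProduct.tmul_add, map_add]
    rw [← hx, ← hy]
  | tmul c w => simp [S.one_mul]

lemma rightUnit_colinear : ρV.coact ∘ₗ (TensorProduct.rid k V).toLinearMap =
    LinearMap.lTensor H (TensorProduct.rid k V).toLinearMap ∘ₗ (tens S ρV (triv S)).coact := by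
  ext v
  simp only [tens, cores, TensorProduct.AlgebraTensorModule.curry_apply,
    LinearMap.restrictScalars_self, TensorProduct.curry_apply, LinearMap.comp_apply,
    ext_coact_tmul, LinearEquiv.coe_coe, TensorProduct.rid_tmul, one_smul, triv,
    TensorProduct.mk_apply]
  induction ρV.coact v with
  | zero => simp
  | add x y hx hy =>
    simp only [TensorProduct.add_tmul, map_add]
    rw [← hx, ← hy]
  | tmul c w => simp [S.mul_one]

lemma map_colinear {U' V' : Type*} [AddCommMonoid U'] [Module k U'] [AddCommMonoid V'] [Module k V']
    {ρU : Coaction k H U} {ρV : Coaction k H V}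
    {ρU' : Coaction k H U'} {ρV' : Coaction k H V'} {L : U →ₗ[k] U'} {M : V →ₗ[k] V'}
    (hL : Compat ρU ρU' (.id k H) L) (hM : Compat ρV ρV' (.id k H) M) :
    (tens S ρU' ρV').coact ∘ₗ TensorProduct.map L M =
      LinearMap.lTensor H (TensorProduct.map L M) ∘ₗ (tens S ρU ρV).coact := by
  have h := (hL.ext hM).push S.mul.toLinearMap
  have h2 : S.mul.toLinearMap ∘ₗ (tmap (.id k H) (.id k H)).toLinearMap = S.mul.toLinearMap := by
    ext; rfl
  rw [h2] at h
  exact h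

lemma assocLin_naturality {U' V' W' : Type*} [AddCommMonoid U'] [Module k U'] [AddCommMonoid V']
    [Module k V'] [AddCommMonoid W'] [Module k W']
    {ρU : Coaction k H U} {ρV : Coaction k H V} {ρW : Coaction k H W}
    {ρU' : Coaction k H U'} {ρV' : Coaction k H V'} {ρW' : Coaction k H W'}
    {L : U →ₗ[k] U'} {M : V →ₗ[k] V'} {N : W →ₗ[k] W'}
    (hL : Compat ρU ρU' (.id k H) L) (hM : Compat ρV ρV' (.id k H) M)
    (hN : Compat ρW ρW' (.id k H) N) :
    assocLin S ρU' ρV' ρW' ∘ₗ TensorProduct.map L (TensorProduct.map M N) =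
      TensorProduct.map (TensorProduct.map L M) N ∘ₗ assocLin S ρU ρV ρW := by
  have h := (hL.ext (hM.ext hN)).act S.φ
  have h2 : pull (tmap (.id k H) (tmap (.id k H) (.id k H))) S.φ = S.φ := by
    apply WithConv.ext
    ext; rfl
  rw [h2] at h
  unfold assocLin
  rw [LinearMap.comp_assoc, h, ← LinearMap.comp_assoc, ← LinearMap.comp_assoc]
  congr 1
  ext; rfl

lemma braidLin_naturality {U' V' : Type*} [AddCommMonoid U'] [Module k U'] [AddCommMonoid V']
    [Module k V'] {ρU : Coaction k H U} {ρV : Coaction k H V}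
    {ρU' : Coaction k H U'} {ρV' : Coaction k H V'} {L : U →ₗ[k] U'} {M : V →ₗ[k] V'}
    (hL : Compat ρU ρU' (.id k H) L) (hM : Compat ρV ρV' (.id k H) M) :
    braidLin S ρU' ρV' ∘ₗ TensorProduct.map L M =
      TensorProduct.map M L ∘ₗ braidLin S ρU ρV := by
  have h := (hM.ext hL).act S.R
  have h2 : pull (tmap (.id k H) (.id k H)) S.R = S.R := by
    apply WithConv.ext
    ext; rfl
  rw [h2] at h
  unfold braidLin
  rw [← LinearMap.comp_assoc, ← h, LinearMap.comp_assoc, LinearMap.comp_assoc]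
  congr 1
  ext; rfl

lemma triangle_lin : LinearMap.rTensor V (TensorProduct.rid k U).toLinearMap ∘ₗ
    assocLin S ρU (triv S) ρV = LinearMap.lTensor U (TensorProduct.lid k V).toLinearMap := by
  ext u v
  have hu := LinearMap.congr_fun ρU.counit u
  have hv := LinearMap.congr_fun ρV.counit v
  simp only [LinearMap.comp_apply, LinearEquiv.coe_coe, LinearMap.id_apply] at hu hv
  simp only [TensorProduct.AlgebraTensorModule.curry_apply,
    LinearMap.restrictScalars_self, TensorProduct.curry_apply, LinearMap.comp_apply,
    LinearMap.lTensor_tmul, LinearEquiv.coe_coe, TensorProduct.lid_tmul, one_smul]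
  conv_rhs => rw [← hu, ← hv]
  simp only [assocLin, act, LinearMap.comp_apply, ext_coact_tmul, triv, TensorProduct.mk_apply,
    LinearEquiv.coe_coe]
  generalize ρU.coact u = x
  generalize ρV.coact v = y
  induction x with
  | zero => simp
  | add x y hx hy => simp only [map_add, TensorProduct.add_tmul, hx, hy]
  | tmul c u =>
    induction y with
    | zero => simp
    | add x y hx hy => simp only [map_add, TensorProduct.tmul_add, hx, hy]
    | tmul d w =>
      simp [S.φ_one, TensorProduct.smul_tmul', TensorProduct.tmul_smul, smul_smul, mul_comm]

lemma pull_eq_pull {C D : Type*} [AddCommMonoid C] [Module k C] [Coalgebra k C]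
    [AddCommMonoid D] [Module k D] [Coalgebra k D] {h h' : C →ₗc[k] D}
    (hh : h.toLinearMap = h'.toLinearMap) (f : Functional k D) : pull h f = pull h' f := by
  apply WithConv.ext
  change f.ofConv ∘ₗ h.toLinearMap = f.ofConv ∘ₗ h'.toLinearMap
  rw [hh]

lemma act_ext_tens_left {C : Type*} [AddCommMonoid C] [Module k C] [Coalgebra k C]
    (ρ : Coaction k C W) (f : Functional k (H ⊗[k] C)) :
    ((tens S ρU ρV).ext ρ).act f = ((ρU.ext ρV).ext ρ).act (pull (tmap S.mul (.id k C)) f) := by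
  simpa [tens] using ((compat_cores (ρU.ext ρV) S.mul).ext (compat_id ρ)).act f

lemma act_ext_tens_right {C : Type*} [AddCommMonoid C] [Module k C] [Coalgebra k C]
    (ρ : Coaction k C W) (f : Functional k (C ⊗[k] H)) :
    (ρ.ext (tens S ρU ρV)).act f = (ρ.ext (ρU.ext ρV)).act (pull (tmap (.id k C) S.mul) f) := by
  simpa [tens] using ((compat_id ρ).ext (compat_cores (ρU.ext ρV) S.mul)).act f

lemma act_ext_tens_mid (f : Functional k (H ⊗[k] (H ⊗[k] H))) :
    (ρU.ext ((tens S ρV ρW).ext ρT)).act f = (ρU.ext ((ρV.ext ρW).ext ρT)).act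
      (pull (tmap (.id k H) (tmap S.mul (.id k H))) f) := by
  simpa [tens] using ((compat_id ρU).ext
    ((compat_cores (ρV.ext ρW) S.mul).ext (compat_id ρT))).act f

lemma act_ext_tens_last (f : Functional k (H ⊗[k] (H ⊗[k] H))) :
    (ρU.ext (ρV.ext (tens S ρW ρT))).act f = (ρU.ext (ρV.ext (ρW.ext ρT))).act
      (pull (tmap (.id k H) (tmap (.id k H) S.mul)) f) := by
  simpa [tens] using ((compat_id ρU).ext
    ((compat_id ρV).ext (compat_cores (ρW.ext ρT) S.mul))).act f

lemma pentagon_lin :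
    LinearMap.rTensor T (assocLin S ρU ρV ρW) ∘ₗ assocLin S ρU (tens S ρV ρW) ρT ∘ₗ
      LinearMap.lTensor U (assocLin S ρV ρW ρT) =
    assocLin S (tens S ρU ρV) ρW ρT ∘ₗ assocLin S ρU ρV (tens S ρW ρT) := by
  have hL := compat_assocL ρU ρV (ρW.ext ρT)
  have hA := (compat_id ρU).ext (compat_assocL ρV ρW ρT)
  have hB := hA.comp (compat_assocL ρU (ρV.ext ρW) ρT)
  have e1 : LinearMap.lTensor U (assocLin S ρV ρW ρT) =
      LinearMap.lTensor U (TensorProduct.assoc k V W T).symm.toLinearMap ∘ₗ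
        (ρU.ext (ρV.ext (ρW.ext ρT))).act (pull (dropL k H _) S.φ) := by
    rw [ext_act_dropL, ← LinearMap.lTensor_comp]; rfl
  have e3 : LinearMap.rTensor T (assocLin S ρU ρV ρW) =
      LinearMap.rTensor T (TensorProduct.assoc k U V W).symm.toLinearMap ∘ₗ
        ((ρU.ext (ρV.ext ρW)).ext ρT).act (pull (dropR k _ H) S.φ) := by
    rw [ext_act_dropR, ← LinearMap.rTensor_comp]; rfl
  have e3' : pull ((assocL k H (H ⊗[k] H) H).comp (tmap (.id k H) (assocL k H H H)))
      (pull (dropR k (H ⊗[k] (H ⊗[k] H)) H) S.φ) =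
      pull (tmap (.id k H) (tmap (.id k H) (dropR k H H))) S.φ := by
    rw [pull_pull]
    apply pull_eq_pull
    ext a b c d
    change Coalgebra.counit (R := k) d • (a ⊗ₜ[k] (b ⊗ₜ[k] c)) =
      a ⊗ₜ[k] (b ⊗ₜ[k] (Coalgebra.counit (R := k) d • c))
    simp
  apply LinearMap.ext
  intro x
  have hcoc := S.cocycle
  simp only [LinearMap.comp_apply]
  rw [e1, e3]
  unfold assocLin
  rw [act_ext_tens_mid, act_ext_tens_left, act_ext_tens_last]
  simp only [LinearMap.comp_apply]
  have s1 : ∀ f y, (ρU.ext ((ρV.ext ρW).ext ρT)).act f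
      (LinearMap.lTensor U (TensorProduct.assoc k V W T).symm.toLinearMap y) =
      LinearMap.lTensor U (TensorProduct.assoc k V W T).symm.toLinearMap
        ((ρU.ext (ρV.ext (ρW.ext ρT))).act (pull (tmap (.id k H) (assocL k H H H)) f) y) :=
    fun f y => hA.act_apply f y
  have s2 : ∀ f y, ((ρU.ext (ρV.ext ρW)).ext ρT).act f
      ((TensorProduct.assoc k U (V ⊗[k] W) T).symm
        (LinearMap.lTensor U (TensorProduct.assoc k V W T).symm.toLinearMap y)) =
      (TensorProduct.assoc k U (V ⊗[k] W) T).symm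
        (LinearMap.lTensor U (TensorProduct.assoc k V W T).symm.toLinearMap
        ((ρU.ext (ρV.ext (ρW.ext ρT))).act (pull ((assocL k H (H ⊗[k] H) H).comp
          (tmap (.id k H) (assocL k H H H))) f) y)) :=
    fun f y => hB.act_apply f y
  have s3 : ∀ f y, ((ρU.ext ρV).ext (ρW.ext ρT)).act f
      ((TensorProduct.assoc k U V (W ⊗[k] T)).symm y) =
      (TensorProduct.assoc k U V (W ⊗[k] T)).symm
        ((ρU.ext (ρV.ext (ρW.ext ρT))).act (pull (assocL k H H (H ⊗[k] H)) f) y) :=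
    fun f y => hL.act_apply f y
  simp only [LinearEquiv.coe_coe]
  rw [s1, s2, s3, act_act_apply, act_act_apply, act_act_apply, e3', pull_pull, pull_pull]
  have q1 : (tmap (CoalgHom.id k H) (tmap S.mul (CoalgHom.id k H))).comp
      (tmap (CoalgHom.id k H) (assocL k H H H)) =
      tmap (.id k H) ((tmap S.mul (.id k H)).comp (assocL k H H H)) := by
    apply CoalgHom.ext
    intro y
    exact LinearMap.congr_fun (by ext; rfl : _ = (tmap (.id k H) ((tmap S.mul (.id k H)).comp
      (assocL k H H H))).toLinearMap) y
  rw [q1, ← mul_assoc, hcoc]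
  generalize ((ρU.ext (ρV.ext (ρW.ext ρT))).act _) x = y
  refine LinearMap.congr_fun (f := (LinearMap.rTensor T
    (TensorProduct.assoc k U V W).symm.toLinearMap) ∘ₗ
    (TensorProduct.assoc k U (V ⊗[k] W) T).symm.toLinearMap ∘ₗ
    LinearMap.lTensor U (TensorProduct.assoc k V W T).symm.toLinearMap)
    (g := (TensorProduct.assoc k (U ⊗[k] V) W T).symm.toLinearMap ∘ₗ
      (TensorProduct.assoc k U V (W ⊗[k] T)).symm.toLinearMap) ?_ y
  ext; rfl

end Lemmas

end Coaction

end Raw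


section Hexagon

variable {k : Type u} {H : Type v} [Field k] [AddCommGroup H] [Module k H] [Coalgebra k H]
  {S : CoquasitriangularCoquasibialgebra k H}
  {U V W : Type*} [AddCommMonoid U] [Module k U]
  [AddCommMonoid V] [Module k V] [AddCommMonoid W] [Module k W]
  (ρU : Coaction k H U) (ρV : Coaction k H V) (ρW : Coaction k H W)

namespace Coaction

lemma act_congr {C : Type*} [AddCommMonoid C] [Module k C] [Coalgebra k C]
    {ρ : Coaction k C V} {f g : Functional k C} (h : f.ofConv = g.ofConv) : ρ.act f = ρ.act g := by
  unfold act; rw [h]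

/-- moving the action of a functional past a compatible map -/
lemma Compat.slide {C D : Type*} [AddCommMonoid C] [Module k C] [Coalgebra k C]
    [AddCommMonoid D] [Module k D] [Coalgebra k D] {ρ : Coaction k C V} {ρ' : Coaction k D W}
    {h : C →ₗc[k] D} {L : V →ₗ[k] W} (H : Compat ρ ρ' h L) (h' : D →ₗc[k] C)
    (hh : h'.toLinearMap ∘ₗ h.toLinearMap = LinearMap.id) (f : Functional k C) (x : V) :
    L (ρ.act f x) = ρ'.act (pull h' f) (L x) := by
  rw [H.act_apply]
  congr 1
  refine LinearMap.congr_fun (act_congr ?_) x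
  change f.ofConv = f.ofConv ∘ₗ (h'.toLinearMap ∘ₗ h.toLinearMap)
  rw [hh, LinearMap.comp_id]

lemma lTensor_braidLin : LinearMap.lTensor W (braidLin S ρU ρV) =
    (ρW.ext (ρV.ext ρU)).act (pull (dropL k H (H ⊗[k] H)) S.R) ∘ₗ
      LinearMap.lTensor W (TensorProduct.comm k U V).toLinearMap := by
  rw [ext_act_dropL, ← LinearMap.lTensor_comp]; rfl

lemma rTensor_braidLin : LinearMap.rTensor W (braidLin S ρU ρV) =
    ((ρV.ext ρU).ext ρW).act (pull (dropR k (H ⊗[k] H) H) S.R) ∘ₗ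
      LinearMap.rTensor W (TensorProduct.comm k U V).toLinearMap := by
  rw [ext_act_dropR, ← LinearMap.rTensor_comp]; rfl

lemma hexagon_lin₁ : braidLin S ρU (tens S ρV ρW) =
    assocLin S ρV ρW ρU ∘ₗ LinearMap.lTensor V (braidLin S ρU ρW) ∘ₗ assocInvLin S ρV ρU ρW ∘ₗ
      LinearMap.rTensor W (braidLin S ρU ρV) ∘ₗ assocLin S ρU ρV ρW := by
  have hR := S.R_mul_left
  rw [lTensor_braidLin ρU ρW ρV, rTensor_braidLin ρU ρV ρW]
  apply LinearMap.ext
  intro x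
  simp only [LinearMap.comp_apply, assocLin, assocInvLin, braidLin, LinearEquiv.coe_coe]
  rw [act_ext_tens_left]
  -- `U ⊗ (V ⊗ W) → (U ⊗ V) ⊗ W`
  have s1 : ∀ f y, (TensorProduct.assoc k U V W).symm ((ρU.ext (ρV.ext ρW)).act f y) =
      ((ρU.ext ρV).ext ρW).act (pull (assocR k H H H) f) ((TensorProduct.assoc k U V W).symm y) :=
    fun f y => (compat_assocL ρU ρV ρW).slide _ (by ext; rfl) f y
  -- flip of the first two factors
  have s2 : ∀ f y, LinearMap.rTensor W (TensorProduct.comm k U V).toLinearMap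
      (((ρU.ext ρV).ext ρW).act f y) = ((ρV.ext ρU).ext ρW).act
        (pull (tmap (flip k H H) (.id k H)) f)
        (LinearMap.rTensor W (TensorProduct.comm k U V).toLinearMap y) :=
    fun f y => ((compat_flip ρU ρV).ext (compat_id ρW)).slide _ (by ext; rfl) f y
  have s3 : ∀ f y, (TensorProduct.assoc k V U W) (((ρV.ext ρU).ext ρW).act f y) =
      (ρV.ext (ρU.ext ρW)).act (pull (assocL k H H H) f) ((TensorProduct.assoc k V U W) y) :=
    fun f y => (compat_assocR ρV ρU ρW).slide _ (by ext; rfl) f y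
  have s4 : ∀ f y, LinearMap.lTensor V (TensorProduct.comm k U W).toLinearMap
      ((ρV.ext (ρU.ext ρW)).act f y) = (ρV.ext (ρW.ext ρU)).act
        (pull (tmap (.id k H) (flip k H H)) f)
        (LinearMap.lTensor V (TensorProduct.comm k U W).toLinearMap y) :=
    fun f y => ((compat_id ρV).ext (compat_flip ρU ρW)).slide _ (by ext; rfl) f y
  have s5 : ∀ f y, (TensorProduct.assoc k V W U).symm ((ρV.ext (ρW.ext ρU)).act f y) =
      ((ρV.ext ρW).ext ρU).act (pull (assocR k H H H) f) ((TensorProduct.assoc k V W U).symm y) :=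
    fun f y => (compat_assocL ρV ρW ρU).slide _ (by ext; rfl) f y
  simp only [s1, s2, s3, s4, act_act_apply, map_mul]
  have e1 : pull (tmap (.id k H) (flip k H H)) (pull (assocL k H H H)
      (pull (tmap (flip k H H) (.id k H)) (pull (assocR k H H H) S.φ))) =
      pull ((flip k (H ⊗[k] H) H).comp (assocL k H H H)) S.φ := by
    simp only [pull_pull]
    apply pull_eq_pull
    ext a b c
    rfl
  have e2 : pull (tmap (.id k H) (flip k H H)) (pull (assocL k H H H)
      (pull (dropR k (H ⊗[k] H) H) S.R)) = pull (tmap (.id k H) (dropL k H H)) S.R := by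
    simp only [pull_pull]
    apply pull_eq_pull
    ext a b c
    change Coalgebra.counit (R := k) b • (a ⊗ₜ[k] c) = a ⊗ₜ[k] (Coalgebra.counit (R := k) b • c)
    simp
  rw [e1, e2]
  try simp only [← mul_assoc]
  rw [← hR, s5]
  have e3 : pull (assocR k H H H) (pull ((tmap S.mul (.id k H)).comp (assocL k H H H)) S.R) =
      pull (tmap S.mul (.id k H)) S.R := by
    simp only [pull_pull]
    apply pull_eq_pull
    ext a b c
    rfl
  rw [e3]
  congr 1
  refine LinearMap.congr_fun (f := (TensorProduct.comm k U (V ⊗[k] W)).toLinearMap)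
    (g := (TensorProduct.assoc k V W U).symm.toLinearMap ∘ₗ
      LinearMap.lTensor V (TensorProduct.comm k U W).toLinearMap ∘ₗ
      (TensorProduct.assoc k V U W).toLinearMap ∘ₗ
      LinearMap.rTensor W (TensorProduct.comm k U V).toLinearMap ∘ₗ
      (TensorProduct.assoc k U V W).symm.toLinearMap) ?_ x
  ext; rfl

lemma hexagon_lin₂ : braidLin S (tens S ρU ρV) ρW =
    assocInvLin S ρW ρU ρV ∘ₗ LinearMap.rTensor V (braidLin S ρU ρW) ∘ₗ assocLin S ρU ρW ρV ∘ₗ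
      LinearMap.lTensor U (braidLin S ρV ρW) ∘ₗ assocInvLin S ρU ρV ρW := by
  have hR := S.R_mul_right
  rw [rTensor_braidLin ρU ρW ρV, lTensor_braidLin ρV ρW ρU]
  apply LinearMap.ext
  intro x
  simp only [LinearMap.comp_apply, assocLin, assocInvLin, braidLin, LinearEquiv.coe_coe]
  rw [act_ext_tens_right]
  have s1 : ∀ f y, LinearMap.lTensor U (TensorProduct.comm k V W).toLinearMap
      ((ρU.ext (ρV.ext ρW)).act f y) = (ρU.ext (ρW.ext ρV)).act
        (pull (tmap (.id k H) (flip k H H)) f)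
        (LinearMap.lTensor U (TensorProduct.comm k V W).toLinearMap y) :=
    fun f y => ((compat_id ρU).ext (compat_flip ρV ρW)).slide _ (by ext; rfl) f y
  have s2 : ∀ f y, (TensorProduct.assoc k U W V).symm ((ρU.ext (ρW.ext ρV)).act f y) =
      ((ρU.ext ρW).ext ρV).act (pull (assocR k H H H) f) ((TensorProduct.assoc k U W V).symm y) :=
    fun f y => (compat_assocL ρU ρW ρV).slide _ (by ext; rfl) f y
  have s3 : ∀ f y, LinearMap.rTensor V (TensorProduct.comm k U W).toLinearMap
      (((ρU.ext ρW).ext ρV).act f y) = ((ρW.ext ρU).ext ρV).act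
        (pull (tmap (flip k H H) (.id k H)) f)
        (LinearMap.rTensor V (TensorProduct.comm k U W).toLinearMap y) :=
    fun f y => ((compat_flip ρU ρW).ext (compat_id ρV)).slide _ (by ext; rfl) f y
  have s4 : ∀ f y, (TensorProduct.assoc k W U V) (((ρW.ext ρU).ext ρV).act f y) =
      (ρW.ext (ρU.ext ρV)).act (pull (assocL k H H H) f) ((TensorProduct.assoc k W U V) y) :=
    fun f y => (compat_assocR ρW ρU ρV).slide _ (by ext; rfl) f y
  simp only [s1, s2, s3, s4, act_act_apply, map_mul]
  have e1 : pull (assocL k H H H) (pull (tmap (flip k H H) (.id k H)) (pull (assocR k H H H)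
      (pull (tmap (.id k H) (flip k H H)) S.φinv))) =
      pull ((assocR k H H H).comp (flip k H (H ⊗[k] H))) S.φinv := by
    simp only [pull_pull]
    apply pull_eq_pull
    ext a b c
    rfl
  have e2 : pull (assocL k H H H) (pull (tmap (flip k H H) (.id k H)) (pull (assocR k H H H)
      (pull (dropL k H (H ⊗[k] H)) S.R))) = pull (tmap (.id k H) (dropL k H H)) S.R := by
    simp only [pull_pull]
    apply pull_eq_pull
    ext a b c
    change Coalgebra.counit (R := k) b • (a ⊗ₜ[k] c) = a ⊗ₜ[k] (Coalgebra.counit (R := k) b • c)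
    simp
  have e3 : pull (assocL k H H H) (pull (tmap (flip k H H) (.id k H)) (pull (assocR k H H H)
      S.φ)) = pull (((assocR k H H H).comp (tmap (flip k H H) (.id k H))).comp
        (assocL k H H H)) S.φ := rfl
  have e4 : pull (assocL k H H H) (pull (dropR k (H ⊗[k] H) H) S.R) =
      pull (tmap (.id k H) (dropR k H H)) S.R := by
    simp only [pull_pull]
    apply pull_eq_pull
    ext a b c
    change Coalgebra.counit (R := k) c • (a ⊗ₜ[k] b) = a ⊗ₜ[k] (Coalgebra.counit (R := k) c • b)
    simp
  rw [e1, e2, e3, e4]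
  try simp only [← mul_assoc]
  rw [← hR]
  congr 1
  refine LinearMap.congr_fun (f := (TensorProduct.comm k (U ⊗[k] V) W).toLinearMap)
    (g := (TensorProduct.assoc k W U V).toLinearMap ∘ₗ
      LinearMap.rTensor V (TensorProduct.comm k U W).toLinearMap ∘ₗ
      (TensorProduct.assoc k U W V).symm.toLinearMap ∘ₗ
      LinearMap.lTensor U (TensorProduct.comm k V W).toLinearMap ∘ₗ
      (TensorProduct.assoc k U V W).toLinearMap) ?_ x
  ext; rfl

end Coaction

end Hexagon


section ComoduleCategory

variable {k : Type u} {H : Type v} [Field k] [AddCommGroup H] [Module k H] [Coalgebra k H]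

/-- The objects of the category `H-Com` of left `H`-comodules. -/
structure Comod (S : CoquasitriangularCoquasibialgebra k H) where
  /-- the underlying vector space -/
  carrier : Type u
  [addCommGroup : AddCommGroup carrier]
  [module : Module k carrier]
  /-- the coaction of `H` -/
  ρ : Coaction k H carrier

namespace Comod

open Coaction

variable {S : CoquasitriangularCoquasibialgebra k H}

instance : CoeSort (Comod S) (Type u) := ⟨Comod.carrier⟩

attribute [instance] Comod.addCommGroup Comod.module

/-- The space of comodule morphisms (colinear maps). -/
def homSubmodule (X Y : Comod S) : Submodule k (X →ₗ[k] Y) where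
  carrier := {L | Y.ρ.coact ∘ₗ L = LinearMap.lTensor H L ∘ₗ X.ρ.coact}
  add_mem' {a b} ha hb := by
    simp only [Set.mem_ofPred_eq, LinearMap.lTensor_add, LinearMap.comp_add, LinearMap.add_comp]
      at *
    rw [ha, hb]
  zero_mem' := by simp
  smul_mem' c a ha := by
    simp only [Set.mem_ofPred_eq, LinearMap.lTensor_smul, LinearMap.comp_smul,
      LinearMap.smul_comp] at *
    rw [ha]

instance : Category (Comod S) where
  Hom X Y := homSubmodule X Y
  id X := ⟨LinearMap.id, by simp [homSubmodule]⟩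
  comp {X Y Z} f g := ⟨g.1 ∘ₗ f.1, by
    have hf : Y.ρ.coact ∘ₗ f.1 = _ := f.2
    have hg : Z.ρ.coact ∘ₗ g.1 = _ := g.2
    change Z.ρ.coact ∘ₗ g.1 ∘ₗ f.1 = _
    rw [← LinearMap.comp_assoc, hg, LinearMap.comp_assoc, hf, LinearMap.lTensor_comp,
      LinearMap.comp_assoc]⟩

/-- The underlying linear map of a comodule morphism. -/
def lin {X Y : Comod S} (f : X ⟶ Y) : X →ₗ[k] Y := f.1

/-- A colinear map as a comodule morphism. -/
def homMk {X Y : Comod S} (L : X →ₗ[k] Y)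
    (h : Y.ρ.coact ∘ₗ L = LinearMap.lTensor H L ∘ₗ X.ρ.coact) : X ⟶ Y := ⟨L, h⟩

@[simp] lemma lin_homMk {X Y : Comod S} (L : X →ₗ[k] Y)
    (h : Y.ρ.coact ∘ₗ L = LinearMap.lTensor H L ∘ₗ X.ρ.coact) : lin (homMk L h) = L := rfl

@[simp] lemma lin_id (X : Comod S) : lin (𝟙 X) = LinearMap.id := rfl

@[simp] lemma lin_comp {X Y Z : Comod S} (f : X ⟶ Y) (g : Y ⟶ Z) :
    lin (f ≫ g) = lin g ∘ₗ lin f := rfl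

lemma hom_ext {X Y : Comod S} {f g : X ⟶ Y} (h : lin f = lin g) : f = g :=
  Subtype.ext h

lemma compat_lin {X Y : Comod S} (f : X ⟶ Y) : Compat X.ρ Y.ρ (.id k H) (lin f) := f.2

instance : Preadditive (Comod S) where
  homGroup X Y := inferInstanceAs (AddCommGroup (homSubmodule X Y))
  add_comp _ _ _ _ _ _ := hom_ext (LinearMap.comp_add _ _ _)
  comp_add _ _ _ _ _ _ := hom_ext (LinearMap.add_comp _ _ _)

instance : Linear k (Comod S) where
  homModule X Y := inferInstanceAs (Module k (homSubmodule X Y))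
  smul_comp _ _ _ _ _ _ := hom_ext (LinearMap.comp_smul _ _ _)
  comp_smul _ _ _ _ _ _ := hom_ext (LinearMap.smul_comp _ _ _)

/-- The tensor product of comodules. -/
noncomputable def tensor (X Y : Comod S) : Comod S where
  carrier := X ⊗[k] Y
  ρ := tens S X.ρ Y.ρ

/-- The unit comodule. -/
noncomputable def unit (S : CoquasitriangularCoquasibialgebra k H) : Comod S where
  carrier := k
  ρ := triv S

/-- The tensor product of comodule morphisms. -/
noncomputable def tensorMap {X X' Y Y' : Comod S} (f : X ⟶ X') (g : Y ⟶ Y') :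
    tensor X Y ⟶ tensor X' Y' :=
  homMk (X := tensor X Y) (Y := tensor X' Y') (TensorProduct.map (lin f) (lin g))
    (map_colinear (compat_lin f) (compat_lin g))

/-- An isomorphism of comodules from a pair of mutually inverse linear maps. -/
def isoMk {X Y : Comod S} (L : X →ₗ[k] Y) (M : Y →ₗ[k] X)
    (h : Y.ρ.coact ∘ₗ L = LinearMap.lTensor H L ∘ₗ X.ρ.coact)
    (h1 : L ∘ₗ M = LinearMap.id) (h2 : M ∘ₗ L = LinearMap.id) : X ≅ Y where
  hom := homMk L h
  inv := homMk M (colinear_inv h h1 h2)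
  hom_inv_id := hom_ext h2
  inv_hom_id := hom_ext h1

/-- The associator `Φ : U ⊗ (V ⊗ W) ≅ (U ⊗ V) ⊗ W`. -/
noncomputable def assocIso (X Y Z : Comod S) : tensor X (tensor Y Z) ≅ tensor (tensor X Y) Z :=
  isoMk (X := tensor X (tensor Y Z)) (Y := tensor (tensor X Y) Z)
    (assocLin S X.ρ Y.ρ Z.ρ) (assocInvLin S X.ρ Y.ρ Z.ρ)
    (assocLin_colinear X.ρ Y.ρ Z.ρ) (assocLin_inv X.ρ Y.ρ Z.ρ) (assocInvLin_assocLin X.ρ Y.ρ Z.ρ)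

/-- The braiding `Ψ : U ⊗ V ≅ V ⊗ U`. -/
noncomputable def braidIso (X Y : Comod S) : tensor X Y ≅ tensor Y X :=
  isoMk (X := tensor X Y) (Y := tensor Y X) (braidLin S X.ρ Y.ρ) (braidInvLin S X.ρ Y.ρ)
    (braidLin_colinear X.ρ Y.ρ) (braidLin_inv X.ρ Y.ρ) (braidInvLin_braidLin X.ρ Y.ρ)

/-- The left unit isomorphism `k ⊗ V ≅ V`. -/
noncomputable def leftUnit (X : Comod S) : tensor (unit S) X ≅ X :=
  isoMk (X := tensor (unit S) X) (Y := X) (TensorProduct.lid k X).toLinearMap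
    (TensorProduct.lid k X).symm.toLinearMap (leftUnit_colinear X.ρ) (LinearEquiv.comp_symm _)
    (LinearEquiv.symm_comp _)

/-- The right unit isomorphism `V ⊗ k ≅ V`. -/
noncomputable def rightUnit (X : Comod S) : tensor X (unit S) ≅ X :=
  isoMk (X := tensor X (unit S)) (Y := X) (TensorProduct.rid k X).toLinearMap
    (TensorProduct.rid k X).symm.toLinearMap (rightUnit_colinear X.ρ) (LinearEquiv.comp_symm _)
    (LinearEquiv.symm_comp _)

noncomputable instance : MonoidalCategoryStruct (Comod S) where
  tensorObj := tensor
  tensorUnit := unit S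
  tensorHom f g := tensorMap f g
  whiskerLeft X _ _ f := tensorMap (𝟙 X) f
  whiskerRight f Y := tensorMap f (𝟙 Y)
  associator X Y Z := (assocIso X Y Z).symm
  leftUnitor := leftUnit
  rightUnitor := rightUnit

lemma lin_tensorHom {X X' Y Y' : Comod S} (f : X ⟶ X') (g : Y ⟶ Y') :
    lin (f ⊗ₘ g) = TensorProduct.map (lin f) (lin g) := rfl
lemma lin_whiskerLeft {X Y Y' : Comod S} (f : Y ⟶ Y') :
    lin (X ◁ f) = LinearMap.lTensor X (lin f) := rfl
lemma lin_whiskerRight {X Y Y' : Comod S} (f : Y ⟶ Y') :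
    lin (f ▷ X) = LinearMap.rTensor X (lin f) := rfl
lemma lin_associator_hom (X Y Z : Comod S) :
    lin (α_ X Y Z).hom = assocInvLin S X.ρ Y.ρ Z.ρ := rfl
lemma lin_associator_inv (X Y Z : Comod S) :
    lin (α_ X Y Z).inv = assocLin S X.ρ Y.ρ Z.ρ := rfl

noncomputable instance : MonoidalCategory (Comod S) where
  tensorHom_def f g := by
    apply hom_ext
    change TensorProduct.map (lin f) (lin g) = TensorProduct.map LinearMap.id (lin g) ∘ₗ
      TensorProduct.map (lin f) LinearMap.id
    rw [← TensorProduct.map_comp]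
    simp
  id_tensorHom_id X Y := hom_ext TensorProduct.map_id
  tensorHom_comp_tensorHom f₁ f₂ g₁ g₂ := by
    apply hom_ext
    exact (TensorProduct.map_comp _ _ _ _).symm
  whiskerLeft_id X Y := hom_ext TensorProduct.map_id
  id_whiskerRight X Y := hom_ext TensorProduct.map_id
  associator_naturality {X₁ X₂ X₃ Y₁ Y₂ Y₃} f₁ f₂ f₃ := by
    have h : (f₁ ⊗ₘ (f₂ ⊗ₘ f₃)) ≫ (assocIso Y₁ Y₂ Y₃).hom =
        (assocIso X₁ X₂ X₃).hom ≫ ((f₁ ⊗ₘ f₂) ⊗ₘ f₃) :=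
      hom_ext (assocLin_naturality (compat_lin f₁) (compat_lin f₂) (compat_lin f₃))
    change ((f₁ ⊗ₘ f₂) ⊗ₘ f₃) ≫ (assocIso Y₁ Y₂ Y₃).inv =
      (assocIso X₁ X₂ X₃).inv ≫ (f₁ ⊗ₘ (f₂ ⊗ₘ f₃))
    erw [Iso.comp_inv_eq, Category.assoc, h, Iso.inv_hom_id_assoc]
  leftUnitor_naturality {X Y} f := by
    apply hom_ext
    change (TensorProduct.lid k Y).toLinearMap ∘ₗ TensorProduct.map LinearMap.id (lin f) =
      lin f ∘ₗ (TensorProduct.lid k X).toLinearMap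
    ext; simp
  rightUnitor_naturality {X Y} f := by
    apply hom_ext
    change (TensorProduct.rid k Y).toLinearMap ∘ₗ TensorProduct.map (lin f) LinearMap.id =
      lin f ∘ₗ (TensorProduct.rid k X).toLinearMap
    ext; simp
  pentagon W X Y Z := by
    have h : (W ◁ (α_ X Y Z).inv ≫ (α_ W (X ⊗ Y) Z).inv) ≫ ((α_ W X Y).inv ▷ Z) =
        (α_ W X (Y ⊗ Z)).inv ≫ (α_ (W ⊗ X) Y Z).inv :=
      hom_ext (pentagon_lin Z.ρ W.ρ X.ρ Y.ρ)
    have h1 : ((α_ W X Y).hom ▷ Z) ≫ ((α_ W X Y).inv ▷ Z) = 𝟙 _ :=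
      hom_ext ((LinearMap.rTensor_comp _ _ _).symm.trans
        ((congrArg (LinearMap.rTensor Z.carrier) (assocLin_inv W.ρ X.ρ Y.ρ)).trans
        (LinearMap.rTensor_id _ _)))
    have h1' : ((α_ W X Y).inv ▷ Z) ≫ ((α_ W X Y).hom ▷ Z) = 𝟙 _ :=
      hom_ext ((LinearMap.rTensor_comp _ _ _).symm.trans
        ((congrArg (LinearMap.rTensor Z.carrier) (assocInvLin_assocLin W.ρ X.ρ Y.ρ)).trans
        (LinearMap.rTensor_id _ _)))
    have h2 : (W ◁ (α_ X Y Z).inv) ≫ (W ◁ (α_ X Y Z).hom) = 𝟙 _ :=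
      hom_ext ((LinearMap.lTensor_comp _ _ _).symm.trans
        ((congrArg (LinearMap.lTensor W.carrier) (assocInvLin_assocLin X.ρ Y.ρ Z.ρ)).trans
        (LinearMap.lTensor_id _ _)))
    have h3 : (α_ W X (Y ⊗ Z)).inv ≫ (α_ (W ⊗ X) Y Z).inv ≫ ((α_ W X Y).hom ▷ Z) ≫
        (α_ W (X ⊗ Y) Z).hom ≫ (W ◁ (α_ X Y Z).hom) = 𝟙 _ := by
      rw [← Category.assoc, ← h]
      simp only [Category.assoc]
      rw [reassoc_of% h1', Iso.inv_hom_id_assoc, h2]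
    have h4 := congrArg (fun t => (α_ (W ⊗ X) Y Z).hom ≫ (α_ W X (Y ⊗ Z)).hom ≫ t) h3
    simpa using h4
  triangle X Y := by
    have h : (α_ X (unit S) Y).inv ≫ ((rightUnit X).hom ▷ Y) = X ◁ (leftUnit Y).hom :=
      hom_ext (triangle_lin X.ρ Y.ρ)
    change (α_ X (unit S) Y).hom ≫ X ◁ (leftUnit Y).hom = (rightUnit X).hom ▷ Y
    rw [← h, Iso.hom_inv_id_assoc]

noncomputable instance : BraidedCategory (Comod S) where
  braiding := braidIso
  braiding_naturality_right X _ _ f := hom_ext (braidLin_naturality (compat_id _) (compat_lin f))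
  braiding_naturality_left f Z := hom_ext (braidLin_naturality (compat_lin f) (compat_id _))
  hexagon_forward X Y Z := by
    have h : (braidIso X (Y ⊗ Z)).hom = (α_ X Y Z).inv ≫ ((braidIso X Y).hom ▷ Z) ≫
        (α_ Y X Z).hom ≫ (Y ◁ (braidIso X Z).hom) ≫ (α_ Y Z X).inv :=
      hom_ext (hexagon_lin₁ X.ρ Y.ρ Z.ρ)
    rw [h]
    simp
  hexagon_reverse X Y Z := by
    have h : (braidIso (X ⊗ Y) Z).hom = (α_ X Y Z).hom ≫ (X ◁ (braidIso Y Z).hom) ≫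
        (α_ X Z Y).inv ≫ ((braidIso X Z).hom ▷ Y) ≫ (α_ Z X Y).hom :=
      hom_ext (hexagon_lin₂ X.ρ Y.ρ Z.ρ)
    rw [h]
    simp

end Comod

end ComoduleCategory


section Bar

open FreeMonoidalCategory

/-- Bracketed words in one letter, possibly containing units: the ways of bracketing a tensor
power of an object. -/
abbrev Word : Type := FreeMonoidalCategory PUnit.{1}

namespace Word

/-- The letter. -/
abbrev letter : Word := FreeMonoidalCategory.of PUnit.unit

/-- The number of letters of a word. -/
def len : Word → ℕ
  | .of _ => 1
  | .unit => 0
  | .tensor x y => len x + len y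

@[simp] lemma len_tensor (x y : Word) : len (x ⊗ y) = len x + len y := rfl
@[simp] lemma len_unit : len (𝟙_ Word) = 0 := rfl
@[simp] lemma len_letter : len letter = 1 := rfl

/-- The word `((a ⊗ a) ⊗ a) ⊗ ⋯` with `n` letters (the unit for `n = 0`), bracketed from left to
right. -/
def lr : ℕ → Word
  | 0 => 𝟙_ Word
  | 1 => letter
  | n + 2 => lr (n + 1) ⊗ letter

@[simp] lemma len_lr : ∀ n, len (lr n) = n
  | 0 => rfl
  | 1 => rfl
  | n + 2 => by simp [lr, len_lr (n + 1)]

lemma nonempty_lr_tensor_letter : ∀ n, Nonempty (lr n ⊗ letter ⟶ lr (n + 1))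
  | 0 => ⟨(λ_ letter).hom⟩
  | _ + 1 => ⟨𝟙 _⟩

lemma nonempty_lr_add (m : ℕ) : ∀ n, Nonempty (lr m ⊗ lr n ⟶ lr (m + n))
  | 0 => ⟨(ρ_ _).hom⟩
  | 1 => nonempty_lr_tensor_letter m
  | n + 2 => by
    obtain ⟨f⟩ := nonempty_lr_add m (n + 1)
    obtain ⟨g⟩ := nonempty_lr_tensor_letter (m + (n + 1))
    exact ⟨(α_ _ _ _).inv ≫ (f ▷ letter) ≫ g⟩

lemma nonempty_to_lr : ∀ s : Word, Nonempty (s ⟶ lr (len s))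
  | .of _ => ⟨𝟙 _⟩
  | .unit => ⟨𝟙 _⟩
  | .tensor x y => by
    obtain ⟨f⟩ := nonempty_to_lr x
    obtain ⟨g⟩ := nonempty_to_lr y
    obtain ⟨h⟩ := nonempty_lr_add (len x) (len y)
    exact ⟨(f ⊗ₘ g) ≫ h⟩

lemma nonempty_hom {s t : Word} (h : len s = len t) : Nonempty (s ⟶ t) := by
  obtain ⟨f⟩ := nonempty_to_lr s
  obtain ⟨g⟩ := nonempty_to_lr t
  rw [← h] at g
  exact ⟨f ≫ Groupoid.inv g⟩

end Word

open Word

/-- The bracketings of an `n`-fold tensor power. -/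
abbrev Bracketing (n : ℕ) : Type := {s : Word // len s = n}

namespace Bracketing

lemma len_eq {n : ℕ} (s t : Bracketing n) : len s.1 = len t.1 := s.2.trans t.2.symm

/-- The bracketing from left to right. -/
abbrev lr (n : ℕ) : Bracketing n := ⟨Word.lr n, len_lr n⟩

end Bracketing

section Ev

variable {C : Type*} [Category C] [MonoidalCategory C] (A : C)

/-- The object of `C` obtained by bracketing a tensor power of `A` according to a word; on
morphisms, the canonical isomorphisms given by the associativity and unit constraints. -/
abbrev ev : Word ⥤ C := FreeMonoidalCategory.project fun _ => A

/-- The canonical isomorphism between two bracketings of a tensor power of `A`. -/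
noncomputable def can {s t : Word} (h : len s = len t) : (ev A).obj s ⟶ (ev A).obj t :=
  (ev A).map (Classical.choice (nonempty_hom h))

/-- By coherence, any composite of associativity and unit constraints is the canonical
isomorphism. -/
lemma ev_map_eq_can {s t : Word} (f : s ⟶ t) (h : len s = len t) :
    (ev A).map f = can A h := by
  unfold can
  congr 1
  exact Subsingleton.elim _ _

@[simp] lemma can_self {s : Word} (h : len s = len s) : can A h = 𝟙 _ := by
  rw [← ev_map_eq_can A (𝟙 s) h, (ev A).map_id]

@[simp] lemma can_can {s t u : Word} (h : len s = len t) (h' : len t = len u) :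
    can A h ≫ can A h' = can A (h.trans h') := by
  obtain ⟨f⟩ := nonempty_hom h
  obtain ⟨g⟩ := nonempty_hom h'
  rw [← ev_map_eq_can A f, ← ev_map_eq_can A g, ← ev_map_eq_can A (f ≫ g), (ev A).map_comp]

@[simp] lemma can_can_assoc {s t u : Word} (h : len s = len t) (h' : len t = len u) {Z : C}
    (f : (ev A).obj u ⟶ Z) :
    can A h ≫ can A h' ≫ f = can A (h.trans h') ≫ f := by
  rw [← Category.assoc, can_can]

end Ev

variable (k : Type*) [Field k] {C : Type*} [Category C] [Preadditive C] [Linear k C]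
  [MonoidalCategory C]

/-- Morphisms `A^{⊗m} → A^{⊗n}` in the strictification of `C`: families consisting of one morphism
for each choice of a bracketing of the source and of the target, which are carried to each other
by the canonical isomorphisms (that is, classes of morphisms between bracketed tensor powers up to
canonical isomorphisms, each class being given by the family of all its members). -/
def powHom (A : C) (m n : ℕ) :
    Submodule k (∀ (s : Bracketing m) (t : Bracketing n), (ev A).obj s.1 ⟶ (ev A).obj t.1) where
  carrier := {f | ∀ (s : Bracketing m) (t : Bracketing n) (s' : Bracketing m) (t' : Bracketing n),
    f s' t' = can A (s'.len_eq s) ≫ f s t ≫ can A (t.len_eq t')}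
  add_mem' {f g} hf hg s t s' t' := by
    simp only [Pi.add_apply]
    rw [hf s t s' t', hg s t s' t']
    simp
  zero_mem' s t s' t' := by simp
  smul_mem' c f hf s t s' t' := by
    simp only [Pi.smul_apply]
    rw [hf s t s' t']
    simp

/-- The full subcategory of the strictification of `C` on the tensor powers of `A`. -/
structure TPow (k : Type*) [Field k] {C : Type*} [Category C] [Preadditive C] [Linear k C]
    [MonoidalCategory C] (A : C) where
  /-- the exponent -/
  deg : ℕ

/-- The object `A^{⊗n}` of the strictification. -/
abbrev tpow (A : C) (n : ℕ) : TPow k A := ⟨n⟩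

namespace TPow

variable {k} {A : C}

noncomputable instance : Category (TPow k A) where
  Hom X Y := powHom k A X.deg Y.deg
  id X := ⟨fun s t => can A (s.len_eq t), fun s t s' t' => by simp⟩
  comp {X Y Z} f g := ⟨fun s u => f.1 s (.lr Y.deg) ≫ g.1 (.lr Y.deg) u, fun s t s' t' => by
    beta_reduce
    rw [f.2 s (.lr Y.deg) s' (.lr Y.deg), g.2 (.lr Y.deg) t (.lr Y.deg) t']
    simp⟩
  id_comp {X Y} f := by
    apply Subtype.ext
    funext s t
    simp only
    rw [f.2 s t (.lr X.deg) t]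
    simp
  comp_id {X Y} f := by
    apply Subtype.ext
    funext s t
    simp only
    rw [f.2 s t s (.lr Y.deg)]
    simp
  assoc f g h := by
    apply Subtype.ext
    funext s t
    simp

/-- The representative of a morphism of the strictification for given bracketings of its source
and of its target. -/
def rep {m n : ℕ} (f : tpow k A m ⟶ tpow k A n) (s : Bracketing m) (t : Bracketing n) :
    (ev A).obj s.1 ⟶ (ev A).obj t.1 := f.1 s t

lemma rep_eq {m n : ℕ} (f : tpow k A m ⟶ tpow k A n) (s : Bracketing m) (t : Bracketing n)
    (s' : Bracketing m) (t' : Bracketing n) :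
    rep f s' t' = can A (s'.len_eq s) ≫ rep f s t ≫ can A (t.len_eq t') := f.2 s t s' t'

/-- The morphism of the strictification represented by a morphism between bracketed tensor
powers. -/
noncomputable def ofRep {m n : ℕ} (s : Bracketing m) (t : Bracketing n)
    (f : (ev A).obj s.1 ⟶ (ev A).obj t.1) : tpow k A m ⟶ tpow k A n :=
  ⟨fun s' t' => can A (s'.len_eq s) ≫ f ≫ can A (t.len_eq t'), fun s₁ t₁ s₂ t₂ => by simp⟩

@[simp] lemma rep_ofRep {m n : ℕ} (s : Bracketing m) (t : Bracketing n)
    (f : (ev A).obj s.1 ⟶ (ev A).obj t.1) : rep (ofRep (k := k) s t f) s t = f := by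
  simp [rep, ofRep]

lemma hom_ext {m n : ℕ} {f g : tpow k A m ⟶ tpow k A n} (s : Bracketing m) (t : Bracketing n)
    (h : rep f s t = rep g s t) : f = g := by
  apply Subtype.ext
  funext s' t'
  change rep f s' t' = rep g s' t'
  rw [rep_eq f s t, rep_eq g s t, h]

lemma rep_comp {l m n : ℕ} (f : tpow k A l ⟶ tpow k A m) (g : tpow k A m ⟶ tpow k A n)
    (s : Bracketing l) (t : Bracketing m) (u : Bracketing n) :
    rep (f ≫ g) s u = rep f s t ≫ rep g t u := by
  change rep f s (.lr m) ≫ rep g (.lr m) u = _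
  rw [rep_eq f s t s (.lr m), rep_eq g t u (.lr m) u]
  simp

lemma ofRep_comp {l m n : ℕ} (s : Bracketing l) (t : Bracketing m) (u : Bracketing n)
    (f : (ev A).obj s.1 ⟶ (ev A).obj t.1) (g : (ev A).obj t.1 ⟶ (ev A).obj u.1) :
    ofRep s t f ≫ ofRep t u g = ofRep (k := k) s u (f ≫ g) := by
  apply hom_ext s u
  rw [rep_comp _ _ s t u]
  simp

/-- Two representatives of the same morphism. -/
lemma ofRep_eq {m n : ℕ} {s s' : Bracketing m} {t t' : Bracketing n}
    {f : (ev A).obj s.1 ⟶ (ev A).obj t.1} {f' : (ev A).obj s'.1 ⟶ (ev A).obj t'.1}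
    (a : s.1 ⟶ s'.1) (b : t.1 ⟶ t'.1) (h : f ≫ (ev A).map b = (ev A).map a ≫ f') :
    ofRep (k := k) s t f = ofRep s' t' f' := by
  apply hom_ext s' t'
  rw [rep_eq _ s t, rep_ofRep, rep_ofRep]
  rw [ev_map_eq_can A b (t.len_eq t'), ev_map_eq_can A a (s.len_eq s')] at h
  rw [h]
  simp

lemma ofRep_map {n : ℕ} (s t : Bracketing n) (a : s.1 ⟶ t.1) :
    ofRep (k := k) s t ((ev A).map a) = 𝟙 _ := by
  rw [ev_map_eq_can A a (s.len_eq t)]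
  apply hom_ext s t
  rw [rep_ofRep]
  rfl

noncomputable instance : Preadditive (TPow k A) where
  homGroup X Y := inferInstanceAs (AddCommGroup (powHom k A X.deg Y.deg))
  add_comp _ _ _ _ _ _ := by
    apply Subtype.ext
    funext s t
    exact Preadditive.add_comp _ _ _ _ _ _
  comp_add _ _ _ _ _ _ := by
    apply Subtype.ext
    funext s t
    exact Preadditive.comp_add _ _ _ _ _ _

noncomputable instance : Linear k (TPow k A) where
  homModule X Y := inferInstanceAs (Module k (powHom k A X.deg Y.deg))
  smul_comp _ _ _ _ _ _ := by
    apply Subtype.ext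
    funext s t
    exact Linear.smul_comp _ _ _ _ _ _
  comp_smul _ _ _ _ _ _ := by
    apply Subtype.ext
    funext s t
    exact Linear.comp_smul _ _ _ _ _ _

end TPow

end Bar

section Bracketed

variable {C : Type*} [Category C] [MonoidalCategory C]

/-- The category of bracketed tensor powers of `A`: its objects are the bracketed words, and its
morphisms are those of `C` between the corresponding bracketed tensor powers. -/
structure BPow (A : C) where
  /-- the bracketing -/
  word : Word

namespace BPow

variable {A : C}

instance : Category (BPow A) where
  Hom s t := (ev A).obj s.word ⟶ (ev A).obj t.word
  id s := 𝟙 ((ev A).obj s.word)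
  comp {s t u} f g := CategoryStruct.comp (X := (ev A).obj s.word) (Y := (ev A).obj t.word)
    (Z := (ev A).obj u.word) f g
  id_comp f := Category.id_comp (obj := C) f
  comp_id f := Category.comp_id (obj := C) f
  assoc f g h := Category.assoc (obj := C) f g h

/-- A morphism of bracketed tensor powers as a morphism of `C`. -/
abbrev toC {s t : BPow A} (f : s ⟶ t) : (ev A).obj s.word ⟶ (ev A).obj t.word := f

/-- A morphism of `C` between bracketed tensor powers. -/
abbrev ofC {s t : BPow A} (f : (ev A).obj s.word ⟶ (ev A).obj t.word) : s ⟶ t := f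

/-- An isomorphism of `C` between bracketed tensor powers. -/
def isoOfC {s t : BPow A} (e : (ev A).obj s.word ≅ (ev A).obj t.word) : s ≅ t where
  hom := e.hom
  inv := e.inv
  hom_inv_id := e.hom_inv_id
  inv_hom_id := e.inv_hom_id

instance : MonoidalCategoryStruct (BPow A) where
  tensorObj s t := ⟨s.word ⊗ t.word⟩
  tensorUnit := ⟨𝟙_ Word⟩
  whiskerLeft s _ _ f := (ev A).obj s.word ◁ toC f
  whiskerRight f t := toC f ▷ (ev A).obj t.word
  tensorHom f g := toC f ⊗ₘ toC g
  associator s t u := isoOfC (s := ⟨(s.word ⊗ t.word) ⊗ u.word⟩) (t := ⟨s.word ⊗ (t.word ⊗ u.word)⟩)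
    (α_ ((ev A).obj s.word) ((ev A).obj t.word) ((ev A).obj u.word))
  leftUnitor s := isoOfC (s := ⟨𝟙_ Word ⊗ s.word⟩) (λ_ ((ev A).obj s.word))
  rightUnitor s := isoOfC (s := ⟨s.word ⊗ 𝟙_ Word⟩) (ρ_ ((ev A).obj s.word))

instance : MonoidalCategory (BPow A) where
  tensorHom_def f g := MonoidalCategory.tensorHom_def (C := C) f g
  id_tensorHom_id _ _ := MonoidalCategory.id_tensorHom_id (C := C) _ _
  tensorHom_comp_tensorHom f₁ f₂ g₁ g₂ :=
    MonoidalCategory.tensorHom_comp_tensorHom (C := C) f₁ f₂ g₁ g₂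
  whiskerLeft_id _ _ := MonoidalCategory.whiskerLeft_id (C := C) _ _
  id_whiskerRight _ _ := MonoidalCategory.id_whiskerRight (C := C) _ _
  associator_naturality f g h := MonoidalCategory.associator_naturality (C := C) f g h
  leftUnitor_naturality f := MonoidalCategory.leftUnitor_naturality (C := C) f
  rightUnitor_naturality f := MonoidalCategory.rightUnitor_naturality (C := C) f
  pentagon _ _ _ _ := MonoidalCategory.pentagon (C := C) _ _ _ _
  triangle _ _ := MonoidalCategory.triangle (C := C) _ _

instance [BraidedCategory C] : BraidedCategory (BPow A) where
  braiding s t := isoOfC (s := ⟨s.word ⊗ t.word⟩) (t := ⟨t.word ⊗ s.word⟩)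
    (β_ ((ev A).obj s.word) ((ev A).obj t.word))
  braiding_naturality_right _ _ _ f := BraidedCategory.braiding_naturality_right (C := C) _ f
  braiding_naturality_left f _ := BraidedCategory.braiding_naturality_left (C := C) f _
  hexagon_forward _ _ _ := BraidedCategory.hexagon_forward (C := C) _ _ _
  hexagon_reverse _ _ _ := BraidedCategory.hexagon_reverse (C := C) _ _ _

/-- `A` itself, as a bracketed tensor power. -/
abbrev base (A : C) : BPow A := ⟨Word.letter⟩

instance [MonObj A] : MonObj (base A) where
  one := (MonObj.one : 𝟙_ C ⟶ A)
  mul := (MonObj.mul : A ⊗ A ⟶ A)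
  one_mul := MonObj.one_mul A
  mul_one := MonObj.mul_one A
  mul_assoc := MonObj.mul_assoc A

/-- An endomorphism of `A`, as a morphism of bracketed tensor powers. -/
abbrev ofEnd (f : A ⟶ A) : base A ⟶ base A := f

/-- The number of tensor factors. -/
def len (s : BPow A) : ℕ := s.word.len

@[simp] lemma len_tensor (x y : BPow A) : len (x ⊗ y) = len x + len y := rfl
@[simp] lemma len_unit : len (𝟙_ (BPow A)) = 0 := rfl
@[simp] lemma len_base : len (base A) = 1 := rfl

/-- The tensor power of `A` bracketed from left to right. -/
def lr (A : C) (n : ℕ) : BPow A := ⟨Word.lr n⟩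

@[simp] lemma len_lr (n : ℕ) : len (lr A n) = n := Word.len_lr n

/-- Composites of associativity and unit constraints. -/
def IsCan {s t : BPow A} (f : s ⟶ t) : Prop := ∃ a : s.word ⟶ t.word, f = (ev A).map a

lemma IsCan.id (s : BPow A) : IsCan (𝟙 s) := ⟨𝟙 _, ((ev A).map_id _).symm⟩
lemma IsCan.comp {s t u : BPow A} {f : s ⟶ t} {g : t ⟶ u} : IsCan f → IsCan g → IsCan (f ≫ g) := by
  rintro ⟨a, rfl⟩ ⟨b, rfl⟩
  exact ⟨a ≫ b, ((ev A).map_comp a b).symm⟩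
lemma IsCan.whiskerLeft (x : BPow A) {s t : BPow A} {f : s ⟶ t} : IsCan f → IsCan (x ◁ f) := by
  rintro ⟨a, rfl⟩
  refine ⟨x.word ◁ a, ?_⟩
  induction a using Quotient.recOn <;> rfl
lemma IsCan.whiskerRight (x : BPow A) {s t : BPow A} {f : s ⟶ t} : IsCan f → IsCan (f ▷ x) := by
  rintro ⟨a, rfl⟩
  refine ⟨a ▷ x.word, ?_⟩
  induction a using Quotient.recOn <;> rfl
lemma IsCan.assoc_hom (x y z : BPow A) : IsCan (α_ x y z).hom :=
  ⟨(α_ x.word y.word z.word).hom, rfl⟩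
lemma IsCan.assoc_inv (x y z : BPow A) : IsCan (α_ x y z).inv :=
  ⟨(α_ x.word y.word z.word).inv, rfl⟩
lemma IsCan.left_hom (x : BPow A) : IsCan (λ_ x).hom := ⟨(λ_ x.word).hom, rfl⟩
lemma IsCan.right_hom (x : BPow A) : IsCan (ρ_ x).hom := ⟨(ρ_ x.word).hom, rfl⟩

lemma IsCan.left_inv (x : BPow A) : IsCan (λ_ x).inv := ⟨(λ_ x.word).inv, rfl⟩

lemma exists_can {s t : BPow A} (h : len s = len t) : ∃ f : s ⟶ t, IsCan f := by
  obtain ⟨a⟩ := Word.nonempty_hom h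
  exact ⟨(ev A).map a, a, rfl⟩

end BPow

end Bracketed

section Operators

open BPow MonObj

variable {k : Type*} [Field k] {C : Type*} [Category C] [Preadditive C] [Linear k C]
  [MonoidalCategory C]

namespace TPow

variable {A : C}

/-- The morphism of the strictification represented by a morphism between bracketed tensor
powers. -/
noncomputable def cls {m n : ℕ} {s t : BPow A} (f : s ⟶ t) (hs : len s = m) (ht : len t = n) :
    tpow k A m ⟶ tpow k A n :=
  ofRep ⟨s.word, hs⟩ ⟨t.word, ht⟩ (toC f)

lemma cls_comp {l m n : ℕ} {s t u : BPow A} (f : s ⟶ t) (g : t ⟶ u) (hs : len s = l)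
    (ht : len t = m) (hu : len u = n) :
    cls (k := k) f hs ht ≫ cls g ht hu = cls (f ≫ g) hs hu :=
  ofRep_comp ⟨s.word, hs⟩ ⟨t.word, ht⟩ ⟨u.word, hu⟩ f g

/-- Two representatives of the same morphism. -/
lemma cls_eq {m n : ℕ} {s t s' t' : BPow A} {f : s ⟶ t} {f' : s' ⟶ t'} {hs : len s = m}
    {ht : len t = n} {hs' : len s' = m} {ht' : len t' = n} (a : s ⟶ s') (b : t ⟶ t')
    (ha : IsCan a) (hb : IsCan b) (h : f ≫ b = a ≫ f') :
    cls (k := k) f hs ht = cls f' hs' ht' := by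
  obtain ⟨a', rfl⟩ := ha
  obtain ⟨b', rfl⟩ := hb
  exact ofRep_eq (s := ⟨s.word, hs⟩) (s' := ⟨s'.word, hs'⟩) (t := ⟨t.word, ht⟩)
    (t' := ⟨t'.word, ht'⟩) a' b' h

lemma cls_can {n : ℕ} {s t : BPow A} (a : s ⟶ t) (ha : IsCan a) (hs : len s = n)
    (ht : len t = n) : cls (k := k) a hs ht = 𝟙 _ := by
  obtain ⟨a', rfl⟩ := ha
  exact ofRep_map (⟨s.word, hs⟩ : Bracketing n) (⟨t.word, ht⟩ : Bracketing n) a'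

/-- The morphism `id ⊗ f ⊗ id : A^{⊗m} → A^{⊗n}` of the strictification, where the identities are
those of the bracketed tensor powers `x` and `y`. -/
noncomputable def slot {m n : ℕ} (x y : BPow A) {s t : BPow A} (f : s ⟶ t)
    (hm : len (x ⊗ (s ⊗ y)) = m) (hn : len (x ⊗ (t ⊗ y)) = n) :
    tpow k A m ⟶ tpow k A n :=
  cls (x ◁ (f ▷ y)) hm hn

lemma slot_eq {m n : ℕ} {x y x' y' : BPow A} {s t : BPow A} (f : s ⟶ t)
    (hm : len (x ⊗ (s ⊗ y)) = m) (hn : len (x ⊗ (t ⊗ y)) = n)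
    (hx : len x = len x') (hy : len y = len y') :
    slot (k := k) x y f hm hn = slot x' y' f (by simp at *; omega) (by simp at *; omega) := by
  obtain ⟨a, ha⟩ := exists_can hx
  obtain ⟨b, hb⟩ := exists_can hy
  refine cls_eq (x ◁ (s ◁ b) ≫ a ▷ _) (x ◁ (t ◁ b) ≫ a ▷ _)
    (((hb.whiskerLeft _).whiskerLeft _).comp (ha.whiskerRight _))
    (((hb.whiskerLeft _).whiskerLeft _).comp (ha.whiskerRight _)) ?_
  rw [Category.assoc, ← whisker_exchange a (f ▷ y'), ← whiskerLeft_comp_assoc,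
    ← whiskerLeft_comp_assoc, whisker_exchange f b]

lemma slot_comp {l m n : ℕ} {x y : BPow A} {s t u : BPow A} (f : s ⟶ t) (g : t ⟶ u)
    (hl : len (x ⊗ (s ⊗ y)) = l) (hm : len (x ⊗ (t ⊗ y)) = m) (hn : len (x ⊗ (u ⊗ y)) = n) :
    slot (k := k) x y f hl hm ≫ slot x y g hm hn = slot x y (f ≫ g) hl hn := by
  unfold slot
  rw [cls_comp]
  simp

lemma slot_can {n : ℕ} {x y : BPow A} {s t : BPow A} (a : s ⟶ t) (ha : IsCan a)
    (hm : len (x ⊗ (s ⊗ y)) = n) (hn : len (x ⊗ (t ⊗ y)) = n) :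
    slot (k := k) x y a hm hn = 𝟙 (tpow k A n) :=
  cls_can _ ((ha.whiskerRight _).whiskerLeft _) _ _

lemma slot_whiskerRight {m n : ℕ} {x y r : BPow A} {s t : BPow A} (f : s ⟶ t)
    (hm : len (x ⊗ ((s ⊗ r) ⊗ y)) = m) (hn : len (x ⊗ ((t ⊗ r) ⊗ y)) = n)
    (hm' : len (x ⊗ (s ⊗ (r ⊗ y))) = m) (hn' : len (x ⊗ (t ⊗ (r ⊗ y))) = n) :
    slot (k := k) x y (f ▷ r) hm hn = slot x (r ⊗ y) f hm' hn' := by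
  refine cls_eq (x ◁ (α_ s r y).hom) (x ◁ (α_ t r y).hom) ((IsCan.assoc_hom _ _ _).whiskerLeft _)
    ((IsCan.assoc_hom _ _ _).whiskerLeft _) ?_
  rw [← whiskerLeft_comp, ← whiskerLeft_comp, associator_naturality_left]

lemma slot_whiskerLeft {m n : ℕ} {x y q : BPow A} {s t : BPow A} (f : s ⟶ t)
    (hm : len (x ⊗ ((q ⊗ s) ⊗ y)) = m) (hn : len (x ⊗ ((q ⊗ t) ⊗ y)) = n)
    (hm' : len ((x ⊗ q) ⊗ (s ⊗ y)) = m) (hn' : len ((x ⊗ q) ⊗ (t ⊗ y)) = n) :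
    slot (k := k) x y (q ◁ f) hm hn = slot (x ⊗ q) y f hm' hn' := by
  refine cls_eq (x ◁ (α_ q s y).hom ≫ (α_ x q (s ⊗ y)).inv)
    (x ◁ (α_ q t y).hom ≫ (α_ x q (t ⊗ y)).inv)
    (((IsCan.assoc_hom _ _ _).whiskerLeft _).comp (IsCan.assoc_inv _ _ _))
    (((IsCan.assoc_hom _ _ _).whiskerLeft _).comp (IsCan.assoc_inv _ _ _)) ?_
  simp

lemma slot_unit_left {m n : ℕ} {y : BPow A} {s t : BPow A} (f : s ⟶ t)
    (hm : len (𝟙_ _ ⊗ (s ⊗ y)) = m) (hn : len (𝟙_ _ ⊗ (t ⊗ y)) = n)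
    (hm' : len (s ⊗ y) = m) (hn' : len (t ⊗ y) = n) :
    slot (k := k) (𝟙_ _) y f hm hn = cls (f ▷ y) hm' hn' :=
  cls_eq (λ_ _).hom (λ_ _).hom (IsCan.left_hom _) (IsCan.left_hom _) (leftUnitor_naturality _)

lemma slot_unit_right {m n : ℕ} {x : BPow A} {s t : BPow A} (f : s ⟶ t)
    (hm : len (x ⊗ (s ⊗ 𝟙_ _)) = m) (hn : len (x ⊗ (t ⊗ 𝟙_ _)) = n)
    (hm' : len (x ⊗ s) = m) (hn' : len (x ⊗ t) = n) :
    slot (k := k) x (𝟙_ _) f hm hn = cls (x ◁ f) hm' hn' :=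
  cls_eq (x ◁ (ρ_ _).hom) (x ◁ (ρ_ _).hom) ((IsCan.right_hom _).whiskerLeft _)
    ((IsCan.right_hom _).whiskerLeft _)
    (by rw [← whiskerLeft_comp, ← whiskerLeft_comp, rightUnitor_naturality])

/-- Morphisms applied to disjoint tensor factors commute. -/
lemma slot_interchange {m n m' n' : ℕ} {x₁ x₂ x₁' x₂' y₁ y₁' y₂ y₂' : BPow A} {s t s' t' : BPow A}
    (f : s ⟶ t) (g : s' ⟶ t')
    (h1 : len (x₁ ⊗ (s ⊗ y₁)) = m) (h2 : len (x₁ ⊗ (t ⊗ y₁)) = n)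
    (h3 : len (x₁' ⊗ (s' ⊗ y₁')) = n) (h4 : len (x₁' ⊗ (t' ⊗ y₁')) = n')
    (h5 : len (x₂' ⊗ (s' ⊗ y₂')) = m) (h6 : len (x₂' ⊗ (t' ⊗ y₂')) = m')
    (h7 : len (x₂ ⊗ (s ⊗ y₂)) = m') (h8 : len (x₂ ⊗ (t ⊗ y₂)) = n')
    (hx : len x₁ = len x₂) (hy : len y₁' = len y₂') (hle : len x₁ + len t ≤ len x₁') :
    slot (k := k) x₁ y₁ f h1 h2 ≫ slot x₁' y₁' g h3 h4 =
      slot x₂' y₂' g h5 h6 ≫ slot x₂ y₂ f h7 h8 := by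
  obtain ⟨c, hc⟩ := Nat.exists_eq_add_of_le hle
  let z := lr A c
  have hz : len z = c := len_lr c
  simp only [len_tensor] at h1 h2 h3 h4 h5 h6 h7 h8
  have e1 : slot (k := k) x₁ y₁ f h1 h2 = slot x₁ y₁' (f ▷ (z ⊗ s')) (by simp; omega)
      (by simp; omega) := by
    rw [slot_whiskerRight f _ _ (by simp; omega) (by simp; omega)]
    exact slot_eq f _ _ rfl (by simp; omega)
  have e2 : slot (k := k) x₂ y₂ f h7 h8 = slot x₁ y₁' (f ▷ (z ⊗ t')) (by simp; omega)
      (by simp; omega) := by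
    rw [slot_whiskerRight f _ _ (by simp; omega) (by simp; omega)]
    exact slot_eq f _ _ hx.symm (by simp; omega)
  have e3 : slot (k := k) x₁' y₁' g h3 h4 = slot x₁ y₁' (t ◁ (z ◁ g)) (by simp; omega)
      (by simp; omega) := by
    rw [slot_whiskerLeft (z ◁ g) _ _ (by simp; omega) (by simp; omega),
      slot_whiskerLeft g _ _ (by simp; omega) (by simp; omega)]
    exact slot_eq g _ _ (by simp; omega) rfl
  have e4 : slot (k := k) x₂' y₂' g h5 h6 = slot x₁ y₁' (s ◁ (z ◁ g)) (by simp; omega)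
      (by simp; omega) := by
    rw [slot_whiskerLeft (z ◁ g) _ _ (by simp; omega) (by simp; omega),
      slot_whiskerLeft g _ _ (by simp; omega) (by simp; omega)]
    exact slot_eq g _ _ (by simp; omega) hy.symm
  rw [e1, e2, e3, e4, slot_comp, slot_comp]
  congr 1
  exact (whisker_exchange _ _).symm

variable [MonObj A]

/-- `id ⊗ m ⊗ id : A^{⊗(n+2)} → A^{⊗(n+1)}`, multiplying the tensor factors number `i` and `i + 1`
(counted from `0`). -/
noncomputable def mulAt (n i : ℕ) (hi : i ≤ n) : tpow k A (n + 2) ⟶ tpow k A (n + 1) :=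
  slot (lr A i) (lr A (n - i)) (μ : base A ⊗ base A ⟶ base A) (by simp; omega) (by simp; omega)

/-- `id ⊗ η ⊗ id : A^{⊗(n+1)} → A^{⊗(n+2)}`, inserting a unit after the tensor factor
number `i` (counted from `0`). -/
noncomputable def unitAt (n i : ℕ) (hi : i ≤ n) : tpow k A (n + 1) ⟶ tpow k A (n + 2) :=
  slot (lr A (i + 1)) (lr A (n - i)) (η : 𝟙_ (BPow A) ⟶ base A) (by simp; omega) (by simp; omega)

lemma mulAt_eq {n i : ℕ} (hi : i ≤ n) (x y : BPow A)
    (hm : len (x ⊗ ((base A ⊗ base A) ⊗ y)) = n + 2)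
    (hn : len (x ⊗ (base A ⊗ y)) = n + 1) (hx : len x = i) :
    mulAt (k := k) (A := A) n i hi = slot x y (μ : base A ⊗ base A ⟶ base A) hm hn :=
  slot_eq _ _ _ (by simp [hx]) (by simp at *; omega)

lemma unitAt_eq {n i : ℕ} (hi : i ≤ n) (x y : BPow A)
    (hm : len (x ⊗ (𝟙_ (BPow A) ⊗ y)) = n + 1)
    (hn : len (x ⊗ (base A ⊗ y)) = n + 2) (hx : len x = i + 1) :
    unitAt (k := k) (A := A) n i hi = slot x y (η : 𝟙_ (BPow A) ⟶ base A) hm hn :=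
  slot_eq _ _ _ (by simp [hx]) (by simp at *; omega)

lemma mulAt_mulAt {n i j : ℕ} (hij : i < j) (hj : j ≤ n + 1) :
    mulAt (k := k) (A := A) (n + 1) j hj ≫ mulAt n i (by omega) =
      mulAt (n + 1) i (by omega) ≫ mulAt n (j - 1) (by omega) := by
  rcases Nat.lt_or_ge (i + 1) j with h | h
  · symm
    exact slot_interchange _ _ _ _ _ _ _ _ _ _ (by simp) (by simp; omega) (by simp; omega)
  · obtain rfl : j = i + 1 := by omega
    let x := lr A i
    let y := lr A (n - i)
    have h1 : mulAt (k := k) (A := A) (n + 1) (i + 1) hj = slot x y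
        (base A ◁ (μ : base A ⊗ base A ⟶ base A)) (by simp [x, y]; omega)
        (by simp [x, y]; omega) := by
      rw [slot_whiskerLeft _ _ _ (by simp [x, y]; omega) (by simp [x, y]; omega)]
      exact mulAt_eq _ _ _ _ _ (by simp [x])
    have h2 : mulAt (k := k) (A := A) (n + 1) i (by omega) = slot x y
        ((μ : base A ⊗ base A ⟶ base A) ▷ base A) (by simp [x, y]; omega)
        (by simp [x, y]; omega) := by
      rw [slot_whiskerRight _ _ _ (by simp [x, y]; omega) (by simp [x, y]; omega)]
      exact mulAt_eq _ _ _ _ _ (by simp [x])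
    rw [h1, h2]
    unfold mulAt
    simp only [Nat.add_sub_cancel]
    rw [slot_comp, slot_comp]
    have h3 := slot_can (k := k) (n := n + 3) (x := x) (y := y)
      (α_ (base A) (base A) (base A)).hom (IsCan.assoc_hom _ _ _) (by simp [x, y]; omega)
      (by simp [x, y]; omega)
    rw [← Category.id_comp (slot x y (base A ◁ (μ : base A ⊗ base A ⟶ base A) ≫ μ) _ _), ← h3,
      slot_comp, MonObj.mul_assoc]

lemma unitAt_unitAt {n i j : ℕ} (hij : i ≤ j) (hj : j ≤ n) :
    unitAt (k := k) (A := A) n j hj ≫ unitAt (n + 1) i (by omega) =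
      unitAt n i (by omega) ≫ unitAt (n + 1) (j + 1) (by omega) := by
  symm
  exact slot_interchange _ _ _ _ _ _ _ _ _ _ (by simp) (by simp) (by simp; omega)

lemma unitAt_mulAt_lt {n i j : ℕ} (hij : i < j) (hj : j ≤ n + 1) :
    unitAt (k := k) (A := A) (n + 1) j hj ≫ mulAt (n + 1) i (by omega) =
      mulAt n i (by omega) ≫ unitAt n (j - 1) (by omega) := by
  symm
  exact slot_interchange _ _ _ _ _ _ _ _ _ _ (by simp) (by simp; omega) (by simp; omega)

lemma unitAt_mulAt_gt {n i j : ℕ} (hij : j + 1 < i) (hj : i ≤ n + 1) :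
    unitAt (k := k) (A := A) (n + 1) j (by omega) ≫ mulAt (n + 1) i hj =
      mulAt n (i - 1) (by omega) ≫ unitAt n j (by omega) :=
  slot_interchange _ _ _ _ _ _ _ _ _ _ (by simp) (by simp; omega) (by simp; omega)

lemma unitAt_mulAt_self {n i : ℕ} (hi : i ≤ n) :
    unitAt (k := k) (A := A) n i hi ≫ mulAt n i hi = 𝟙 _ := by
  let x := lr A i
  let y := lr A (n - i)
  have h1 : unitAt (k := k) (A := A) n i hi = slot x y
      (base A ◁ (η : 𝟙_ (BPow A) ⟶ base A)) (by simp [x, y]; omega) (by simp [x, y]; omega) := by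
    rw [slot_whiskerLeft _ _ _ (by simp [x, y]; omega) (by simp [x, y]; omega)]
    exact unitAt_eq _ _ _ _ _ (by simp [x])
  rw [h1, mulAt, slot_comp, MonObj.mul_one]
  exact slot_can _ (IsCan.right_hom _) _ _

/-- inserting a unit in front of the factor number `i` and multiplying -/
lemma slot_unit_mulAt {n i : ℕ} (hi : i ≤ n) (x y : BPow A) (hx : len x = i)
    (hm : len (x ⊗ (𝟙_ (BPow A) ⊗ y)) = n + 1) (hn : len (x ⊗ (base A ⊗ y)) = n + 2) :
    slot (k := k) x y (η : 𝟙_ (BPow A) ⟶ base A) hm hn ≫ mulAt n i hi = 𝟙 _ := by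
  have hy : len y = n - i + 1 := by simp at hm; omega
  let y' := lr A (n - i)
  have h1 : slot (k := k) x y (η : 𝟙_ (BPow A) ⟶ base A) hm hn = slot x y'
      ((η : 𝟙_ (BPow A) ⟶ base A) ▷ base A) (by simp [y']; omega) (by simp [y']; omega) := by
    rw [slot_whiskerRight _ _ _ (by simp [y']; omega) (by simp [y']; omega)]
    exact slot_eq _ _ _ rfl (by simp [y']; omega)
  rw [h1, mulAt_eq hi x y' (by simp [y']; omega) (by simp [y']; omega) hx, slot_comp,
    MonObj.one_mul]
  exact slot_can _ (IsCan.left_hom _) _ _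

lemma unitAt_mulAt_succ {n i : ℕ} (hi : i + 1 ≤ n) :
    unitAt (k := k) (A := A) n i (by omega) ≫ mulAt n (i + 1) hi = 𝟙 _ :=
  slot_unit_mulAt hi _ _ (by simp) _ _

end TPow

end Operators

section Ribbon

open MonObj

/-- A ribbon structure on an algebra `A` in a braided monoidal category: an automorphism `σ` of the
object `A` with `m (σ ⊗ σ) Ψ² = σ m` and `σ η = η`. -/
structure IsRibbon {C : Type*} [Category C] [MonoidalCategory C] [BraidedCategory C] {A : C}
    [MonObj A] (σ : A ≅ A) : Prop where
  mul : ((β_ A A).hom ≫ (β_ A A).hom) ≫ (σ.hom ⊗ₘ σ.hom) ≫ μ = μ ≫ σ.hom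
  unit : η ≫ σ.hom = η

end Ribbon

section Braid

variable {C : Type*} [Category C] [MonoidalCategory C] [BraidedCategory C]

lemma braid_square (X a : C) :
    (β_ (X ⊗ a) a).hom ≫ (α_ a X a).inv ≫ (β_ (a ⊗ X) a).hom ≫ (α_ a a X).inv =
      (α_ X a a).hom ≫ (β_ X (a ⊗ a)).hom ≫ ((β_ a a).hom ≫ (β_ a a).hom) ▷ X := by
  have h := BraidedCategory.braiding_naturality_right X (β_ a a).hom
  rw [comp_whiskerRight, ← reassoc_of% h]
  simp [BraidedCategory.braiding_tensor_left_hom, BraidedCategory.braiding_tensor_right_hom]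

lemma braid_square_end (X a : C) (s : a ⟶ a) :
    (((β_ (X ⊗ a) a).hom ≫ s ▷ (X ⊗ a)) ≫ (α_ a X a).inv ≫
      ((β_ (a ⊗ X) a).hom ≫ s ▷ (a ⊗ X))) ≫ (α_ a a X).inv =
      (α_ X a a).hom ≫ (β_ X (a ⊗ a)).hom ≫
        (((β_ a a).hom ≫ (β_ a a).hom) ≫ (s ⊗ₘ s)) ▷ X := by
  rw [comp_whiskerRight, ← reassoc_of% (braid_square X a)]
  have h1 : s ▷ (X ⊗ a) ≫ (α_ a X a).inv = (α_ a X a).inv ≫ (s ▷ X) ▷ a := by simp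
  have h2 := BraidedCategory.braiding_naturality_left (s ▷ X) a
  simp only [Category.assoc]
  rw [reassoc_of% h1, reassoc_of% h2]
  congr 3
  rw [tensorHom_def']
  simp

end Braid

section Rotation

open BPow MonObj

variable {k : Type*} [Field k] {C : Type*} [Category C] [Preadditive C] [Linear k C]
  [MonoidalCategory C] [BraidedCategory C]

namespace TPow

variable {A : C}

/-- `(σ ⊗ id) Ψ_{n,1} : A^{⊗(n+1)} → A^{⊗(n+1)}`, moving the last tensor factor to the front by the
braiding of `A^{⊗n}` with `A` and then applying `σ` to it. -/
noncomputable def rot (σ : A ≅ A) (n : ℕ) : tpow k A (n + 1) ⟶ tpow k A (n + 1) :=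
  cls ((β_ (lr A n) (base A)).hom ≫ ofEnd σ.hom ▷ lr A n) (by simp) (by simp; omega)

variable (σ : A ≅ A)

lemma rot_eq {n : ℕ} (x : BPow A) (h1 : len (x ⊗ base A) = n + 1)
    (h2 : len (base A ⊗ x) = n + 1) :
    rot (k := k) σ n = cls ((β_ x (base A)).hom ≫ ofEnd σ.hom ▷ x) h1 h2 := by
  obtain ⟨a, ha⟩ := exists_can (s := lr A n) (t := x) (by simp at *; omega)
  refine cls_eq (a ▷ _) (_ ◁ a) (ha.whiskerRight _) (ha.whiskerLeft _) ?_
  rw [Category.assoc, ← whisker_exchange, BraidedCategory.braiding_naturality_left_assoc]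

/-- `(σ ⊗ id) Ψ_{n,1}` and morphisms not touching the last tensor factor -/
lemma slot_rot {m n : ℕ} {x y x' y' : BPow A} {s t : BPow A} (f : s ⟶ t)
    (h1 : len (x ⊗ (s ⊗ y)) = m + 1) (h2 : len (x ⊗ (t ⊗ y)) = n + 1)
    (h3 : len (x' ⊗ (s ⊗ y')) = m + 1) (h4 : len (x' ⊗ (t ⊗ y')) = n + 1)
    (hx : len x' = len x + 1) (hy : len y = len y' + 1) :
    slot (k := k) x y f h1 h2 ≫ rot σ n = rot σ m ≫ slot x' y' f h3 h4 := by
  simp only [len_tensor] at h1 h2 h3 h4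
  have e1 : slot (k := k) x y f h1 h2 = cls ((x ◁ (f ▷ y')) ▷ base A)
      (by simp; omega) (by simp; omega) := by
    rw [slot_eq f h1 h2 (x' := x) (y' := y' ⊗ base A) rfl (by simp [hy])]
    refine cls_eq (x ◁ (α_ _ _ _).inv ≫ (α_ _ _ _).inv) (x ◁ (α_ _ _ _).inv ≫ (α_ _ _ _).inv)
      (((IsCan.assoc_inv _ _ _).whiskerLeft _).comp (IsCan.assoc_inv _ _ _))
      (((IsCan.assoc_inv _ _ _).whiskerLeft _).comp (IsCan.assoc_inv _ _ _)) ?_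
    simp
  have e2 : slot (k := k) x' y' f h3 h4 = cls (base A ◁ (x ◁ (f ▷ y')))
      (by simp; omega) (by simp; omega) := by
    rw [slot_eq f h3 h4 (x' := base A ⊗ x) (y' := y') (by simp; omega) rfl]
    refine cls_eq (α_ _ _ _).hom (α_ _ _ _).hom (IsCan.assoc_hom _ _ _) (IsCan.assoc_hom _ _ _) ?_
    simp
  rw [e1, e2, rot_eq σ (x ⊗ (t ⊗ y')) (by simp; omega) (by simp; omega),
    rot_eq σ (x ⊗ (s ⊗ y')) (by simp; omega) (by simp; omega), cls_comp, cls_comp]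
  congr 1
  rw [Category.assoc, ← whisker_exchange, BraidedCategory.braiding_naturality_left_assoc]

/-- The square of `(σ ⊗ id) Ψ_{n,1}`. -/
lemma rot_rot {n : ℕ} (x : BPow A) (h1 : len (x ⊗ (base A ⊗ base A)) = n + 1)
    (h2 : len ((base A ⊗ base A) ⊗ x) = n + 1) :
    rot (k := k) σ n ≫ rot σ n = cls ((β_ x (base A ⊗ base A)).hom ≫
      ((((β_ (base A) (base A)).hom ≫ (β_ (base A) (base A)).hom) ≫
        (ofEnd σ.hom ⊗ₘ ofEnd σ.hom)) ▷ x)) h1 h2 := by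
  simp only [len_tensor, len_base] at h1 h2
  have h3 : rot (k := k) σ n ≫ rot σ n =
      cls (((β_ (x ⊗ base A) (base A)).hom ≫ ofEnd σ.hom ▷ (x ⊗ base A)) ≫
        (α_ (base A) x (base A)).inv ≫
        ((β_ (base A ⊗ x) (base A)).hom ≫ ofEnd σ.hom ▷ (base A ⊗ x)))
        (by simp; omega) (by simp; omega) := by
    have hc := cls_can (k := k) (n := n + 1) (α_ (base A) x (base A)).inv (IsCan.assoc_inv _ _ _)
      (by simp; omega) (by simp; omega)
    have hl := rot_eq (k := k) σ (n := n) (x ⊗ base A) (by simp; omega) (by simp; omega)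
    have hr := rot_eq (k := k) σ (n := n) (base A ⊗ x) (by simp; omega) (by simp; omega)
    rw [← cls_comp (k := k) (m := n + 1) ((β_ (x ⊗ base A) (base A)).hom ≫ _) _ (by simp; omega)
      (by simp; omega) (by simp; omega), ← cls_comp (k := k) (m := n + 1) (α_ _ _ _).inv _
      (by simp; omega) (by simp; omega) (by simp; omega), hc, ← hl, ← hr, Category.id_comp]
  rw [h3]
  refine cls_eq (α_ _ _ _).hom (α_ _ _ _).inv (IsCan.assoc_hom _ _ _) (IsCan.assoc_inv _ _ _) ?_
  exact braid_square_end x (base A) (ofEnd σ.hom)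

variable [MonObj A]

lemma rot_mulAt {n i : ℕ} (hi : i + 1 ≤ n) :
    rot (k := k) σ (n + 1) ≫ mulAt n (i + 1) hi = mulAt n i (by omega) ≫ rot σ n :=
  (slot_rot σ _ _ _ _ _ (by simp) (by simp; omega)).symm

lemma rot_unitAt {n i : ℕ} (hi : i + 1 ≤ n) :
    rot (k := k) σ n ≫ unitAt n (i + 1) hi = unitAt n i (by omega) ≫ rot σ (n + 1) :=
  (slot_rot σ _ _ _ _ _ (by simp) (by simp; omega)).symm

variable {σ}

lemma rot_rot_mulAt (hσ : IsRibbon σ) (n : ℕ) :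
    rot (k := k) σ (n + 1) ≫ rot σ (n + 1) ≫ mulAt n 0 (by omega) = mulAt n n le_rfl ≫ rot σ n := by
  let x := lr A n
  have h1 : mulAt (k := k) (A := A) n 0 (by omega) =
      cls ((μ : base A ⊗ base A ⟶ base A) ▷ x) (by simp [x]; omega) (by simp [x]; omega) := by
    rw [mulAt_eq (by omega) (𝟙_ _) x (by simp [x]; omega) (by simp [x]; omega) (by simp)]
    exact slot_unit_left _ _ _ _ _
  have h2 : mulAt (k := k) (A := A) n n le_rfl =
      cls (x ◁ (μ : base A ⊗ base A ⟶ base A)) (by simp [x]) (by simp [x]) := by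
    rw [mulAt_eq (by omega) x (𝟙_ _) (by simp [x]) (by simp [x]) (by simp [x])]
    exact slot_unit_right _ _ _ _ _
  rw [← Category.assoc, rot_rot σ x (by simp [x]) (by simp [x]; omega), h1, h2, rot, cls_comp,
    cls_comp]
  congr 1
  have h3 : ((β_ (base A) (base A)).hom ≫ (β_ (base A) (base A)).hom) ≫
      (ofEnd σ.hom ⊗ₘ ofEnd σ.hom) ≫ (μ : base A ⊗ base A ⟶ base A) = μ ≫ ofEnd σ.hom := hσ.mul
  rw [Category.assoc, ← comp_whiskerRight, Category.assoc, h3, comp_whiskerRight,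
    BraidedCategory.braiding_naturality_right_assoc]

lemma rot_unitAt_zero (hσ : IsRibbon σ) (n : ℕ) :
    rot (k := k) σ n ≫ unitAt n 0 (by omega) = unitAt n n le_rfl ≫ rot σ (n + 1) ≫ rot σ (n + 1) := by
  let x := lr A n
  have h1 : unitAt (k := k) (A := A) n 0 (by omega) =
      cls ((base A ◁ (η : 𝟙_ (BPow A) ⟶ base A)) ▷ x) (by simp [x]; omega)
        (by simp [x]; omega) := by
    rw [unitAt_eq (by omega) (𝟙_ _ ⊗ base A) x (by simp [x]; omega) (by simp [x]; omega) (by simp),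
      ← slot_whiskerLeft _ (by simp [x]; omega) (by simp [x]; omega)]
    exact slot_unit_left _ _ _ _ _
  have h2 : unitAt (k := k) (A := A) n n le_rfl =
      cls (x ◁ (base A ◁ (η : 𝟙_ (BPow A) ⟶ base A))) (by simp [x]) (by simp [x]) := by
    rw [unitAt_eq (by omega) (x ⊗ base A) (𝟙_ _) (by simp [x]) (by simp [x]) (by simp [x]),
      ← slot_whiskerLeft _ (by simp [x]) (by simp [x])]
    exact slot_unit_right _ _ _ _ _
  have h3 : rot (k := k) σ n = cls ((β_ x (base A ⊗ 𝟙_ _)).hom ≫ (ofEnd σ.hom ▷ 𝟙_ _) ▷ x)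
      (by simp [x]) (by simp [x]; omega) := by
    symm
    refine cls_eq (x ◁ (ρ_ _).hom) ((ρ_ _).hom ▷ x) ((IsCan.right_hom _).whiskerLeft _)
      ((IsCan.right_hom _).whiskerRight _) ?_
    rw [Category.assoc, ← comp_whiskerRight, rightUnitor_naturality, comp_whiskerRight,
      BraidedCategory.braiding_naturality_right_assoc]
  have h4 : (η : 𝟙_ (BPow A) ⟶ base A) ≫ ofEnd σ.hom = η := hσ.unit
  have h5 : (base A ◁ (η : 𝟙_ (BPow A) ⟶ base A)) ≫ ((β_ (base A) (base A)).hom ≫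
      (β_ (base A) (base A)).hom) ≫ (ofEnd σ.hom ⊗ₘ ofEnd σ.hom) =
      (ofEnd σ.hom ▷ 𝟙_ _) ≫ (base A ◁ (η : 𝟙_ (BPow A) ⟶ base A)) := by
    have e1 := BraidedCategory.braiding_naturality_right (base A) (η : 𝟙_ (BPow A) ⟶ base A)
    have e2 := BraidedCategory.braiding_naturality_left (η : 𝟙_ (BPow A) ⟶ base A) (base A)
    rw [Category.assoc, reassoc_of% e1, reassoc_of% e2, tensorHom_def', ← whiskerLeft_comp_assoc,
      h4, ← whisker_exchange]
    simp
  rw [rot_rot σ x (by simp [x]) (by simp [x]; omega), h1, h2, cls_comp, h3, cls_comp]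
  congr 1
  rw [BraidedCategory.braiding_naturality_right_assoc, ← comp_whiskerRight, h5, comp_whiskerRight,
    Category.assoc]

lemma unitAt_rot (hσ : IsRibbon σ) (n : ℕ) : unitAt (k := k) (A := A) n n le_rfl ≫ rot σ (n + 1) =
    slot (𝟙_ (BPow A)) (lr A (n + 1)) (η : 𝟙_ (BPow A) ⟶ base A) (by simp) (by simp; omega) := by
  let x := lr A (n + 1)
  have h2 : unitAt (k := k) (A := A) n n le_rfl =
      cls (x ◁ (η : 𝟙_ (BPow A) ⟶ base A)) (by simp [x]) (by simp [x]) := by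
    rw [unitAt_eq (by omega) x (𝟙_ _) (by simp [x]) (by simp [x]) (by simp [x])]
    exact slot_unit_right _ _ _ _ _
  have h4 : (η : 𝟙_ (BPow A) ⟶ base A) ≫ ofEnd σ.hom = η := hσ.unit
  rw [h2, rot, cls_comp, slot_unit_left _ _ _ (by simp) (by simp; omega)]
  refine cls_eq ((ρ_ _).hom ≫ (λ_ _).inv) (𝟙 _) ((IsCan.right_hom _).comp (IsCan.left_inv _))
    (IsCan.id _) ?_
  rw [BraidedCategory.braiding_naturality_right_assoc, ← comp_whiskerRight, h4]
  simp [x]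

/-- The morphisms `d_i : A^{⊗(n+2)} → A^{⊗(n+1)}` for `0 ≤ i ≤ n + 1`: the multiplication of the
factors number `i` and `i + 1` if `i ≤ n`, and `(m ⊗ id) (σ ⊗ id) Ψ_{n+1,1}` if `i = n + 1`. -/
noncomputable def face (σ : A ≅ A) (n i : ℕ) : tpow k A (n + 2) ⟶ tpow k A (n + 1) :=
  if h : i ≤ n then mulAt n i h else rot σ (n + 1) ≫ mulAt n 0 (Nat.zero_le n)

lemma face_of_le (σ : A ≅ A) {n i : ℕ} (h : i ≤ n) : face (k := k) σ n i = mulAt n i h := dif_pos h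

lemma face_last (σ : A ≅ A) (n : ℕ) :
    face (k := k) σ n (n + 1) = rot σ (n + 1) ≫ mulAt n 0 (Nat.zero_le n) := dif_neg (by omega)

lemma face_face (hσ : IsRibbon σ) {n i j : ℕ} (hij : i < j) (hj : j ≤ n + 2) :
    face (k := k) σ (n + 1) j ≫ face σ n i = face σ (n + 1) i ≫ face σ n (j - 1) := by
  rcases Nat.lt_or_ge (n + 1) j with h | h
  · obtain rfl : j = n + 2 := by omega
    simp only [Nat.add_sub_cancel, show n + 2 - 1 = n + 1 by omega]
    rw [face_last, face_last]
    rcases Nat.lt_or_ge n i with h' | h'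
    · obtain rfl : i = n + 1 := by omega
      rw [face_last, face_of_le σ (le_refl (n + 1)), ← Category.assoc (mulAt (n + 1) (n + 1) _),
        ← rot_rot_mulAt hσ (n + 1)]
      have h1 := rot_mulAt (k := k) σ (n := n + 1) (i := 0) (by omega)
      have h2 := mulAt_mulAt (k := k) (A := A) (n := n) (i := 0) (j := 1) (by omega) (by omega)
      simp only [Nat.zero_add, Nat.sub_self] at h1 h2
      simp only [Category.assoc]
      rw [← reassoc_of% h1, h2]
    · rw [face_of_le σ h', face_of_le σ (show i ≤ n + 1 by omega),
        ← Category.assoc (mulAt (n + 1) i _), ← rot_mulAt σ (show i + 1 ≤ n + 1 by omega)]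
      have h2 := mulAt_mulAt (k := k) (A := A) (n := n) (i := 0) (j := i + 1) (by omega) (by omega)
      simp only [Category.assoc]
      rw [h2]
      rfl
  · rw [face_of_le σ h, face_of_le σ (show i ≤ n by omega),
      face_of_le σ (show i ≤ n + 1 by omega), face_of_le σ (show j - 1 ≤ n by omega)]
    exact mulAt_mulAt hij h

lemma unitAt_face_lt (σ : A ≅ A) {n i j : ℕ} (hij : i < j) (hj : j ≤ n + 1) :
    unitAt (k := k) (A := A) (n + 1) j hj ≫ face σ (n + 1) i =
      face σ n i ≫ unitAt n (j - 1) (by omega) := by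
  rw [face_of_le σ (show i ≤ n + 1 by omega), face_of_le σ (show i ≤ n by omega)]
  exact unitAt_mulAt_lt hij hj

lemma unitAt_face_self (σ : A ≅ A) {n i : ℕ} (hi : i ≤ n) :
    unitAt (k := k) (A := A) n i hi ≫ face σ n i = 𝟙 _ := by
  rw [face_of_le σ hi]
  exact unitAt_mulAt_self hi

lemma unitAt_face_succ (hσ : IsRibbon σ) {n i : ℕ} (hi : i ≤ n) :
    unitAt (k := k) (A := A) n i hi ≫ face σ n (i + 1) = 𝟙 _ := by
  rcases Nat.lt_or_ge i n with h | h
  · rw [face_of_le σ h]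
    exact unitAt_mulAt_succ h
  · obtain rfl : i = n := by omega
    rw [face_last, ← Category.assoc, unitAt_rot hσ]
    exact slot_unit_mulAt _ _ _ (by simp) _ _

lemma unitAt_face_gt (σ : A ≅ A) {n i j : ℕ} (hij : j + 1 < i) (hi : i ≤ n + 2) :
    unitAt (k := k) (A := A) (n + 1) j (by omega) ≫ face σ (n + 1) i =
      face σ n (i - 1) ≫ unitAt n j (by omega) := by
  rcases Nat.lt_or_ge (n + 1) i with h | h
  · obtain rfl : i = n + 2 := by omega
    simp only [show n + 2 - 1 = n + 1 by omega]
    rw [face_last, face_last, ← Category.assoc, ← rot_unitAt σ (show j + 1 ≤ n + 1 by omega),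
      Category.assoc, unitAt_mulAt_lt (by omega), Category.assoc]
    rfl
  · rw [face_of_le σ h, face_of_le σ (show i - 1 ≤ n by omega)]
    exact unitAt_mulAt_gt hij h

lemma rot_face (hσ : IsRibbon σ) {n i : ℕ} (hi : i ≤ n) :
    rot (k := k) σ (n + 1) ≫ face σ n (i + 1) = face σ n i ≫ rot σ n := by
  rcases Nat.lt_or_ge i n with h | h
  · rw [face_of_le σ h, face_of_le σ hi]
    exact rot_mulAt σ h
  · obtain rfl : i = n := by omega
    rw [face_last, face_of_le σ le_rfl]
    exact rot_rot_mulAt hσ i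

lemma rot_face_zero (σ : A ≅ A) (n : ℕ) :
    rot (k := k) σ (n + 1) ≫ face σ n 0 = face σ n (n + 1) := by
  rw [face_last, face_of_le σ (Nat.zero_le n)]

end TPow

end Rotation

section Cocyclic

universe w

/-- A cocyclic module over `k` (with the signed convention for the cyclic operator). -/
structure CocyclicModule (k : Type u) [Field k] where
  /-- the module of cochains of a given degree -/
  obj : ℕ → Type w
  [addCommGroup : ∀ n, AddCommGroup (obj n)]
  [module : ∀ n, Module k (obj n)]
  /-- the face maps `d_i`, `0 ≤ i ≤ n + 1` -/
  d (n : ℕ) (i : Fin (n + 2)) : obj n →ₗ[k] obj (n + 1)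
  /-- the degeneracy maps `s_i`, `0 ≤ i ≤ n` -/
  s (n : ℕ) (i : Fin (n + 1)) : obj (n + 1) →ₗ[k] obj n
  /-- the cyclicity map `λ` -/
  cyc (n : ℕ) : obj n →ₗ[k] obj n
  d_d (n i j : ℕ) (hij : i < j) (hj : j ≤ n + 2) (φ : obj n) :
    d (n + 1) ⟨j, by omega⟩ (d n ⟨i, by omega⟩ φ) =
      d (n + 1) ⟨i, by omega⟩ (d n ⟨j - 1, by omega⟩ φ)
  s_s (n i j : ℕ) (hij : i ≤ j) (hj : j ≤ n) (φ : obj (n + 2)) :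
    s n ⟨j, by omega⟩ (s (n + 1) ⟨i, by omega⟩ φ) =
      s n ⟨i, by omega⟩ (s (n + 1) ⟨j + 1, by omega⟩ φ)
  s_d_of_lt (n i j : ℕ) (hij : i < j) (hj : j ≤ n + 1) (φ : obj (n + 1)) :
    s (n + 1) ⟨j, by omega⟩ (d (n + 1) ⟨i, by omega⟩ φ) =
      d n ⟨i, by omega⟩ (s n ⟨j - 1, by omega⟩ φ)
  s_d_self (n i : ℕ) (hi : i ≤ n) (φ : obj n) : s n ⟨i, by omega⟩ (d n ⟨i, by omega⟩ φ) = φ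
  s_d_succ (n i : ℕ) (hi : i ≤ n) (φ : obj n) : s n ⟨i, by omega⟩ (d n ⟨i + 1, by omega⟩ φ) = φ
  s_d_of_gt (n i j : ℕ) (hij : j + 1 < i) (hi : i ≤ n + 2) (φ : obj (n + 1)) :
    s (n + 1) ⟨j, by omega⟩ (d (n + 1) ⟨i, by omega⟩ φ) =
      d n ⟨i - 1, by omega⟩ (s n ⟨j, by omega⟩ φ)
  cyc_d (n i : ℕ) (hi : 1 ≤ i) (hi' : i ≤ n + 1) (φ : obj n) :
    cyc (n + 1) (d n ⟨i, by omega⟩ φ) = -d n ⟨i - 1, by omega⟩ (cyc n φ)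
  cyc_d_zero (n : ℕ) (φ : obj n) :
    cyc (n + 1) (d n ⟨0, by omega⟩ φ) = (-1 : k) ^ (n + 1) • d n ⟨n + 1, by omega⟩ φ
  cyc_s (n i : ℕ) (hi : 1 ≤ i) (hi' : i ≤ n) (φ : obj (n + 1)) :
    cyc n (s n ⟨i, by omega⟩ φ) = -s n ⟨i - 1, by omega⟩ (cyc (n + 1) φ)
  cyc_s_zero (n : ℕ) (φ : obj (n + 1)) :
    cyc n (s n ⟨0, by omega⟩ φ) =
      (-1 : k) ^ n • s n ⟨n, by omega⟩ (cyc (n + 1) (cyc (n + 1) φ))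
  cyc_pow (n : ℕ) (φ : obj n) : (cyc n ^ (n + 1)) φ = φ

attribute [instance] CocyclicModule.addCommGroup CocyclicModule.module

/-- An isomorphism of cocyclic modules: linear isomorphisms in each degree commuting with the
face, degeneracy and cyclicity maps. -/
structure CocyclicModule.Iso {k : Type u} [Field k] (X Y : CocyclicModule.{u, w} k) where
  /-- the isomorphism in a given degree -/
  equiv (n : ℕ) : X.obj n ≃ₗ[k] Y.obj n
  map_d (n : ℕ) (i : Fin (n + 2)) (φ : X.obj n) : equiv (n + 1) (X.d n i φ) = Y.d n i (equiv n φ)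
  map_s (n : ℕ) (i : Fin (n + 1)) (φ : X.obj (n + 1)) :
    equiv n (X.s n i φ) = Y.s n i (equiv (n + 1) φ)
  map_cyc (n : ℕ) (φ : X.obj n) : equiv n (X.cyc n φ) = Y.cyc n (equiv n φ)

/-- Commuting a power of the cyclicity map past faces or degeneracies. -/
lemma pow_cyc_comm {k M N : Type*} [Field k] [AddCommGroup M] [Module k M] [AddCommGroup N]
    [Module k N] (T : Module.End k M) (T' : Module.End k N) (D : ℕ → M →ₗ[k] N) (r e : ℕ)
    (h : ∀ i, i + 1 ≤ r → ∀ φ, T' (D (i + 1) φ) = -D i (T φ))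
    (h0 : ∀ φ, T' (D 0 φ) = (-1 : k) ^ r • D r ((T ^ e) φ)) (i : ℕ) (hi : i ≤ r) (φ : M) :
    (T' ^ (r + 1)) (D i φ) = D i ((T ^ (r + e)) φ) := by
  have key : ∀ j p, p + j ≤ r → ∀ φ, (T' ^ j) (D (p + j) φ) = (-1 : k) ^ j • D p ((T ^ j) φ) := by
    intro j
    induction j with
    | zero => intro p _ φ; simp
    | succ j ih =>
      intro p hp φ
      rw [pow_succ, Module.End.mul_apply, ← Nat.add_assoc, h _ (by omega), map_neg,
        ih p (by omega), pow_succ T, Module.End.mul_apply, pow_succ]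
      simp
  obtain ⟨q, rfl⟩ := Nat.exists_eq_add_of_le hi
  have h1 := key i 0 (by omega) φ
  rw [Nat.zero_add] at h1
  rw [show i + q + 1 = q + 1 + i by omega, pow_add, Module.End.mul_apply, h1, map_smul,
    pow_succ, Module.End.mul_apply, h0, map_smul, key q i (by omega), smul_smul, smul_smul,
    ← Module.End.mul_apply, ← Module.End.mul_apply]
  have h2 : (-1 : k) ^ i * ((-1) ^ (i + q) * (-1) ^ q) = 1 := by
    rw [← pow_add, ← pow_add]
    exact Even.neg_one_pow ⟨i + q, by ring⟩
  have h3 : T ^ q * T ^ e * T ^ i = T ^ (i + q + e) := by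
    rw [← pow_add, ← pow_add]
    congr 1
    omega
  rw [h3]
  first
  | rw [h2, one_smul]
  | rw [← mul_assoc] at h2
    rw [h2, one_smul]

end Cocyclic

section Cochains

open BPow MonObj

variable {k : Type u} [Field k] {C : Type*} [Category C] [Preadditive C] [Linear k C]
  [MonoidalCategory C] [BraidedCategory C]

namespace TPow

variable {A : C} (σ : A ≅ A)

/-- The morphism `λ = (-1)ⁿ (σ ⊗ id) Ψ_{n,1} : A^{⊗(n+1)} → A^{⊗(n+1)}`. -/
noncomputable def lam (n : ℕ) : tpow k A (n + 1) ⟶ tpow k A (n + 1) := (-1 : k) ^ n • rot σ n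

/-- Composition with `λ`, on morphisms from `A^{⊗(n+1)}` to the unit object. -/
noncomputable def cycMap (n : ℕ) : Module.End k (tpow k A (n + 1) ⟶ tpow k A 0) :=
  Linear.leftComp k (tpow k A 0) (lam σ n)

/-- The space `Cⁿ(C; A, σ)` of those `φ : A^{⊗(n+1)} → 1` with `φ λ^{n+1} = φ`. -/
noncomputable def cochains (n : ℕ) : Submodule k (tpow k A (n + 1) ⟶ tpow k A 0) :=
  LinearMap.eqLocus (cycMap σ n ^ (n + 1)) LinearMap.id

variable [MonObj A]

/-- Composition with `d_i`. -/
noncomputable def faceMap (n i : ℕ) :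
    (tpow k A (n + 1) ⟶ tpow k A 0) →ₗ[k] (tpow k A (n + 2) ⟶ tpow k A 0) :=
  Linear.leftComp k (tpow k A 0) (face σ n i)

/-- Composition with `s_i`. -/
noncomputable def degenMap (n i : ℕ) (hi : i ≤ n) :
    (tpow k A (n + 2) ⟶ tpow k A 0) →ₗ[k] (tpow k A (n + 1) ⟶ tpow k A 0) :=
  Linear.leftComp k (tpow k A 0) (unitAt n i hi)

variable {σ}

lemma cycMap_faceMap (hσ : IsRibbon σ) {n i : ℕ} (hi : i ≤ n)
    (φ : tpow k A (n + 1) ⟶ tpow k A 0) :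
    cycMap σ (n + 1) (faceMap σ n (i + 1) φ) = -faceMap σ n i (cycMap σ n φ) := by
  simp only [cycMap, faceMap, Linear.leftComp_apply, lam, Linear.smul_comp, Linear.comp_smul]
  rw [← Category.assoc, rot_face hσ hi, Category.assoc, pow_succ]
  simp

lemma cycMap_faceMap_zero (n : ℕ) (φ : tpow k A (n + 1) ⟶ tpow k A 0) :
    cycMap σ (n + 1) (faceMap σ n 0 φ) = (-1 : k) ^ (n + 1) • faceMap σ n (n + 1) φ := by
  simp only [cycMap, faceMap, Linear.leftComp_apply, lam, Linear.smul_comp]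
  rw [← Category.assoc, rot_face_zero]

lemma cycMap_degenMap {n i : ℕ} (hi : i + 1 ≤ n) (φ : tpow k A (n + 2) ⟶ tpow k A 0) :
    cycMap σ n (degenMap n (i + 1) hi φ) =
      -degenMap n i (Nat.le_of_succ_le hi) (cycMap σ (n + 1) φ) := by
  simp only [cycMap, degenMap, Linear.leftComp_apply, lam, Linear.smul_comp, Linear.comp_smul]
  rw [← Category.assoc, rot_unitAt σ hi, Category.assoc, pow_succ]
  simp

lemma cycMap_degenMap_zero (hσ : IsRibbon σ) (n : ℕ) (φ : tpow k A (n + 2) ⟶ tpow k A 0) :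
    cycMap σ n (degenMap n 0 (Nat.zero_le n) φ) =
      (-1 : k) ^ n • degenMap n n le_rfl (cycMap σ (n + 1) (cycMap σ (n + 1) φ)) := by
  simp only [cycMap, degenMap, Linear.leftComp_apply, lam, Linear.smul_comp, Linear.comp_smul,
    smul_smul, ← pow_add]
  rw [← Category.assoc, rot_unitAt_zero hσ, Category.assoc, Category.assoc]
  congr 1
  rw [show n + (n + 1 + (n + 1)) = n + 2 * (n + 1) by ring, pow_add, pow_mul]
  simp

lemma faceMap_mem (hσ : IsRibbon σ) {n i : ℕ} (hi : i ≤ n + 1)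
    {φ : tpow k A (n + 1) ⟶ tpow k A 0} (hφ : φ ∈ cochains σ n) :
    faceMap σ n i φ ∈ cochains σ (n + 1) := by
  have hφ' : (cycMap σ n ^ (n + 1)) φ = φ := hφ
  have h := pow_cyc_comm (cycMap σ n) (cycMap σ (n + 1)) (fun i => faceMap σ n i) (n + 1) 0
    (fun i hi φ => cycMap_faceMap hσ (by omega) φ) (fun φ => cycMap_faceMap_zero n φ) i hi φ
  change (cycMap σ (n + 1) ^ (n + 1 + 1)) (faceMap σ n i φ) = faceMap σ n i φ
  exact h.trans (congrArg _ hφ')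

lemma degenMap_mem (hσ : IsRibbon σ) {n i : ℕ} (hi : i ≤ n)
    {φ : tpow k A (n + 2) ⟶ tpow k A 0} (hφ : φ ∈ cochains σ (n + 1)) :
    degenMap n i hi φ ∈ cochains σ n := by
  have hφ' : (cycMap σ (n + 1) ^ (n + 2)) φ = φ := hφ
  have h := pow_cyc_comm (cycMap σ (n + 1)) (cycMap σ n)
    (fun i => if h : i ≤ n then degenMap n i h else 0) n 2
    (fun i hi φ => by
      rw [dif_pos hi, dif_pos (Nat.le_of_succ_le hi)]
      exact cycMap_degenMap hi φ)
    (fun φ => by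
      rw [dif_pos (Nat.zero_le n), dif_pos le_rfl]
      exact cycMap_degenMap_zero hσ n φ) i hi φ
  simp only [dif_pos hi] at h
  change (cycMap σ n ^ (n + 1)) (degenMap n i hi φ) = degenMap n i hi φ
  rw [h, hφ']

lemma cycMap_mem {n : ℕ} {φ : tpow k A (n + 1) ⟶ tpow k A 0} (hφ : φ ∈ cochains σ n) :
    cycMap σ n φ ∈ cochains σ n := by
  have hφ' : (cycMap σ n ^ (n + 1)) φ = φ := hφ
  change (cycMap σ n ^ (n + 1)) (cycMap σ n φ) = cycMap σ n φ
  rw [← Module.End.mul_apply, ← pow_succ, pow_succ', Module.End.mul_apply, hφ']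

end TPow

open TPow

/-- The cocyclic module `C^•(C; A, σ)` of an algebra `A` with ribbon structure `σ` in a braided
monoidal `k`-linear category `C`. -/
noncomputable def cocyclicModule {A : C} [MonObj A] (σ : A ≅ A) (hσ : IsRibbon σ) :
    CocyclicModule k where
  obj n := cochains (k := k) σ n
  d n i := (faceMap σ n i).restrict fun _ h => faceMap_mem hσ (by omega) h
  s n i := (degenMap n i (by omega)).restrict fun _ h => degenMap_mem hσ (by omega) h
  cyc n := (cycMap σ n).restrict fun _ h => cycMap_mem h
  d_d n i j hij hj φ := by
    apply Subtype.ext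
    change face σ (n + 1) j ≫ face σ n i ≫ φ.1 = face σ (n + 1) i ≫ face σ n (j - 1) ≫ φ.1
    rw [← Category.assoc, face_face hσ hij hj, Category.assoc]
  s_s n i j hij hj φ := by
    apply Subtype.ext
    change unitAt n j _ ≫ unitAt (n + 1) i _ ≫ φ.1 = unitAt n i _ ≫ unitAt (n + 1) (j + 1) _ ≫ φ.1
    rw [← Category.assoc, unitAt_unitAt hij hj, Category.assoc]
  s_d_of_lt n i j hij hj φ := by
    apply Subtype.ext
    change unitAt (n + 1) j _ ≫ face σ (n + 1) i ≫ φ.1 = face σ n i ≫ unitAt n (j - 1) _ ≫ φ.1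
    rw [← Category.assoc, unitAt_face_lt σ hij hj, Category.assoc]
  s_d_self n i hi φ := by
    apply Subtype.ext
    change unitAt n i _ ≫ face σ n i ≫ φ.1 = φ.1
    rw [← Category.assoc, unitAt_face_self σ hi, Category.id_comp]
  s_d_succ n i hi φ := by
    apply Subtype.ext
    change unitAt n i _ ≫ face σ n (i + 1) ≫ φ.1 = φ.1
    rw [← Category.assoc, unitAt_face_succ hσ hi, Category.id_comp]
  s_d_of_gt n i j hij hi φ := by
    apply Subtype.ext
    change unitAt (n + 1) j _ ≫ face σ (n + 1) i ≫ φ.1 = face σ n (i - 1) ≫ unitAt n j _ ≫ φ.1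
    rw [← Category.assoc, unitAt_face_gt σ hij hi, Category.assoc]
  cyc_d n i hi hi' φ := by
    apply Subtype.ext
    obtain ⟨i, rfl⟩ := Nat.exists_eq_add_of_le' hi
    exact cycMap_faceMap hσ (by omega) φ.1
  cyc_d_zero n φ := Subtype.ext (cycMap_faceMap_zero n φ.1)
  cyc_s n i hi hi' φ := by
    apply Subtype.ext
    obtain ⟨i, rfl⟩ := Nat.exists_eq_add_of_le' hi
    exact cycMap_degenMap hi' φ.1
  cyc_s_zero n φ := Subtype.ext (cycMap_degenMap_zero hσ n φ.1)
  cyc_pow n φ := by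
    apply Subtype.ext
    have h : ∀ m, ((((cycMap σ n).restrict fun _ h => cycMap_mem h : Module.End k
      (cochains (k := k) σ n)) ^ m) φ).1 = (cycMap σ n ^ m) φ.1 := by
      intro m
      induction m with
      | zero => simp
      | succ m ih =>
        rw [pow_succ', Module.End.mul_apply, pow_succ', Module.End.mul_apply, ← ih]
        rfl
    exact (h (n + 1)).trans φ.2

end Cochains


section Conjugation

variable {k : Type*} [Field k]
  {C D E T T' : Type*} [AddCommMonoid C] [Module k C] [Coalgebra k C]
  [AddCommMonoid D] [Module k D] [Coalgebra k D]
  [AddCommMonoid E] [Module k E] [Coalgebra k E]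
  [AddCommMonoid T] [Module k T] [AddCommMonoid T'] [Module k T']

lemma convL_comp (f : Functional k C) (t : C →ₗ[k] T) (s : T →ₗ[k] T') :
    s ∘ₗ convL f t = convL f (s ∘ₗ t) := by
  ext c
  simp only [convL, LinearMap.comp_apply, LinearEquiv.coe_coe]
  induction Coalgebra.comul (R := k) c with
  | zero => simp
  | add x y hx hy => simp only [map_add, hx, hy]
  | tmul a b => simp

lemma convR_comp (f : Functional k C) (t : C →ₗ[k] T) (s : T →ₗ[k] T') :
    s ∘ₗ convR t f = convR (s ∘ₗ t) f := by
  ext c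
  simp only [convR, LinearMap.comp_apply, LinearEquiv.coe_coe]
  induction Coalgebra.comul (R := k) c with
  | zero => simp
  | add x y hx hy => simp only [map_add, hx, hy]
  | tmul a b => simp

/-- `c ↦ s(c₍₁₎) ⊗ t(c₍₂₎)` -/
noncomputable def conv2 (s : C →ₗ[k] T) (t : C →ₗ[k] T') : C →ₗ[k] T ⊗[k] T' :=
  TensorProduct.map s t ∘ₗ Coalgebra.comul

lemma conv2_assoc {T'' : Type*} [AddCommMonoid T''] [Module k T'']
    (s : C →ₗ[k] T) (t : C →ₗ[k] T') (u : C →ₗ[k] T'') :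
    (TensorProduct.assoc k T T' T'').toLinearMap ∘ₗ conv2 (conv2 s t) u =
      conv2 s (conv2 t u) := by
  have h : conv2 s (conv2 t u) = TensorProduct.map s (TensorProduct.map t u) ∘ₗ
      LinearMap.lTensor C Coalgebra.comul ∘ₗ Coalgebra.comul := by
    unfold conv2
    rw [← LinearMap.comp_assoc, LinearMap.lTensor, ← TensorProduct.map_comp, LinearMap.comp_id]
  have h' : conv2 (conv2 s t) u = TensorProduct.map (TensorProduct.map s t) u ∘ₗ
      LinearMap.rTensor C Coalgebra.comul ∘ₗ Coalgebra.comul := by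
    unfold conv2
    rw [← LinearMap.comp_assoc, LinearMap.rTensor, ← TensorProduct.map_comp, LinearMap.comp_id]
  rw [h, h', ← Coalgebra.coassoc]
  simp only [← LinearMap.comp_assoc]
  congr 2
  ext; rfl

lemma conv2_comp_left {T'' : Type*} [AddCommMonoid T''] [Module k T'']
    (s : C →ₗ[k] T) (t : C →ₗ[k] T') (p : T →ₗ[k] T'') :
    conv2 (p ∘ₗ s) t = LinearMap.rTensor T' p ∘ₗ conv2 s t := by
  unfold conv2
  rw [← LinearMap.comp_assoc, LinearMap.rTensor, ← TensorProduct.map_comp, LinearMap.id_comp]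

lemma conv2_comp_right {T'' : Type*} [AddCommMonoid T''] [Module k T'']
    (s : C →ₗ[k] T) (t : C →ₗ[k] T') (p : T' →ₗ[k] T'') :
    conv2 s (p ∘ₗ t) = LinearMap.lTensor T p ∘ₗ conv2 s t := by
  unfold conv2
  rw [← LinearMap.comp_assoc, LinearMap.lTensor, ← TensorProduct.map_comp, LinearMap.id_comp]

lemma convL_eq (f : Functional k C) (t : C →ₗ[k] T) :
    convL f t = (TensorProduct.lid k T).toLinearMap ∘ₗ conv2 f.ofConv t := rfl

lemma convR_eq (f : Functional k C) (t : C →ₗ[k] T) :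
    convR t f = (TensorProduct.rid k T).toLinearMap ∘ₗ conv2 t f.ofConv := rfl

lemma conv2_convL_left (f : Functional k C) (s : C →ₗ[k] T) (t : C →ₗ[k] T') :
    conv2 (convL f s) t = convL f (conv2 s t) := by
  rw [convL_eq, conv2_comp_left, convL_eq, ← conv2_assoc, ← LinearMap.comp_assoc]
  congr 1
  ext; simp

lemma conv2_convR_right (f : Functional k C) (s : C →ₗ[k] T) (t : C →ₗ[k] T') :
    conv2 s (convR t f) = convR (conv2 s t) f := by
  rw [convR_eq, conv2_comp_right, convR_eq, ← conv2_assoc, ← LinearMap.comp_assoc]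
  congr 1
  ext; simp

lemma conv2_convR_left (f : Functional k C) (s : C →ₗ[k] T) (t : C →ₗ[k] T') :
    conv2 (convR s f) t = conv2 s (convL f t) := by
  rw [convR_eq, conv2_comp_left, convL_eq, conv2_comp_right, ← conv2_assoc,
    ← LinearMap.comp_assoc]
  congr 1
  ext; simp

lemma convL_convL (f g : Functional k C) (t : C →ₗ[k] T) :
    convL f (convL g t) = convL (f * g) t := by
  rw [convL_eq (f * g) t, ← Coaction.convL_ofConv, conv2_convL_left, convL_comp]
  rfl

lemma convR_ofConv (f g : Functional k C) : convR f.ofConv g = (f * g).ofConv := by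
  ext c
  simp only [convR, LinearMap.convMul_def, LinearMap.comp_apply]
  induction Coalgebra.comul (R := k) c with
  | zero => simp
  | add x y hx hy => simp only [map_add, hx, hy]
  | tmul a b => simp [mul_comm]

lemma convR_convR (f g : Functional k C) (t : C →ₗ[k] T) :
    convR (convR t f) g = convR t (f * g) := by
  rw [convR_eq (f * g) t, ← convR_ofConv, conv2_convR_right, convR_comp]
  rfl

lemma convL_convR (f g : Functional k C) (t : C →ₗ[k] T) :
    convR (convL f t) g = convL f (convR t g) := by
  rw [convR_eq, conv2_convL_left, convL_comp]
  rfl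

lemma convL_one (t : C →ₗ[k] T) : convL 1 t = t := by
  have h : convL 1 t = t ∘ₗ convL 1 LinearMap.id := by rw [convL_comp]; rfl
  rw [h]
  ext c
  have := Coalgebra.rTensor_counit_comul (R := k) c
  have h2 := congrArg (TensorProduct.lid k C) this
  simp only [TensorProduct.lid_tmul, one_smul] at h2
  simp only [LinearMap.comp_apply]
  congr 1

lemma convR_one (t : C →ₗ[k] T) : convR t 1 = t := by
  have h : convR t 1 = t ∘ₗ convR LinearMap.id 1 := by rw [convR_comp]; rfl
  rw [h]
  ext c
  have := Coalgebra.lTensor_counit_comul (R := k) c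
  have h2 := congrArg (TensorProduct.rid k C) this
  simp only [TensorProduct.rid_tmul, one_smul] at h2
  simp only [LinearMap.comp_apply]
  congr 1

lemma convL_pre (h : C →ₗc[k] D) (f : Functional k D) (t : D →ₗ[k] T) :
    convL f t ∘ₗ h.toLinearMap = convL (pull h f) (t ∘ₗ h.toLinearMap) := by
  unfold convL
  rw [LinearMap.comp_assoc, LinearMap.comp_assoc, ← h.map_comp_comul, ← LinearMap.comp_assoc,
    ← LinearMap.comp_assoc, ← LinearMap.comp_assoc]
  congr 1
  ext; rfl

lemma convR_pre (h : C →ₗc[k] D) (f : Functional k D) (t : D →ₗ[k] T) :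
    convR t f ∘ₗ h.toLinearMap = convR (t ∘ₗ h.toLinearMap) (pull h f) := by
  unfold convR
  rw [LinearMap.comp_assoc, LinearMap.comp_assoc, ← h.map_comp_comul, ← LinearMap.comp_assoc,
    ← LinearMap.comp_assoc, ← LinearMap.comp_assoc]
  congr 1
  ext; rfl

/-- The coalgebra morphism `c ↦ F(c₍₁₎) c₍₂₎ F⁻¹(c₍₃₎)`. -/
noncomputable def conj (F : (Functional k C)ˣ) : C →ₗc[k] C where
  toLinearMap := convL F (convR LinearMap.id (↑F⁻¹ : Functional k C))
  counit_comp := by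
    rw [convL_comp, convR_comp]
    have h : (Coalgebra.counit ∘ₗ LinearMap.id : C →ₗ[k] k) = (1 : Functional k C).ofConv := rfl
    rw [h, convR_ofConv, one_mul, Coaction.convL_ofConv, Units.mul_inv]
    rfl
  map_comp_comul := by
    rw [convL_comp, convR_comp]
    have h : (Coalgebra.comul ∘ₗ LinearMap.id : C →ₗ[k] C ⊗[k] C) =
      conv2 LinearMap.id LinearMap.id := by simp [conv2]
    rw [h]
    change conv2 _ _ = _
    rw [← convL_convR, conv2_convR_left, convL_convR, convL_convL, Units.inv_mul, convL_one,
      conv2_convL_left, conv2_convR_right]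

lemma comp_conj (F : (Functional k C)ˣ) (t : C →ₗ[k] T) :
    t ∘ₗ (conj F).toLinearMap = convL F (convR t (↑F⁻¹ : Functional k C)) := by
  have e : (conj F).toLinearMap = convL F (convR LinearMap.id (↑F⁻¹ : Functional k C)) := rfl
  rw [e, convL_comp, convR_comp, LinearMap.comp_id]

lemma pull_conj (F : (Functional k C)ˣ) (g : Functional k C) :
    pull (conj F) g = F * g * (↑F⁻¹ : Functional k C) := by
  apply WithConv.ext
  change g.ofConv ∘ₗ (conj F).toLinearMap = _
  rw [comp_conj, convR_ofConv, Coaction.convL_ofConv, mul_assoc]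

lemma conj_comp (F : (Functional k D)ˣ) (h : C →ₗc[k] D) :
    (conj F).toLinearMap ∘ₗ h.toLinearMap =
      h.toLinearMap ∘ₗ (conj (Units.map (pull h) F)).toLinearMap := by
  rw [comp_conj]
  have e : (conj F).toLinearMap = convL F (convR LinearMap.id (↑F⁻¹ : Functional k D)) := rfl
  rw [e, convL_pre, convR_pre, LinearMap.id_comp]
  rfl

lemma conj_one : (conj (1 : (Functional k C)ˣ)).toLinearMap = LinearMap.id := by
  change convL _ _ = _
  simp [convL_one, convR_one]

lemma convR_lTensor (E : Type*) [AddCommMonoid E] [Module k E] [Coalgebra k E]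
    (X : Functional k C) (t : C →ₗ[k] T) : convR (LinearMap.lTensor E t) (pull (dropL k E C) X) =
    LinearMap.lTensor E (convR t X) := by
  ext e c
  have hv := congrArg (TensorProduct.rid k E) (Coalgebra.lTensor_counit_comul (R := k) e)
  simp only [TensorProduct.rid_tmul, one_smul] at hv
  simp only [convR, LinearMap.comp_apply, TensorProduct.AlgebraTensorModule.curry_apply,
    LinearMap.restrictScalars_self, TensorProduct.curry_apply, LinearMap.lTensor_tmul,
    LinearEquiv.coe_coe, TensorProduct.comul_tmul]
  conv_rhs => rw [← hv]
  generalize Coalgebra.comul (R := k) e = x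
  generalize Coalgebra.comul (R := k) c = y
  induction x with
  | zero => simp
  | add x y hx hy => simp only [map_add, TensorProduct.add_tmul, hx, hy]
  | tmul e e' =>
    induction y with
    | zero => simp
    | add x y hx hy => simp only [map_add, TensorProduct.tmul_add, hx, hy]
    | tmul c c' =>
      simp only [AlgebraTensorModule.tensorTensorTensorComm_tmul, TensorProduct.map_tmul,
        LinearMap.lTensor_tmul, TensorProduct.rid_tmul]
      change X.ofConv (Coalgebra.counit (R := k) e' • c') • _ = _
      simp [TensorProduct.smul_tmul', TensorProduct.tmul_smul, smul_smul, mul_comm]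

lemma convL_lTensor (E : Type*) [AddCommMonoid E] [Module k E] [Coalgebra k E]
    (X : Functional k C) (t : C →ₗ[k] T) : convL (pull (dropL k E C) X) (LinearMap.lTensor E t) =
    LinearMap.lTensor E (convL X t) := by
  ext e c
  have hv := congrArg (TensorProduct.lid k E) (Coalgebra.rTensor_counit_comul (R := k) e)
  simp only [TensorProduct.lid_tmul, one_smul] at hv
  simp only [convL, LinearMap.comp_apply, TensorProduct.AlgebraTensorModule.curry_apply,
    LinearMap.restrictScalars_self, TensorProduct.curry_apply, LinearMap.lTensor_tmul,
    LinearEquiv.coe_coe, TensorProduct.comul_tmul]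
  conv_rhs => rw [← hv]
  generalize Coalgebra.comul (R := k) e = x
  generalize Coalgebra.comul (R := k) c = y
  induction x with
  | zero => simp
  | add x y hx hy => simp only [map_add, TensorProduct.add_tmul, hx, hy]
  | tmul e e' =>
    induction y with
    | zero => simp
    | add x y hx hy => simp only [map_add, TensorProduct.tmul_add, hx, hy]
    | tmul c c' =>
      simp only [AlgebraTensorModule.tensorTensorTensorComm_tmul, TensorProduct.map_tmul,
        LinearMap.lTensor_tmul, TensorProduct.lid_tmul]
      change X.ofConv (Coalgebra.counit (R := k) e • c) • _ = _
      simp [TensorProduct.smul_tmul', TensorProduct.tmul_smul, smul_smul, mul_comm]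

/-- `X` intertwines `t` and `t'`: `t(c₍₁₎) X(c₍₂₎) = X(c₍₁₎) t'(c₍₂₎)`. -/
def Intertwines (X : Functional k C) (t t' : C →ₗ[k] T) : Prop := convR t X = convL X t'

namespace Intertwines

lemma conj {X : Functional k C} {t t' : C →ₗ[k] T} (h : Intertwines X t t')
    (P Q : (Functional k C)ˣ) :
    Intertwines ((P : Functional k C) * X * (↑Q⁻¹ : Functional k C)) (t ∘ₗ (conj P).toLinearMap)
      (t' ∘ₗ (QuasiCyclic.conj Q).toLinearMap) := by
  unfold Intertwines at *
  rw [comp_conj, comp_conj, convL_convR, convR_convR, convL_convL]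
  have e : (↑P⁻¹ : Functional k C) * ((P : Functional k C) * X * (↑Q⁻¹ : Functional k C)) =
    X * (↑Q⁻¹ : Functional k C) := by simp [← mul_assoc]
  have e' : ((P : Functional k C) * X * (↑Q⁻¹ : Functional k C)) * Q = P * X := by simp [mul_assoc]
  rw [e, e', ← convR_convR, h, convL_convR, convL_convL]

lemma pull_mul {X : Functional k C} {h h' : C →ₗc[k] D}
    (H : Intertwines X h.toLinearMap h'.toLinearMap) (g : Functional k D) :
    pull h g * X = X * pull h' g := by
  apply WithConv.ext
  rw [← convR_ofConv, ← Coaction.convL_ofConv]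
  change convR (g.ofConv ∘ₗ h.toLinearMap) X = convL X (g.ofConv ∘ₗ h'.toLinearMap)
  rw [← convR_comp, ← convL_comp, H]

lemma pre {X : Functional k D} {t t' : D →ₗ[k] T} (H : Intertwines X t t') (h : C →ₗc[k] D) :
    Intertwines (pull h X) (t ∘ₗ h.toLinearMap) (t' ∘ₗ h.toLinearMap) := by
  unfold Intertwines at *
  rw [← convR_pre, ← convL_pre, H]

lemma post {X : Functional k C} {t t' : C →ₗ[k] T} (H : Intertwines X t t') (s : T →ₗ[k] T') :
    Intertwines X (s ∘ₗ t) (s ∘ₗ t') := by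
  unfold Intertwines at *
  rw [← convR_comp, ← convL_comp, H]

lemma left (E : Type*) [AddCommMonoid E] [Module k E] [Coalgebra k E] {X : Functional k C}
    {t t' : C →ₗ[k] T} (H : Intertwines X t t') :
    Intertwines (pull (dropL k E C) X) (LinearMap.lTensor E t) (LinearMap.lTensor E t') := by
  unfold Intertwines at *
  rw [convR_lTensor, convL_lTensor, H]

lemma right (E : Type*) [AddCommMonoid E] [Module k E] [Coalgebra k E] {X : Functional k C}
    {t t' : C →ₗ[k] T} (H : Intertwines X t t') :
    Intertwines (pull (dropR k C E) X) (LinearMap.rTensor E t) (LinearMap.rTensor E t') := by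
  have h := ((H.left E).pre (flip k C E)).post (TensorProduct.comm k E T).toLinearMap
  convert h using 1
  · rw [pull_pull]
    apply Coaction.pull_eq_pull
    ext; rfl
  · ext; rfl
  · ext; rfl

end Intertwines

end Conjugation


section Twist

variable {k : Type u} {H : Type v} [Field k] [AddCommGroup H] [Module k H] [Coalgebra k H]

/-- A 2-cochain `F` on `H`: a convolution invertible functional `F : H ⊗ H → k` with
`F(a,1) = ε(a) = F(1,a)`. -/
structure TwoCochain (S : CoquasitriangularCoquasibialgebra k H) where
  /-- the functional, as a unit of the convolution algebra -/
  F : (Functional k (H ⊗[k] H))ˣ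
  F_one : ∀ a, F.val (a ⊗ₜ S.one) = Coalgebra.counit (R := k) a
  one_F : ∀ a, F.val (S.one ⊗ₜ a) = Coalgebra.counit (R := k) a

namespace CoquasitriangularCoquasibialgebra

variable (S : CoquasitriangularCoquasibialgebra k H) (F : TwoCochain S)

/-- The coalgebra morphism `a ↦ 1 ⊗ a`. -/
noncomputable def oneTmul (C : Type*) [AddCommMonoid C] [Module k C] [Coalgebra k C] :
    C →ₗc[k] H ⊗[k] C where
  toLinearMap := TensorProduct.mk k H C S.one
  counit_comp := by ext a; simp [S.one_groupLike.counit_eq_one]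
  map_comp_comul := by
    ext a
    simp only [LinearMap.comp_apply, TensorProduct.mk_apply, TensorProduct.comul_tmul,
      S.one_groupLike.comul_eq_tmul_self]
    induction Coalgebra.comul (R := k) a with
    | zero => simp
    | add x y hx hy => simp only [map_add, TensorProduct.tmul_add, hx, hy]
    | tmul b c => simp

/-- The coalgebra morphism `a ↦ a ⊗ 1`. -/
noncomputable def tmulOne : H →ₗc[k] H ⊗[k] H := (flip k H H).comp (S.oneTmul H)

/-- the unit element, as a coalgebra morphism `k → H` -/
noncomputable def oneHom : k →ₗc[k] H :=
  (dropR k H k).comp (S.oneTmul k)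

lemma conj_eq_id {C : Type*} [AddCommMonoid C] [Module k C] [Coalgebra k C]
    {D : Type*} [AddCommMonoid D] [Module k D] [Coalgebra k D]
    (P : (Functional k D)ˣ) (h : C →ₗc[k] D) (hP : pull h P.val = 1) (c : C) :
    conj P (h c) = h c := by
  have := LinearMap.congr_fun (conj_comp P h) c
  have e1 : Units.map (pull h) P = 1 := Units.ext hP
  rw [e1, conj_one] at this
  exact this

/-- The cotwisted product `a ⊗ b ↦ F(a₍₁₎,b₍₁₎) a₍₂₎b₍₂₎ F⁻¹(a₍₃₎,b₍₃₎)`. -/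
noncomputable def twistMul : H ⊗[k] H →ₗc[k] H := S.mul.comp (conj F.F)

/-- `F(b,c)` as a functional of `a ⊗ (b ⊗ c)` -/
noncomputable def f23 : (Functional k (H ⊗[k] (H ⊗[k] H)))ˣ := Units.map (pull (dropL k H (H ⊗[k] H))) F.F

/-- `F(a,bc)` as a functional of `a ⊗ (b ⊗ c)` -/
noncomputable def f1_23 : (Functional k (H ⊗[k] (H ⊗[k] H)))ˣ :=
  Units.map (pull (tmap (.id k H) S.mul)) F.F

/-- `F(a,b)` as a functional of `a ⊗ (b ⊗ c)` -/
noncomputable def f12 : (Functional k (H ⊗[k] (H ⊗[k] H)))ˣ :=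
  Units.map (pull (tmap (.id k H) (dropR k H H))) F.F

/-- `F(ab,c)` as a functional of `a ⊗ (b ⊗ c)` -/
noncomputable def f12_3 : (Functional k (H ⊗[k] (H ⊗[k] H)))ˣ :=
  Units.map (pull ((tmap S.mul (.id k H)).comp (assocL k H H H))) F.F

/-- The 3-cocycle, as a unit. -/
def φu : (Functional k (H ⊗[k] (H ⊗[k] H)))ˣ := ⟨S.φ, S.φinv, S.φ_φinv, S.φinv_φ⟩

/-- The coquasitriangular structure, as a unit. -/
def Ru : (Functional k (H ⊗[k] H))ˣ := ⟨S.R, S.Rinv, S.R_Rinv, S.Rinv_R⟩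

/-- The cotwisted 3-cocycle
`F(b₁,c₁) F(a₁,b₂c₂) φ(a₂,b₃,c₃) F⁻¹(a₃b₄,c₄) F⁻¹(a₄,b₅)`. -/
noncomputable def twistφ : (Functional k (H ⊗[k] (H ⊗[k] H)))ˣ :=
  S.f23 F * S.f1_23 F * S.φu * (S.f12_3 F)⁻¹ * (S.f12 F)⁻¹

/-- The cotwisted coquasitriangular structure `F(b₁,a₁) R(a₂,b₂) F⁻¹(a₃,b₃)`. -/
noncomputable def twistR : (Functional k (H ⊗[k] H))ˣ :=
  Units.map (pull (flip k H H)) F.F * S.Ru * F.F⁻¹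

section lemmas

variable {C D E : Type*} [AddCommMonoid C] [Module k C] [Coalgebra k C]
  [AddCommMonoid D] [Module k D] [Coalgebra k D] [AddCommMonoid E] [Module k E] [Coalgebra k E]

lemma twist_one_mul (a : H) : S.twistMul F (S.one ⊗ₜ a) = a := by
  change S.mul (conj F.F (S.oneTmul H a)) = a
  rw [conj_eq_id]
  · exact S.one_mul a
  · apply WithConv.ext
    ext a
    exact F.one_F a

lemma twist_mul_one (a : H) : S.twistMul F (a ⊗ₜ S.one) = a := by
  change S.mul (conj F.F (S.tmulOne a)) = a
  rw [conj_eq_id]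
  · exact S.mul_one a
  · apply WithConv.ext
    ext a
    exact F.F_one a

lemma tmap_conj_right (P : (Functional k C)ˣ) :
    (tmap (.id k E) (conj P)).toLinearMap =
      (conj (Units.map (pull (dropL k E C)) P)).toLinearMap := by
  have h1 : (tmap (.id k E) (conj P)).toLinearMap =
    LinearMap.lTensor E (convL P (convR LinearMap.id (↑P⁻¹ : Functional k C))) := rfl
  have h2 : (conj (Units.map (pull (dropL k E C)) P)).toLinearMap =
    convL (pull (dropL k E C) P.val) (convR LinearMap.id (pull (dropL k E C) P.inv)) := rfl
  rw [h1, h2, ← convL_lTensor, ← convR_lTensor, LinearMap.lTensor_id]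
  rfl

lemma tmap_conj_left (P : (Functional k C)ˣ) :
    (tmap (conj P) (.id k E)).toLinearMap =
      (conj (Units.map (pull (dropR k C E)) P)).toLinearMap := by
  have e : (tmap (conj P) (.id k E)).toLinearMap = (flip k E C).toLinearMap ∘ₗ
      (tmap (.id k E) (conj P)).toLinearMap ∘ₗ (flip k C E).toLinearMap := by
    ext; rfl
  have e2 : Units.map (pull (flip k C E)) (Units.map (pull (dropL k E C)) P) =
      Units.map (pull (dropR k C E)) P := by
    apply Units.ext
    change pull _ (pull _ P.val) = pull _ P.val
    rw [pull_pull]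
    apply Coaction.pull_eq_pull
    ext; rfl
  have e3 : (flip k E C).toLinearMap ∘ₗ (flip k C E).toLinearMap = LinearMap.id := by
    ext; rfl
  rw [e, tmap_conj_right, conj_comp, e2, ← LinearMap.comp_assoc, e3, LinearMap.id_comp]

lemma conj_conj (P Q : (Functional k C)ˣ) :
    (conj P).toLinearMap ∘ₗ (conj Q).toLinearMap = (conj (Q * P)).toLinearMap := by
  have e : ∀ P : (Functional k C)ˣ, (conj P).toLinearMap =
    convL P (convR LinearMap.id (↑P⁻¹ : Functional k C)) := fun _ => rfl
  rw [comp_conj, e P, e (Q * P), convL_convR, convR_convR, convL_convL, mul_inv_rev,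
    Units.val_mul, Units.val_mul]

lemma twist_assoc_right :
    ((S.twistMul F).comp (tmap (.id k H) (S.twistMul F))).toLinearMap =
      (S.mul.comp (tmap (.id k H) S.mul)).toLinearMap ∘ₗ
        (conj (S.f23 F * S.f1_23 F)).toLinearMap := by
  have e1 : ((S.twistMul F).comp (tmap (.id k H) (S.twistMul F))).toLinearMap =
      S.mul.toLinearMap ∘ₗ ((conj F.F).toLinearMap ∘ₗ (tmap (.id k H) S.mul).toLinearMap) ∘ₗ
        (tmap (.id k H) (conj F.F)).toLinearMap := by
    ext; rfl
  rw [e1, conj_comp, tmap_conj_right, LinearMap.comp_assoc, conj_conj]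
  rfl

lemma twist_assoc_left :
    ((S.twistMul F).comp ((tmap (S.twistMul F) (.id k H)).comp
      (assocL k H H H))).toLinearMap =
      (S.mul.comp ((tmap S.mul (.id k H)).comp (assocL k H H H))).toLinearMap ∘ₗ
        (conj (S.f12 F * S.f12_3 F)).toLinearMap := by
  have e1 : ((S.twistMul F).comp ((tmap (S.twistMul F) (.id k H)).comp
      (assocL k H H H))).toLinearMap =
      S.mul.toLinearMap ∘ₗ ((conj F.F).toLinearMap ∘ₗ (tmap S.mul (.id k H)).toLinearMap) ∘ₗ
        (tmap (conj F.F) (.id k H)).toLinearMap ∘ₗ (assocL k H H H).toLinearMap := by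
    ext; rfl
  have e2 : (Units.map (pull (assocL k H H H))) (Units.map (pull (dropR k (H ⊗[k] H) H)) F.F) =
      S.f12 F := by
    apply Units.ext
    change pull _ (pull _ F.F.val) = pull _ F.F.val
    rw [pull_pull]
    apply Coaction.pull_eq_pull
    ext a b c
    change Coalgebra.counit (R := k) c • (a ⊗ₜ[k] b) = a ⊗ₜ[k] (Coalgebra.counit (R := k) c • b)
    simp
  rw [e1, conj_comp, tmap_conj_left, conj_comp, e2, LinearMap.comp_assoc,
    ← LinearMap.comp_assoc _ _ (conj _).toLinearMap, conj_comp, LinearMap.comp_assoc, conj_conj]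
  rfl

lemma intertwines_φ : Intertwines S.φ (S.mul.comp (tmap (.id k H) S.mul)).toLinearMap
    (S.mul.comp ((tmap S.mul (.id k H)).comp (assocL k H H H))).toLinearMap := S.quasi_assoc

lemma intertwines_R : Intertwines S.R (S.mul.comp (flip k H H)).toLinearMap
    S.mul.toLinearMap := S.quasi_comm

lemma twist_quasi_assoc :
    convR ((S.twistMul F).comp (tmap (.id k H) (S.twistMul F))).toLinearMap (S.twistφ F).val =
      convL (S.twistφ F).val ((S.twistMul F).comp ((tmap (S.twistMul F) (.id k H)).comp
        (assocL k H H H))).toLinearMap := by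
  have h := S.intertwines_φ.conj (S.f23 F * S.f1_23 F) (S.f12 F * S.f12_3 F)
  have e : (S.twistφ F).val =
      (↑(S.f23 F * S.f1_23 F) : Functional k (H ⊗[k] (H ⊗[k] H))) * S.φ *
        (↑(S.f12 F * S.f12_3 F)⁻¹ : Functional k (H ⊗[k] (H ⊗[k] H))) := by
    simp [twistφ, φu, mul_assoc]
  rw [twist_assoc_right, twist_assoc_left, e]
  exact h

lemma twist_quasi_comm :
    convR ((S.twistMul F).comp (flip k H H)).toLinearMap (S.twistR F).val =
      convL (S.twistR F).val (S.twistMul F).toLinearMap := by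
  have h := S.intertwines_R.conj (Units.map (pull (flip k H H)) F.F) F.F
  have e : ((S.twistMul F).comp (flip k H H)).toLinearMap =
      (S.mul.comp (flip k H H)).toLinearMap ∘ₗ
        (conj (Units.map (pull (flip k H H)) F.F)).toLinearMap := by
    change S.mul.toLinearMap ∘ₗ ((conj F.F).toLinearMap ∘ₗ (flip k H H).toLinearMap) = _
    rw [conj_comp]
    rfl
  rw [e]
  exact h

lemma pull_comp_conj (P : (Functional k C)ˣ) (h : C →ₗc[k] D) (g : Functional k D) :
    pull (h.comp (conj P)) g = P * pull h g * (↑P⁻¹ : Functional k C) := by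
  rw [← pull_pull, pull_conj]

lemma twist_φ_one (a b : H) : (S.twistφ F).val (a ⊗ₜ (S.one ⊗ₜ b)) =
    Coalgebra.counit (R := k) a * Coalgebra.counit (R := k) b := by
  let h : H ⊗[k] H →ₗc[k] H ⊗[k] (H ⊗[k] H) := tmap (.id k H) (S.oneTmul H)
  have key : pull h (S.twistφ F).val = 1 := by
    have e1 : Units.map (pull h) (S.f23 F) = 1 := by
      apply Units.ext
      apply WithConv.ext
      ext a b
      change F.F.val.ofConv (Coalgebra.counit (R := k) a • (S.one ⊗ₜ[k] b)) = _
      have := F.one_F b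
      change F.F.val.ofConv _ = _ at this
      simp [this, mul_comm]
    have e2 : Units.map (pull h) (S.f12 F) = 1 := by
      apply Units.ext
      apply WithConv.ext
      ext a b
      change F.F.val.ofConv (a ⊗ₜ[k] (Coalgebra.counit (R := k) b • S.one)) = _
      have := F.F_one a
      change F.F.val.ofConv _ = _ at this
      simp [this, mul_comm]
    have e3 : Units.map (pull h) (S.f1_23 F) = F.F := by
      apply Units.ext
      apply WithConv.ext
      ext a b
      change F.F.val.ofConv (a ⊗ₜ[k] S.mul (S.one ⊗ₜ b)) = _
      rw [S.one_mul]
      rfl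
    have e4 : Units.map (pull h) (S.f12_3 F) = F.F := by
      apply Units.ext
      apply WithConv.ext
      ext a b
      change F.F.val.ofConv (S.mul (a ⊗ₜ[k] S.one) ⊗ₜ b) = _
      rw [S.mul_one]
      rfl
    have e5 : Units.map (pull h) S.φu = 1 := by
      apply Units.ext
      apply WithConv.ext
      ext a b
      have := S.φ_one a b
      change S.φ.ofConv _ = _ at this
      change S.φ.ofConv (a ⊗ₜ[k] (S.one ⊗ₜ[k] b)) = _
      simp [this, mul_comm]
    change (Units.map (pull h) (S.twistφ F)).val = 1
    simp [twistφ, e1, e2, e3, e4, e5]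
  have := congrArg (fun f : Functional k (H ⊗[k] H) => f (a ⊗ₜ b)) key
  refine Eq.trans this ?_
  simp [mul_comm]

/-- Pull-back of invertible functionals. -/
noncomputable abbrev um (h : C →ₗc[k] D) : (Functional k D)ˣ →* (Functional k C)ˣ :=
  Units.map (pull h)

lemma um_eq {h h' : C →ₗc[k] D} (hh : h.toLinearMap = h'.toLinearMap)
    (x : (Functional k D)ˣ) : um h x = um h' x :=
  Units.ext (Coaction.pull_eq_pull hh x.val)

lemma um_um (h : C →ₗc[k] D) (h' : D →ₗc[k] E) (x : (Functional k E)ˣ) :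
    um h (um h' x) = um (h'.comp h) x := rfl

lemma um_conj {h h' : C →ₗc[k] D} {P : (Functional k C)ˣ}
    (hh : h.toLinearMap = h'.toLinearMap ∘ₗ (conj P).toLinearMap)
    (x : (Functional k D)ˣ) : um h x = P * um h' x * P⁻¹ :=
  Units.ext ((Coaction.pull_eq_pull (h' := h'.comp (conj P)) hh x.val).trans
    (pull_comp_conj P h' x.val))

lemma um_intertwines {X : (Functional k C)ˣ} {h h' : C →ₗc[k] D}
    (H : Intertwines X.val h.toLinearMap h'.toLinearMap) (x : (Functional k D)ˣ) :
    um h x * X = X * um h' x := Units.ext (H.pull_mul x.val)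

lemma group_cocycle {G : Type*} [Group G] {a b c d e f g h i j m n s₁ s₂ t₁ t₂ t₃ : G}
    (h1 : t₁ * t₂ * t₃ = s₁ * s₂) (h2 : j * t₁ = t₁ * e) (h3 : f * t₃ = t₃ * n)
    (h4 : i * a = a * i) :
    (a * b * t₁ * c⁻¹ * d⁻¹) * (d * (c * e * t₂ * f⁻¹ * g⁻¹) * d⁻¹) *
      (d * g * t₃ * h⁻¹ * i⁻¹) =
    (a * (b * j * s₁ * m⁻¹ * i⁻¹) * a⁻¹) * (i * (a * m * s₂ * n⁻¹ * h⁻¹) * i⁻¹) := by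
  have e1 : e = t₁⁻¹ * (j * t₁) := by rw [h2]; group
  have e2 : n = t₃⁻¹ * (f * t₃) := by rw [h3]; group
  have e3 : s₂ = s₁⁻¹ * (t₁ * t₂ * t₃) := by rw [h1]; group
  have e4 : i⁻¹ * (a⁻¹ * (i * a)) = 1 := by rw [h4]; group
  have e5 : ∀ x, i⁻¹ * (a⁻¹ * (i * (a * x))) = x := fun x => by
    have := congrArg (· * x) e4
    simpa [mul_assoc] using this
  subst e1 e2 e3
  simp [mul_assoc, e5]

lemma group_left {G : Type*} [Group G]
    {f12 p l f12_3 f23 f1_23 φcab fcab fca rac fac facb φacb fa_cb fcb rbc φ : G}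
    (h1 : l = φcab * rac * φacb⁻¹ * rbc * φ) (h2 : fcab * rac = rac * facb)
    (h3 : fa_cb * rbc = rbc * f1_23) :
    f12 * (p * l * f12_3⁻¹) * f12⁻¹ =
      (f12 * p * φcab * fcab⁻¹ * fca⁻¹) * (fca * rac * fac⁻¹) *
      (fcb * fa_cb * φacb * facb⁻¹ * fac⁻¹)⁻¹ * (fcb * rbc * f23⁻¹) *
      (f23 * f1_23 * φ * f12_3⁻¹ * f12⁻¹) := by
  have e1 : facb = rac⁻¹ * (fcab * rac) := by rw [h2]; group
  have e2 : f1_23 = rbc⁻¹ * (fa_cb * rbc) := by rw [h3]; group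
  subst e1 e2 h1
  simp [mul_assoc]

lemma group_right {G : Type*} [Group G]
    {f23 q l f1_23 fca fb_ca φbca rac fac fb_ac φbac fba_c fba rab f12 f12_3 φ : G}
    (h1 : l = φbca⁻¹ * rac * φbac * rab * φ⁻¹) (h2 : fb_ca * rac = rac * fb_ac)
    (h3 : fba_c * rab = rab * f12_3) :
    f23 * (q * l * f1_23⁻¹) * f23⁻¹ =
      (fca * fb_ca * φbca * q⁻¹ * f23⁻¹)⁻¹ * (fca * rac * fac⁻¹) *
      (fac * fb_ac * φbac * fba_c⁻¹ * fba⁻¹) * (fba * rab * f12⁻¹) *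
      (f23 * f1_23 * φ * f12_3⁻¹ * f12⁻¹)⁻¹ := by
  have e1 : fb_ac = rac⁻¹ * (fb_ca * rac) := by rw [h2]; group
  have e2 : f12_3 = rab⁻¹ * (fba_c * rab) := by rw [h3]; group
  subst e1 e2 h1
  simp [mul_assoc]

end lemmas

end CoquasitriangularCoquasibialgebra
end Twist


section Twist

variable {k : Type u} {H : Type v} [Field k] [AddCommGroup H] [Module k H] [Coalgebra k H]

namespace CoquasitriangularCoquasibialgebra

variable (S : CoquasitriangularCoquasibialgebra k H) (F : TwoCochain S)

section lemmas

variable {C D E : Type*} [AddCommMonoid C] [Module k C] [Coalgebra k C]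
  [AddCommMonoid D] [Module k D] [Coalgebra k D] [AddCommMonoid E] [Module k E] [Coalgebra k E]

lemma lift_right {h h' : C →ₗc[k] D} {P : (Functional k C)ˣ}
    (hh : h.toLinearMap = h'.toLinearMap ∘ₗ (conj P).toLinearMap) :
    (tmap (.id k E) h).toLinearMap =
      (tmap (.id k E) h').toLinearMap ∘ₗ (conj (um (dropL k E C) P)).toLinearMap := by
  rw [← tmap_conj_right]
  change LinearMap.lTensor E h.toLinearMap = LinearMap.lTensor E h'.toLinearMap ∘ₗ
    LinearMap.lTensor E (conj P).toLinearMap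
  rw [hh, LinearMap.lTensor_comp]

lemma lift_left {h h' : C →ₗc[k] D} {P : (Functional k C)ˣ}
    (hh : h.toLinearMap = h'.toLinearMap ∘ₗ (conj P).toLinearMap) :
    (tmap h (.id k E)).toLinearMap =
      (tmap h' (.id k E)).toLinearMap ∘ₗ (conj (um (dropR k C E) P)).toLinearMap := by
  rw [← tmap_conj_left]
  change LinearMap.rTensor E h.toLinearMap = LinearMap.rTensor E h'.toLinearMap ∘ₗ
    LinearMap.rTensor E (conj P).toLinearMap
  rw [hh, LinearMap.rTensor_comp]

lemma lift_pre {h h' : C →ₗc[k] D} {P : (Functional k C)ˣ}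
    (hh : h.toLinearMap = h'.toLinearMap ∘ₗ (conj P).toLinearMap) (g : E →ₗc[k] C) :
    (h.comp g).toLinearMap = (h'.comp g).toLinearMap ∘ₗ (conj (um g P)).toLinearMap := by
  change h.toLinearMap ∘ₗ g.toLinearMap = (h'.toLinearMap ∘ₗ g.toLinearMap) ∘ₗ _
  rw [hh, LinearMap.comp_assoc, conj_comp, LinearMap.comp_assoc]

lemma um_drop_comm (f : (Functional k C)ˣ) (g : (Functional k D)ˣ) :
    um (dropL k C D) g * um (dropR k C D) f = um (dropR k C D) f * um (dropL k C D) g := by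
  refine um_intertwines ?_ g
  have h : Intertwines f.val (Coalgebra.counit (R := k) (A := C)) Coalgebra.counit := by
    change convR (1 : Functional k C).ofConv _ = convL _ (1 : Functional k C).ofConv
    rw [convR_ofConv, Coaction.convL_ofConv, _root_.one_mul, _root_.mul_one]
  have h2 := (h.right D).post (TensorProduct.lid k D).toLinearMap
  convert h2 using 1
  · rfl
  · ext a b
    simp
  · ext a b
    simp

lemma twistMul_eq : (S.twistMul F).toLinearMap = S.mul.toLinearMap ∘ₗ (conj F.F).toLinearMap :=
  rfl

end lemmas

section lemmas

variable {C : Type*} [AddCommMonoid C] [Module k C] [Coalgebra k C]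
  (h : C →ₗc[k] H ⊗[k] (H ⊗[k] H))

lemma um_f23 : um h (S.f23 F) = um ((dropL k H (H ⊗[k] H)).comp h) F.F := rfl
lemma um_f12 : um h (S.f12 F) = um ((tmap (.id k H) (dropR k H H)).comp h) F.F := rfl
lemma um_f1_23 : um h (S.f1_23 F) = um ((tmap (.id k H) S.mul).comp h) F.F := rfl
lemma um_f12_3 : um h (S.f12_3 F) =
    um (((tmap S.mul (.id k H)).comp (assocL k H H H)).comp h) F.F := rfl

end lemmas

lemma f12_eq : um (assocL k H H H) (um (dropR k (H ⊗[k] H) H) F.F) = S.f12 F := by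
  change um ((dropR k (H ⊗[k] H) H).comp (assocL k H H H)) F.F =
    um (tmap (.id k H) (dropR k H H)) F.F
  apply um_eq
  ext a b c
  change Coalgebra.counit (R := k) c • (a ⊗ₜ[k] b) = a ⊗ₜ[k] (Coalgebra.counit (R := k) c • b)
  simp

lemma twist_cocycle :
    pull (dropL k H (H ⊗[k] (H ⊗[k] H))) (S.twistφ F).val *
      pull (tmap (.id k H) ((tmap (S.twistMul F) (.id k H)).comp (assocL k H H H)))
        (S.twistφ F).val *
      pull (tmap (.id k H) (tmap (.id k H) (dropR k H H))) (S.twistφ F).val =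
    pull (tmap (.id k H) (tmap (.id k H) (S.twistMul F))) (S.twistφ F).val *
      pull ((tmap (S.twistMul F) (.id k (H ⊗[k] H))).comp (assocL k H H (H ⊗[k] H)))
        (S.twistφ F).val := by
  let Z : H ⊗[k] (H ⊗[k] (H ⊗[k] H)) →ₗc[k] H ⊗[k] (H ⊗[k] H) := dropL k H (H ⊗[k] (H ⊗[k] H))
  let A : H ⊗[k] (H ⊗[k] (H ⊗[k] H)) →ₗc[k] H ⊗[k] (H ⊗[k] H) :=
    tmap (.id k H) ((tmap S.mul (.id k H)).comp (assocL k H H H))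
  let B : H ⊗[k] (H ⊗[k] (H ⊗[k] H)) →ₗc[k] H ⊗[k] (H ⊗[k] H) :=
    tmap (.id k H) (tmap (.id k H) (dropR k H H))
  let X : H ⊗[k] (H ⊗[k] (H ⊗[k] H)) →ₗc[k] H ⊗[k] (H ⊗[k] H) :=
    tmap (.id k H) (tmap (.id k H) S.mul)
  let Y : H ⊗[k] (H ⊗[k] (H ⊗[k] H)) →ₗc[k] H ⊗[k] (H ⊗[k] H) :=
    (tmap S.mul (.id k (H ⊗[k] H))).comp (assocL k H H (H ⊗[k] H))
  have hA : um (tmap (.id k H) ((tmap (S.twistMul F) (.id k H)).comp (assocL k H H H)))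
      (S.twistφ F) = um Z (S.f12 F) * um A (S.twistφ F) * (um Z (S.f12 F))⁻¹ := by
    rw [← f12_eq]
    have h1 := lift_left (E := H) (S.twistMul_eq F)
    have h2 := lift_pre h1 (assocL k H H H)
    have h3 := lift_right (E := H) h2
    exact um_conj h3 _
  have hX : um (tmap (.id k H) (tmap (.id k H) (S.twistMul F))) (S.twistφ F) =
      um Z (S.f23 F) * um X (S.twistφ F) * (um Z (S.f23 F))⁻¹ :=
    by
    have h1 := lift_right (E := H) (S.twistMul_eq F)
    have h2 := lift_right (E := H) h1
    exact um_conj h2 _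
  have hi : um (assocL k H H (H ⊗[k] H)) (um (dropR k (H ⊗[k] H) (H ⊗[k] H)) F.F) =
      um B (S.f12 F) := by
    rw [um_um, um_f12]
    apply um_eq
    ext a b c d
    simp [B, smul_smul, mul_comm]
  have hY : um ((tmap (S.twistMul F) (.id k (H ⊗[k] H))).comp (assocL k H H (H ⊗[k] H)))
      (S.twistφ F) = um B (S.f12 F) * um Y (S.twistφ F) * (um B (S.f12 F))⁻¹ := by
    rw [← hi]
    have h1 := lift_left (E := H ⊗[k] H) (S.twistMul_eq F)
    have h2 := lift_pre h1 (assocL k H H (H ⊗[k] H))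
    exact um_conj h2 _
  have q1 : um A (S.f23 F) = um Z (S.f12_3 F) := by
    simp only [um_f23, um_f12, um_f1_23, um_f12_3]
    apply um_eq
    ext a b c d
    simp [Z, A, B, X, Y, smul_smul, mul_comm]
  have q2 : um A (S.f12 F) = um B (S.f1_23 F) := by
    simp only [um_f23, um_f12, um_f1_23, um_f12_3]
    apply um_eq
    ext a b c d
    simp [Z, A, B, X, Y, smul_smul, mul_comm]
  have q3 : um B (S.f23 F) = um Z (S.f12 F) := by
    simp only [um_f23, um_f12, um_f1_23, um_f12_3]
    apply um_eq
    ext a b c d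
    simp [Z, A, B, X, Y, smul_smul, mul_comm]
  have q4 : um X (S.f23 F) = um Z (S.f1_23 F) := by
    simp only [um_f23, um_f12, um_f1_23, um_f12_3]
    apply um_eq
    ext a b c d
    simp [Z, A, B, X, Y, smul_smul, mul_comm]
  have q5 : um X (S.f12 F) = um B (S.f12 F) := by
    simp only [um_f23, um_f12, um_f1_23, um_f12_3]
    apply um_eq
    ext a b c d
    simp [Z, A, B, X, Y, smul_smul, mul_comm]
  have q6 : um Y (S.f23 F) = um Z (S.f23 F) := by
    simp only [um_f23, um_f12, um_f1_23, um_f12_3]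
    apply um_eq
    ext a b c d
    simp [Z, A, B, X, Y, smul_smul, mul_comm]
  have q7 : um Y (S.f1_23 F) = um X (S.f12_3 F) := by
    simp only [um_f23, um_f12, um_f1_23, um_f12_3]
    apply um_eq
    ext a b c d
    simp [Z, A, B, X, Y, smul_smul, mul_comm]
  have q8 : um Y (S.f12 F) = um B (S.f12_3 F) := by
    simp only [um_f23, um_f12, um_f1_23, um_f12_3]
    apply um_eq
    ext a b c d
    simp [Z, A, B, X, Y, smul_smul, mul_comm]
  have r1 : um Z S.φu * um A S.φu * um B S.φu = um X S.φu * um Y S.φu := Units.ext S.cocycle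
  have r2 : um X (S.f1_23 F) * um Z S.φu = um Z S.φu * um A (S.f1_23 F) := by
    refine um_intertwines (X := um Z S.φu)
      (h := (tmap (.id k H) S.mul).comp (tmap (.id k H) (tmap (.id k H) S.mul)))
      (h' := (tmap (.id k H) S.mul).comp
        (tmap (.id k H) ((tmap S.mul (.id k H)).comp (assocL k H H H)))) ?_ F.F
    have := S.intertwines_φ.left H
    convert this using 1 <;> (ext; rfl)
  let J : H ⊗[k] (H ⊗[k] (H ⊗[k] H)) →ₗc[k] (H ⊗[k] (H ⊗[k] H)) ⊗[k] H :=
    (assocL k H (H ⊗[k] H) H).comp (tmap (.id k H) (assocL k H H H))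
  have hB : um B S.φu = um J (um (dropR k (H ⊗[k] (H ⊗[k] H)) H) S.φu) := by
    rw [um_um]
    apply um_eq
    ext a b c d
    simp [B, J]
  have r3 : um A (S.f12_3 F) * um B S.φu = um B S.φu * um Y (S.f12_3 F) := by
    rw [hB]
    refine um_intertwines (X := um J (um (dropR k (H ⊗[k] (H ⊗[k] H)) H) S.φu))
      (h := ((tmap S.mul (.id k H)).comp (assocL k H H H)).comp A)
      (h' := ((tmap S.mul (.id k H)).comp (assocL k H H H)).comp Y) ?_ F.F
    have := (S.intertwines_φ.right H).pre J
    convert this using 1 <;> (ext; rfl)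
  have r4 : um B (S.f12 F) * um Z (S.f23 F) = um Z (S.f23 F) * um B (S.f12 F) := by
    have e : um Z (S.f23 F) =
        um (assocL k H H (H ⊗[k] H)) (um (dropL k (H ⊗[k] H) (H ⊗[k] H)) F.F) := by
      rw [um_um, um_f23]
      apply um_eq
      ext a b c d
      simp [Z, smul_smul, mul_comm]
    rw [← hi, e, ← map_mul, ← map_mul, um_drop_comm]
  have key : um Z (S.twistφ F) *
      um (tmap (.id k H) ((tmap (S.twistMul F) (.id k H)).comp (assocL k H H H))) (S.twistφ F) *
      um B (S.twistφ F) =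
    um (tmap (.id k H) (tmap (.id k H) (S.twistMul F))) (S.twistφ F) *
      um ((tmap (S.twistMul F) (.id k (H ⊗[k] H))).comp (assocL k H H (H ⊗[k] H)))
        (S.twistφ F) := by
    rw [hA, hX, hY]
    simp only [twistφ, map_mul, map_inv, q1, q2, q3, q4, q5, q6, q7, q8]
    exact group_cocycle r1 r2 r3 r4
  exact congrArg Units.val key

lemma twist_R_mul_left :
    pull ((tmap (S.twistMul F) (.id k H)).comp (assocL k H H H)) (S.twistR F).val =
      pull ((flip k (H ⊗[k] H) H).comp (assocL k H H H)) (S.twistφ F).val *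
      pull (tmap (.id k H) (dropL k H H)) (S.twistR F).val *
      pull (tmap (.id k H) (flip k H H)) (S.twistφ F).inv *
      pull (dropL k H (H ⊗[k] H)) (S.twistR F).val *
      (S.twistφ F).val := by
  let L : H ⊗[k] (H ⊗[k] H) →ₗc[k] H ⊗[k] H := (tmap S.mul (.id k H)).comp (assocL k H H H)
  let cab : H ⊗[k] (H ⊗[k] H) →ₗc[k] H ⊗[k] (H ⊗[k] H) :=
    (flip k (H ⊗[k] H) H).comp (assocL k H H H)
  let ac : H ⊗[k] (H ⊗[k] H) →ₗc[k] H ⊗[k] H := tmap (.id k H) (dropL k H H)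
  let acb : H ⊗[k] (H ⊗[k] H) →ₗc[k] H ⊗[k] (H ⊗[k] H) := tmap (.id k H) (flip k H H)
  let bc : H ⊗[k] (H ⊗[k] H) →ₗc[k] H ⊗[k] H := dropL k H (H ⊗[k] H)
  have hL : um ((tmap (S.twistMul F) (.id k H)).comp (assocL k H H H)) (S.twistR F) =
      S.f12 F * um L (S.twistR F) * (S.f12 F)⁻¹ := by
    rw [← f12_eq]
    have h1 := lift_left (E := H) (S.twistMul_eq F)
    have h2 := lift_pre h1 (assocL k H H H)
    exact um_conj h2 _
  have q1 : um cab (S.f23 F) = S.f12 F := by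
    rw [um_f23]
    apply um_eq
    ext a b c
    simp [cab, smul_smul, mul_comm]
  have q2 : um cab (S.f1_23 F) = um L (um (flip k H H) F.F) := by
    rw [um_f1_23, um_um]
    apply um_eq
    ext a b c
    simp [cab, L]
  have q3 : um cab (S.f12 F) = um ac (um (flip k H H) F.F) := by
    rw [um_f12, um_um]
    apply um_eq
    ext a b c
    simp [cab, ac, smul_smul, mul_comm]
  have q4 : um L F.F = S.f12_3 F := rfl
  have q5 : um acb (S.f12 F) = um ac F.F := by
    rw [um_f12]
    apply um_eq
    ext a b c
    simp [acb, ac, smul_smul, mul_comm]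
  have q6 : um acb (S.f23 F) = um bc (um (flip k H H) F.F) := by
    rw [um_f23, um_um]
    apply um_eq
    ext a b c
    simp [acb, bc, smul_smul, mul_comm]
  have q7 : um bc F.F = S.f23 F := rfl
  have r1 : um L S.Ru = um cab S.φu * um ac S.Ru * (um acb S.φu)⁻¹ * um bc S.Ru * S.φu :=
    Units.ext S.R_mul_left
  have r2 : um cab (S.f12_3 F) * um ac S.Ru = um ac S.Ru * um acb (S.f12_3 F) := by
    let J : H ⊗[k] (H ⊗[k] H) →ₗc[k] (H ⊗[k] H) ⊗[k] H :=
      (assocL k H H H).comp (tmap (.id k H) (flip k H H))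
    have hJ : um ac S.Ru = um J (um (dropR k (H ⊗[k] H) H) S.Ru) := by
      rw [um_um]
      apply um_eq
      ext a b c
      simp [J, ac]
    rw [hJ]
    refine um_intertwines (X := um J (um (dropR k (H ⊗[k] H) H) S.Ru))
      (h := ((tmap S.mul (.id k H)).comp (assocL k H H H)).comp cab)
      (h' := ((tmap S.mul (.id k H)).comp (assocL k H H H)).comp acb) ?_ F.F
    have := (S.intertwines_R.right H).pre J
    convert this using 1 <;> (ext; rfl)
  have r3 : um acb (S.f1_23 F) * um bc S.Ru = um bc S.Ru * S.f1_23 F := by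
    refine um_intertwines (X := um bc S.Ru)
      (h := (tmap (.id k H) S.mul).comp acb)
      (h' := tmap (.id k H) S.mul) ?_ F.F
    have := S.intertwines_R.left H
    convert this using 1 <;> (ext; rfl)
  have key : um ((tmap (S.twistMul F) (.id k H)).comp (assocL k H H H)) (S.twistR F) =
      um cab (S.twistφ F) * um ac (S.twistR F) * (um acb (S.twistφ F))⁻¹ * um bc (S.twistR F) *
        S.twistφ F := by
    rw [hL]
    simp only [twistφ, twistR, map_mul, map_inv, q1, q2, q3, q4, q5, q6, q7]
    exact group_left r1 r2 r3
  exact congrArg Units.val key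

lemma twist_R_mul_right :
    pull (tmap (.id k H) (S.twistMul F)) (S.twistR F).val =
      pull ((assocR k H H H).comp (flip k H (H ⊗[k] H))) (S.twistφ F).inv *
      pull (tmap (.id k H) (dropL k H H)) (S.twistR F).val *
      pull (((assocR k H H H).comp (tmap (flip k H H) (.id k H))).comp (assocL k H H H))
        (S.twistφ F).val *
      pull (tmap (.id k H) (dropR k H H)) (S.twistR F).val *
      (S.twistφ F).inv := by
  let L : H ⊗[k] (H ⊗[k] H) →ₗc[k] H ⊗[k] H := tmap (.id k H) S.mul
  let bca : H ⊗[k] (H ⊗[k] H) →ₗc[k] H ⊗[k] (H ⊗[k] H) :=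
    (assocR k H H H).comp (flip k H (H ⊗[k] H))
  let ac : H ⊗[k] (H ⊗[k] H) →ₗc[k] H ⊗[k] H := tmap (.id k H) (dropL k H H)
  let bac : H ⊗[k] (H ⊗[k] H) →ₗc[k] H ⊗[k] (H ⊗[k] H) :=
    ((assocR k H H H).comp (tmap (flip k H H) (.id k H))).comp (assocL k H H H)
  let ab : H ⊗[k] (H ⊗[k] H) →ₗc[k] H ⊗[k] H := tmap (.id k H) (dropR k H H)
  have hL : um (tmap (.id k H) (S.twistMul F)) (S.twistR F) =
      S.f23 F * um L (S.twistR F) * (S.f23 F)⁻¹ :=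
    um_conj (lift_right (S.twistMul_eq F)) _
  have q1 : um bca (S.f12 F) = S.f23 F := by
    rw [um_f12]
    apply um_eq
    ext a b c
    simp [bca, smul_smul, mul_comm]
  have q2 : um bca (S.f12_3 F) = um L (um (flip k H H) F.F) := by
    rw [um_f12_3, um_um]
    apply um_eq
    ext a b c
    simp [bca, L]
  have q3 : um bca (S.f23 F) = um ac (um (flip k H H) F.F) := by
    rw [um_f23, um_um]
    apply um_eq
    ext a b c
    simp [bca, ac, smul_smul, mul_comm]
  have q4 : um L F.F = S.f1_23 F := rfl
  have q5 : um bac (S.f23 F) = um ac F.F := by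
    rw [um_f23]
    apply um_eq
    ext a b c
    simp [bac, ac, smul_smul, mul_comm]
  have q6 : um bac (S.f12 F) = um ab (um (flip k H H) F.F) := by
    rw [um_f12, um_um]
    apply um_eq
    ext a b c
    simp [bac, ab, smul_smul, mul_comm]
  have q7 : um ab F.F = S.f12 F := rfl
  have r1 : um L S.Ru =
      (um bca S.φu)⁻¹ * um ac S.Ru * um bac S.φu * um ab S.Ru * S.φu⁻¹ :=
    Units.ext S.R_mul_right
  have r2 : um bca (S.f1_23 F) * um ac S.Ru = um ac S.Ru * um bac (S.f1_23 F) := by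
    have hJ : um ac S.Ru = um bac (um (dropL k H (H ⊗[k] H)) S.Ru) := by
      rw [um_um]
      apply um_eq
      ext a b c
      simp [bac, ac]
    rw [hJ]
    refine um_intertwines (X := um bac (um (dropL k H (H ⊗[k] H)) S.Ru))
      (h := (tmap (.id k H) S.mul).comp bca)
      (h' := (tmap (.id k H) S.mul).comp bac) ?_ F.F
    have := (S.intertwines_R.left H).pre bac
    convert this using 1 <;> (ext; rfl)
  have r3 : um bac (S.f12_3 F) * um ab S.Ru = um ab S.Ru * S.f12_3 F := by
    have hJ : um ab S.Ru = um (assocL k H H H) (um (dropR k (H ⊗[k] H) H) S.Ru) := by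
      rw [um_um]
      apply um_eq
      ext a b c
      simp [ab]
    rw [hJ]
    refine um_intertwines (X := um (assocL k H H H) (um (dropR k (H ⊗[k] H) H) S.Ru))
      (h := ((tmap S.mul (.id k H)).comp (assocL k H H H)).comp bac)
      (h' := (tmap S.mul (.id k H)).comp (assocL k H H H)) ?_ F.F
    have := (S.intertwines_R.right H).pre (assocL k H H H)
    convert this using 1 <;> (ext; rfl)
  have key : um (tmap (.id k H) (S.twistMul F)) (S.twistR F) =
      (um bca (S.twistφ F))⁻¹ * um ac (S.twistR F) * um bac (S.twistφ F) * um ab (S.twistR F) *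
        (S.twistφ F)⁻¹ := by
    rw [hL]
    simp only [twistφ, twistR, map_mul, map_inv, q1, q2, q3, q4, q5, q6, q7]
    exact group_right r1 r2 r3
  exact congrArg Units.val key

/-- The cotwist `H^F` of `H` by the 2-cochain `F`: the same coalgebra and unit element, with the
product, the 3-cocycle and the coquasitriangular structure conjugated by `F`. -/
noncomputable def twist : CoquasitriangularCoquasibialgebra k H where
  mul := S.twistMul F
  one := S.one
  one_groupLike := S.one_groupLike
  one_mul := S.twist_one_mul F
  mul_one := S.twist_mul_one F
  φ := (S.twistφ F).val
  φinv := (S.twistφ F).inv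
  φ_φinv := (S.twistφ F).val_inv
  φinv_φ := (S.twistφ F).inv_val
  cocycle := S.twist_cocycle F
  φ_one := S.twist_φ_one F
  quasi_assoc := S.twist_quasi_assoc F
  R := (S.twistR F).val
  Rinv := (S.twistR F).inv
  R_Rinv := (S.twistR F).val_inv
  Rinv_R := (S.twistR F).inv_val
  R_mul_left := S.twist_R_mul_left F
  R_mul_right := S.twist_R_mul_right F
  quasi_comm := S.twist_quasi_comm F

end CoquasitriangularCoquasibialgebra
end Twist


section TwistComod

open Coaction CoquasitriangularCoquasibialgebra

variable {k : Type u} {H : Type v} [Field k] [AddCommGroup H] [Module k H] [Coalgebra k H]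
  {S : CoquasitriangularCoquasibialgebra k H} (F : TwoCochain S)

section Raw

variable {V : Type*} [AddCommMonoid V] [Module k V] (ρ : Coaction k H V)

lemma act_triv_left :
    ((triv S).ext ρ).act F.F.val = LinearMap.id := by
  ext v
  have hv := LinearMap.congr_fun ρ.counit v
  simp only [LinearMap.comp_apply, LinearEquiv.coe_coe, LinearMap.id_apply] at hv
  simp only [TensorProduct.AlgebraTensorModule.curry_apply,
    LinearMap.restrictScalars_self, TensorProduct.curry_apply, LinearMap.id_apply]
  conv_rhs => rw [← hv]
  simp only [act, LinearMap.comp_apply, ext_coact_tmul, LinearEquiv.coe_coe, triv,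
    TensorProduct.mk_apply]
  generalize ρ.coact v = x
  induction x with
  | zero => simp
  | add x y hx hy => simp only [map_add, TensorProduct.tmul_add, hx, hy]
  | tmul d w =>
    have := F.one_F d
    change F.F.val.ofConv _ = _ at this
    simp [this]

lemma act_triv_right :
    (ρ.ext (triv S)).act F.F.val = LinearMap.id := by
  ext v
  have hv := LinearMap.congr_fun ρ.counit v
  simp only [LinearMap.comp_apply, LinearEquiv.coe_coe, LinearMap.id_apply] at hv
  simp only [TensorProduct.AlgebraTensorModule.curry_apply,
    LinearMap.restrictScalars_self, TensorProduct.curry_apply, LinearMap.id_apply]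
  conv_rhs => rw [← hv]
  simp only [act, LinearMap.comp_apply, ext_coact_tmul, LinearEquiv.coe_coe, triv,
    TensorProduct.mk_apply]
  generalize ρ.coact v = x
  induction x with
  | zero => simp
  | add x y hx hy => simp only [map_add, TensorProduct.add_tmul, hx, hy]
  | tmul d w =>
    have := F.F_one d
    change F.F.val.ofConv _ = _ at this
    simp [this, TensorProduct.smul_tmul']


lemma twistMul_assoc {m : V ⊗[k] V →ₗ[k] V} (hm : Compat (tens S ρ ρ) ρ (.id k H) m)
    (hassoc : m ∘ₗ LinearMap.rTensor V m =
      m ∘ₗ LinearMap.lTensor V m ∘ₗ assocInvLin S ρ ρ ρ) :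
    (m ∘ₗ (ρ.ext ρ).act F.F.val) ∘ₗ LinearMap.rTensor V (m ∘ₗ (ρ.ext ρ).act F.F.val) =
      (m ∘ₗ (ρ.ext ρ).act F.F.val) ∘ₗ LinearMap.lTensor V (m ∘ₗ (ρ.ext ρ).act F.F.val) ∘ₗ
        assocInvLin (S.twist F) ρ ρ ρ := by
  have hL : (ρ.ext ρ).act F.F.val ∘ₗ LinearMap.rTensor V (m) =
      LinearMap.rTensor V (m) ∘ₗ
        ((ρ.ext ρ).ext ρ).act (pull (tmap S.mul (.id k H)) F.F.val) := by
    rw [← act_ext_tens_left]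
    have h := (hm.ext (compat_id ρ)).act F.F.val
    have e : pull (tmap (.id k H) (.id k H)) F.F.val = F.F.val := by
      apply WithConv.ext
      ext; rfl
    rw [e] at h
    exact h
  have hR : (ρ.ext ρ).act F.F.val ∘ₗ LinearMap.lTensor V (m) =
      LinearMap.lTensor V (m) ∘ₗ (ρ.ext (ρ.ext ρ)).act (S.f1_23 F).val := by
    have e0 : (ρ.ext (ρ.ext ρ)).act (S.f1_23 F).val =
      (ρ.ext (tens S ρ ρ)).act F.F.val := (act_ext_tens_right ρ ρ ρ F.F.val).symm
    rw [e0]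
    have h := ((compat_id ρ).ext hm).act F.F.val
    have e : pull (tmap (.id k H) (.id k H)) F.F.val = F.F.val := by
      apply WithConv.ext
      ext; rfl
    rw [e] at h
    exact h
  have hL2 : LinearMap.rTensor V ((ρ.ext ρ).act F.F.val) =
      ((ρ.ext ρ).ext ρ).act (pull (dropR k (H ⊗[k] H) H) F.F.val) :=
    (ext_act_dropR _ _ _).symm
  have hR2 : LinearMap.lTensor V ((ρ.ext ρ).act F.F.val) =
      (ρ.ext (ρ.ext ρ)).act (S.f23 F).val :=
    (ext_act_dropL _ _ _).symm
  have eP : pull (assocR k H H H) (S.f12 F * S.f12_3 F).val =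
      pull (dropR k (H ⊗[k] H) H) F.F.val * pull (tmap S.mul (.id k H)) F.F.val := by
    rw [Units.val_mul, map_mul]
    congr 1
    · change pull _ (pull _ F.F.val) = _
      rw [pull_pull]
      apply pull_eq_pull
      ext a b c
      simp
    · change pull _ (pull _ F.F.val) = _
      rw [pull_pull]
      apply pull_eq_pull
      ext a b c
      simp
  have eφ : (S.twist F).φinv * (S.f23 F * S.f1_23 F).val =
      (S.f12 F * S.f12_3 F).val * S.φinv := by
    change ((S.twistφ F)⁻¹ * (S.f23 F * S.f1_23 F)).val = (S.f12 F * S.f12_3 F * (S.φu)⁻¹).val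
    congr 1
    simp [twistφ, _root_.mul_assoc, ← _root_.mul_assoc (S.f23 F)⁻¹]
  have l1 : LinearMap.rTensor V (m ∘ₗ (ρ.ext ρ).act F.F.val) =
      LinearMap.rTensor V (m) ∘ₗ LinearMap.rTensor V ((ρ.ext ρ).act F.F.val) :=
    LinearMap.rTensor_comp _ _ _
  have l2 : LinearMap.lTensor V (m ∘ₗ (ρ.ext ρ).act F.F.val) =
      LinearMap.lTensor V (m) ∘ₗ LinearMap.lTensor V ((ρ.ext ρ).act F.F.val) :=
    LinearMap.lTensor_comp _ _ _
  have lhs : (m ∘ₗ (ρ.ext ρ).act F.F.val) ∘ₗ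
      LinearMap.rTensor V (m ∘ₗ (ρ.ext ρ).act F.F.val) =
      (m ∘ₗ LinearMap.rTensor V (m)) ∘ₗ
        ((ρ.ext ρ).ext ρ).act (pull (assocR k H H H) (S.f12 F * S.f12_3 F).val) := by
    rw [l1, LinearMap.comp_assoc, ← LinearMap.comp_assoc _ _ ((ρ.ext ρ).act F.F.val), hL, hL2,
      LinearMap.comp_assoc, act_act, eP, LinearMap.comp_assoc]
  have rhs : (m ∘ₗ (ρ.ext ρ).act F.F.val) ∘ₗ
      LinearMap.lTensor V (m ∘ₗ (ρ.ext ρ).act F.F.val) ∘ₗ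
        assocInvLin (S.twist F) ρ ρ ρ =
      m ∘ₗ LinearMap.lTensor V (m) ∘ₗ
        (ρ.ext (ρ.ext ρ)).act ((S.f12 F * S.f12_3 F).val * S.φinv) ∘ₗ
          (TensorProduct.assoc k V V V).toLinearMap := by
    rw [l2, LinearMap.comp_assoc, LinearMap.comp_assoc,
      ← LinearMap.comp_assoc _ _ ((ρ.ext ρ).act F.F.val), hR, hR2]
    unfold assocInvLin
    rw [LinearMap.comp_assoc, ← LinearMap.comp_assoc _ _ (act _ (S.f23 F).val), act_act,
      ← LinearMap.comp_assoc _ _ (act _ (S.f1_23 F).val), act_act, _root_.mul_assoc, ← Units.val_mul, eφ]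
  have mid : (ρ.ext (ρ.ext ρ)).act ((S.f12 F * S.f12_3 F).val * S.φinv) ∘ₗ
      (TensorProduct.assoc k V V V).toLinearMap = assocInvLin S ρ ρ ρ ∘ₗ
        ((ρ.ext ρ).ext ρ).act (pull (assocR k H H H) (S.f12 F * S.f12_3 F).val) := by
    unfold assocInvLin
    rw [← act_act, LinearMap.comp_assoc, (compat_assocR ρ ρ ρ).act, LinearMap.comp_assoc]
  rw [lhs, rhs, hassoc, mid]
  rfl

end Raw

namespace Comod

/-- An `H`-comodule, regarded as an `H^F`-comodule. -/
noncomputable def twist (X : Comod S) : Comod (S.twist F) where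
  carrier := X
  ρ := X.ρ

/-- A morphism of `H`-comodules, regarded as a morphism of `H^F`-comodules. -/
noncomputable def twistHom {X Y : Comod S} (f : X ⟶ Y) : X.twist F ⟶ Y.twist F := homMk (lin f) f.2

/-- An isomorphism of `H`-comodules, regarded as an isomorphism of `H^F`-comodules. -/
@[simps]
noncomputable def twistIso {X Y : Comod S} (f : X ≅ Y) : X.twist F ≅ Y.twist F where
  hom := twistHom F f.hom
  inv := twistHom F f.inv
  hom_inv_id := hom_ext (congrArg lin f.hom_inv_id)
  inv_hom_id := hom_ext (congrArg lin f.inv_hom_id)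

/-- The linear map `u ⊗ v ↦ F(u₍₁₎,v₍₁₎) u₍₂₎ ⊗ v₍₂₎`. -/
noncomputable def cochainLin (X Y : Comod S) : X ⊗[k] Y →ₗ[k] X ⊗[k] Y := (X.ρ.ext Y.ρ).act F.F.val

lemma cochainLin_colinear (X Y : Comod S) :
    (tens S X.ρ Y.ρ).coact ∘ₗ cochainLin F X Y =
      LinearMap.lTensor H (cochainLin F X Y) ∘ₗ (tens (S.twist F) X.ρ Y.ρ).coact := by
  change (X.ρ.ext Y.ρ).push S.mul.toLinearMap ∘ₗ _ =
    _ ∘ₗ (X.ρ.ext Y.ρ).push (S.twistMul F).toLinearMap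
  unfold cochainLin
  rw [push_act, lTensor_act_push, twistMul_eq, comp_conj, convL_convR, convR_convR,
    Units.inv_mul, convR_one]

/-- The morphism `U ⊗_F V → U ⊗ V`, `u ⊗ v ↦ F(u₍₁₎,v₍₁₎) u₍₂₎ ⊗ v₍₂₎` of `H^F`-comodules. -/
noncomputable def cochainHom (X Y : Comod S) : X.twist F ⊗ Y.twist F ⟶ (X ⊗ Y).twist F :=
  homMk (X := X.twist F ⊗ Y.twist F) (Y := (X ⊗ Y).twist F) (cochainLin F X Y)
    (cochainLin_colinear F X Y)

open MonObj

variable (A : Comod S) [MonObj A]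

/-- The cotwisted product `a ⊗ b ↦ F(a₍₁₎,b₍₁₎) a₍₂₎b₍₂₎` on the comodule of `A`. -/
noncomputable def twistMul : A.twist F ⊗ A.twist F ⟶ A.twist F :=
  cochainHom F A A ≫ twistHom F μ[A]

/-- The unit of the cotwisted algebra, the same as the one of `A`. -/
noncomputable def twistOne : 𝟙_ (Comod (S.twist F)) ⟶ A.twist F :=
  homMk (X := 𝟙_ (Comod (S.twist F))) (Y := A.twist F) (lin η[A]) η[A].2

lemma lin_twistMul : lin (twistMul F A) = lin μ[A] ∘ₗ cochainLin F A A := rfl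

/-- The cotwist `A_F` of an algebra `A` in `H`-comodules: the same comodule with the same unit and
the product `a ⊗ b ↦ F(a₍₁₎,b₍₁₎) a₍₂₎b₍₂₎`, an algebra in `H^F`-comodules. -/
noncomputable instance : MonObj (A.twist F) where
  one := twistOne F A
  mul := twistMul F A
  one_mul := by
    apply hom_ext
    have h := ((compat_lin η[A]).ext (compat_id A.ρ)).act F.F.val
    have e : pull (tmap (.id k H) (.id k H)) F.F.val = F.F.val := by
      apply WithConv.ext
      ext; rfl
    rw [e] at h
    have h2 : cochainLin F A A ∘ₗ LinearMap.rTensor A (lin η[A]) =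
        LinearMap.rTensor A (lin η[A]) :=
      h.trans (congrArg (TensorProduct.map (lin η[A]) LinearMap.id ∘ₗ ·) (act_triv_left F A.ρ))
    have h3 : lin μ[A] ∘ₗ LinearMap.rTensor A.carrier (lin η[A]) =
        (TensorProduct.lid k A).toLinearMap := congrArg lin (MonObj.one_mul A)
    change (lin μ[A] ∘ₗ cochainLin F A A) ∘ₗ LinearMap.rTensor A.carrier (lin η[A]) =
      (TensorProduct.lid k A).toLinearMap
    exact (congrArg (lin μ[A] ∘ₗ ·) h2).trans h3
  mul_one := by
    apply hom_ext
    have h := ((compat_id A.ρ).ext (compat_lin η[A])).act F.F.val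
    have e : pull (tmap (.id k H) (.id k H)) F.F.val = F.F.val := by
      apply WithConv.ext
      ext; rfl
    rw [e] at h
    have h2 : cochainLin F A A ∘ₗ LinearMap.lTensor A (lin η[A]) =
        LinearMap.lTensor A (lin η[A]) :=
      h.trans (congrArg (TensorProduct.map LinearMap.id (lin η[A]) ∘ₗ ·) (act_triv_right F A.ρ))
    have h3 : lin μ[A] ∘ₗ LinearMap.lTensor A.carrier (lin η[A]) =
        (TensorProduct.rid k A).toLinearMap := congrArg lin (MonObj.mul_one A)
    change (lin μ[A] ∘ₗ cochainLin F A A) ∘ₗ LinearMap.lTensor A.carrier (lin η[A]) =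
      (TensorProduct.rid k A).toLinearMap
    exact (congrArg (lin μ[A] ∘ₗ ·) h2).trans h3
  mul_assoc := hom_ext (twistMul_assoc F A.ρ (compat_lin μ[A]) (congrArg lin (MonObj.mul_assoc A)))

end Comod

end TwistComod


section Formula

open Coaction CoquasitriangularCoquasibialgebra

variable {k : Type u} {H : Type v} [Field k] [AddCommGroup H] [Module k H] [Coalgebra k H]
  {S : CoquasitriangularCoquasibialgebra k H}

namespace Comod

/-- The gauge transformation `S_α` between a bracketed tensor power of `A` in `H^F`-comodules and
the same bracketed tensor power in `H`-comodules: `S_{(α,β)} = 𝓕 (S_α ⊗ S_β)`, where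
`𝓕 (u ⊗ v) = F(u₍₁₎,v₍₁₎) u₍₂₎ ⊗ v₍₂₎`. -/
noncomputable def gauge (F : TwoCochain S) (A : Comod S) :
    ∀ w : Word, (ev (A.twist F)).obj w →ₗ[k] (ev A).obj w
  | .of _ => (LinearMap.id : A →ₗ[k] A)
  | .unit => (LinearMap.id : k →ₗ[k] k)
  | .tensor x y => cochainLin F ((ev A).obj x) ((ev A).obj y) ∘ₗ
      TensorProduct.map (gauge F A x) (gauge F A y)

/-- The identification of the vector spaces underlying a bracketed tensor power of `A` in
`H^F`-comodules and the same bracketed tensor power in `H`-comodules. -/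
noncomputable def samePow (F : TwoCochain S) (A : Comod S) :
    ∀ w : Word, (ev (A.twist F)).obj w ≃ₗ[k] (ev A).obj w
  | .of _ => LinearEquiv.refl k A
  | .unit => LinearEquiv.refl k k
  | .tensor x y => TensorProduct.congr (samePow F A x) (samePow F A y)

end Comod

variable (k H) in
/-- The coalgebra `((H ⊗ H) ⊗ H) ⊗ ⋯` with `n + 1` factors, bracketed from left to right. -/
noncomputable def lrPow : ℕ → CoalgCat.{v} k
  | 0 => CoalgCat.of k H
  | n + 1 => CoalgCat.of k (lrPow n ⊗[k] H)

/-- The product `((h⁰ h¹) h²) ⋯ hⁿ` from left to right in `H`. -/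
noncomputable def lrMul (S : CoquasitriangularCoquasibialgebra k H) : ∀ n, lrPow k H n →ₗc[k] H
  | 0 => CoalgHom.id k H
  | n + 1 => S.mul.comp (tmap (lrMul S n) (.id k H))

/-- The functional
`F(h⁰₍₁₎,h¹₍₁₎) F(h⁰₍₂₎h¹₍₂₎,h²₍₁₎) F((h⁰₍₃₎h¹₍₃₎)h²₍₂₎,h³₍₁₎) ⋯
F((⋯(h⁰₍ₙ₎h¹₍ₙ₎)⋯)hⁿ⁻¹₍₂₎,hⁿ₍₁₎)` of `h⁰ ⊗ ⋯ ⊗ hⁿ`. -/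
noncomputable def lrFactor (F : TwoCochain S) : ∀ n, Functional k (lrPow k H n)
  | 0 => (1 : Functional k H)
  | n + 1 => pull (dropR k (lrPow k H n) H) (lrFactor F n) *
      pull (tmap (lrMul S n) (.id k H)) F.F.val

/-- The coaction
`a⁰ ⊗ ⋯ ⊗ aⁿ ↦ (a⁰₍₁₎ ⊗ ⋯ ⊗ aⁿ₍₁₎) ⊗ (a⁰₍₂₎ ⊗ ⋯ ⊗ aⁿ₍₂₎)` of `H ⊗ ⋯ ⊗ H` on
`A ⊗ ⋯ ⊗ A`, both bracketed from left to right. -/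
noncomputable def lrCoaction (A : Comod S) :
    ∀ n, Coaction k (lrPow k H n) ((ev A).obj (Word.lr (n + 1)))
  | 0 => A.ρ
  | n + 1 => (lrCoaction A n).ext A.ρ

/-- The linear functional on a bracketed tensor power of `A` which represents a cochain
`φ : A^{⊗(n+1)} → 1`, for a given bracketing of the source. -/
noncomputable def cochainRep {A : Comod S} [MonObj A] {σ : A ≅ A} {hσ : IsRibbon σ} {n : ℕ}
    (φ : (cocyclicModule (k := k) σ hσ).obj n) (s : Bracketing (n + 1)) : (ev A).obj s.1 →ₗ[k] k :=
  Comod.lin (Y := 𝟙_ (Comod S)) (TPow.rep φ.1 s (.lr 0))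

end Formula

end QuasiCyclic

open CategoryTheory QuasiCyclic

/-! Cotwisting changes neither the comodules nor the colinear maps: H-Com and H^F-Com are the same
k-linear category with two different braided monoidal structures. The operator 𝓕 (u ⊗ v) =
F(u₍₁₎,v₍₁₎) u₍₂₎ ⊗ v₍₂₎ is an isomorphism from the tensor product of H^F-Com to that of H-Com, and
it makes the identity functor T : H-Com ⥤ H^F-Com a braided monoidal functor. The formulas for the
cotwisted data are what this requires: the definition of φ_F is the associativity condition on 𝓕
solved for φ_F (`act_assoc`), the definition of R_F is the compatibility with the braidings solved
for R_F (`act_braid`), the unit conditions are F(1,a) = ε(a) = F(a,1), and the conjugated product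
makes 𝓕 colinear. The algebra A_F is then the image T A, with product T(m) ∘ 𝓕.

The cocyclic module is built only from the linear braided monoidal category, the algebra and σ.
Hence a fully faithful linear braided monoidal functor identifies the cocyclic modules of A and T A,
provided that the product, the unit and σ of T A are the images of those of A. This is
`cocyclicModuleIso`, proved for arbitrary categories. The identification conjugates T(f) by the
tensorators of T iterated along the bracketings of source and target (`powIso`). The one thing to
check before it makes sense is independence of the bracketing: the iterated tensorators must
intertwine the canonical isomorphisms of the two categories. Canonical isomorphisms are images of
morphisms of the free monoidal category, so `Corr.map` settles this by induction on such morphisms,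
one square per generator. Each operator `d_i`, `s_i`, `λ` has a representative composed of whiskered
copies of m, η, σ and the braiding, and for these the correspondence is again a square.

For the cotwisting functor the iterated tensorator along α satisfies the recursion of S_α, so it is
S_α (`lin_gaugeHom`), and on the target, the unit object, it is the identity. This yields φ_F^α =
φ^α ∘ S_α. For the left-to-right bracketing, S_α is unrolled by induction (`gauge_lr`): each further
tensor factor contributes one value of F, whose first argument is the product of the coaction
components of the preceding factors, because that product is how H coacts on their tensor product.
-/

namespace QuasiCyclic

/-! ### Bracketed tensor powers under a monoidal functor. -/

section MonoidalTransport

open Functor.LaxMonoidal Functor.OplaxMonoidal Functor.Monoidal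

variable {C D : Type*} [Category C] [MonoidalCategory C] [Category D] [MonoidalCategory D]
  (T : C ⥤ D) [T.Monoidal] (A : C)

section Squares

variable {T} {X Y Z X' Y' Z' : C} {U V W U' V' W' : D}

/-- This is naturality of the tensorator together with the interchange law. The vertical maps `i`,
`j` are left arbitrary in this and the following squares; later they are iterated tensorators, whose
recursion on a tensor word is the composite `(i ⊗ₘ i') ≫ μ` used here, so that each square becomes a
statement about `Corr` by unfolding. -/
lemma square_tensor {i : U ⟶ T.obj X} {j : V ⟶ T.obj Y} {i' : U' ⟶ T.obj X'} {j' : V' ⟶ T.obj Y'}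
    {f : X ⟶ Y} {g : U ⟶ V} {f' : X' ⟶ Y'} {g' : U' ⟶ V'} (h : i ≫ T.map f = g ≫ j)
    (h' : i' ≫ T.map f' = g' ≫ j') :
    ((i ⊗ₘ i') ≫ μ T X X') ≫ T.map (f ⊗ₘ f') = (g ⊗ₘ g') ≫ (j ⊗ₘ j') ≫ μ T Y Y' := by
  rw [Category.assoc, ← μ_natural, tensorHom_comp_tensorHom_assoc, h, h',
    tensorHom_comp_tensorHom_assoc]

lemma square_whiskerLeft (l : W ⟶ T.obj Z) {i : U ⟶ T.obj X} {j : V ⟶ T.obj Y} {f : X ⟶ Y}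
    {g : U ⟶ V} (h : i ≫ T.map f = g ≫ j) :
    ((l ⊗ₘ i) ≫ μ T Z X) ≫ T.map (Z ◁ f) = (W ◁ g) ≫ (l ⊗ₘ j) ≫ μ T Z Y := by
  rw [← id_tensorHom, ← id_tensorHom]
  exact square_tensor (by simp) h

lemma square_whiskerRight (l : W ⟶ T.obj Z) {i : U ⟶ T.obj X} {j : V ⟶ T.obj Y} {f : X ⟶ Y}
    {g : U ⟶ V} (h : i ≫ T.map f = g ≫ j) :
    ((i ⊗ₘ l) ≫ μ T X Z) ≫ T.map (f ▷ Z) = (g ▷ W) ≫ (j ⊗ₘ l) ≫ μ T Y Z := by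
  rw [← tensorHom_id, ← tensorHom_id]
  exact square_tensor h (by simp)

/-- The associativity axiom of a monoidal functor, with the vertical maps `i`, `j`, `l` carried
through the associator of the target category by naturality. -/
lemma square_assoc (i : U ⟶ T.obj X) (j : V ⟶ T.obj Y) (l : W ⟶ T.obj Z) :
    ((((i ⊗ₘ j) ≫ μ T X Y) ⊗ₘ l) ≫ μ T (X ⊗ Y) Z) ≫ T.map (α_ X Y Z).hom =
      (α_ U V W).hom ≫ (i ⊗ₘ ((j ⊗ₘ l) ≫ μ T Y Z)) ≫ μ T X (Y ⊗ Z) := by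
  -- Splits off the inner tensorator from the vertical maps, on either side, so that the two
  -- tensorators become adjacent and the axiom applies.
  have h1 := tensorHom_comp_tensorHom (i ⊗ₘ j) l (μ T X Y) (𝟙 _)
  have h2 := tensorHom_comp_tensorHom i (j ⊗ₘ l) (𝟙 _) (μ T Y Z)
  rw [Category.comp_id, tensorHom_id] at h1
  rw [Category.comp_id, id_tensorHom] at h2
  rw [← h1, ← h2, Category.assoc, Category.assoc, Category.assoc,
    Functor.LaxMonoidal.associativity, associator_naturality_assoc]

/-- Left unitality of the functor and naturality of the left unitor. The empty word is compared by
`ε T`, which is why this map stands in the first slot. -/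
lemma square_left (i : U ⟶ T.obj X) :
    ((ε T ⊗ₘ i) ≫ μ T (𝟙_ C) X) ≫ T.map (λ_ X).hom = (λ_ U).hom ≫ i := by
  rw [← leftUnitor_naturality, Functor.LaxMonoidal.left_unitality, tensorHom_def']
  simp only [Category.assoc]

lemma square_right (i : U ⟶ T.obj X) :
    ((i ⊗ₘ ε T) ≫ μ T X (𝟙_ C)) ≫ T.map (ρ_ X).hom = (ρ_ U).hom ≫ i := by
  rw [← rightUnitor_naturality, Functor.LaxMonoidal.right_unitality, MonoidalCategory.tensorHom_def]
  simp only [Category.assoc]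

end Squares

/-- The tensorator of a monoidal functor, iterated over a bracketed tensor power. -/
noncomputable def powIso : ∀ w : Word, (ev (T.obj A)).obj w ≅ T.obj ((ev A).obj w)
  | .of _ => Iso.refl (T.obj A)
  | .unit => εIso T
  | .tensor x y => (powIso x ⊗ᵢ powIso y) ≪≫ μIso T ((ev A).obj x) ((ev A).obj y)

/-- A morphism of bracketed tensor powers of `A` and one of bracketed tensor powers of `T A`
correspond to each other under the iterated tensorators. -/
def Corr {s t : Word} (f : (ev A).obj s ⟶ (ev A).obj t)
    (g : (ev (T.obj A)).obj s ⟶ (ev (T.obj A)).obj t) : Prop :=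
  (powIso T A s).hom ≫ T.map f = g ≫ (powIso T A t).hom

/-! ### Corresponding morphisms of bracketed tensor powers. -/

namespace Corr

variable {T A}

lemma id (s : Word) : Corr T A (𝟙 ((ev A).obj s)) (𝟙 _) := by
  simp [Corr]

lemma comp {s t w : Word} {f : (ev A).obj s ⟶ (ev A).obj t} {g}
    {f' : (ev A).obj t ⟶ (ev A).obj w} {g'} (h : Corr T A f g) (h' : Corr T A f' g') :
    Corr T A (f ≫ f') (g ≫ g') := by
  unfold Corr at *
  rw [T.map_comp, ← Category.assoc, h, Category.assoc, h', Category.assoc]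

/-- Needed for the generators of the free monoidal category that are inverses of constraints: a
commuting square whose horizontal arrows are invertible can be read backwards. -/
lemma of_inv {s t : Word} {f : (ev A).obj s ≅ (ev A).obj t}
    {g : (ev (T.obj A)).obj s ≅ (ev (T.obj A)).obj t} (h : Corr T A f.hom g.hom) :
    Corr T A f.inv g.inv := by
  unfold Corr at *
  rw [Iso.eq_inv_comp, ← Category.assoc, ← h, Category.assoc, ← T.map_comp]
  simp

lemma tensor {s t s' t' : Word} {f : (ev A).obj s ⟶ (ev A).obj t} {g}
    {f' : (ev A).obj s' ⟶ (ev A).obj t'} {g'} (h : Corr T A f g) (h' : Corr T A f' g') :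
    Corr T A (s := s ⊗ s') (t := t ⊗ t') (f ⊗ₘ f') (g ⊗ₘ g') := square_tensor h h'

lemma whiskerLeft (x : Word) {s t : Word} {f : (ev A).obj s ⟶ (ev A).obj t} {g}
    (h : Corr T A f g) :
    Corr T A (s := x ⊗ s) (t := x ⊗ t) ((ev A).obj x ◁ f) ((ev (T.obj A)).obj x ◁ g) :=
  square_whiskerLeft _ h

lemma whiskerRight (x : Word) {s t : Word} {f : (ev A).obj s ⟶ (ev A).obj t} {g}
    (h : Corr T A f g) :
    Corr T A (s := s ⊗ x) (t := t ⊗ x) (f ▷ (ev A).obj x) (g ▷ (ev (T.obj A)).obj x) :=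
  square_whiskerRight _ h

lemma assoc (x y z : Word) :
    Corr T A (s := (x ⊗ y) ⊗ z) (t := x ⊗ (y ⊗ z))
      (α_ ((ev A).obj x) ((ev A).obj y) ((ev A).obj z)).hom
      (α_ ((ev (T.obj A)).obj x) ((ev (T.obj A)).obj y) ((ev (T.obj A)).obj z)).hom :=
  square_assoc _ _ _

lemma left (x : Word) :
    Corr T A (s := 𝟙_ Word ⊗ x) (t := x) (λ_ ((ev A).obj x)).hom
      (λ_ ((ev (T.obj A)).obj x)).hom := square_left _

lemma right (x : Word) :
    Corr T A (s := x ⊗ 𝟙_ Word) (t := x) (ρ_ ((ev A).obj x)).hom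
      (ρ_ ((ev (T.obj A)).obj x)).hom := square_right _

/-- The coherence statement behind the whole transport. A morphism of words is a formal composite of
constraints, their inverses, whiskerings and tensor products; each generator has its square, and
squares can be pasted, so the iterated tensorators are natural with respect to all composites of
constraints. -/
lemma map {s t : Word} (a : s ⟶ t) : Corr T A ((ev A).map a) ((ev (T.obj A)).map a) := by
  induction a using Quotient.recOn with
  -- Morphisms of words are classes of formal expressions. The claim being a proposition,
  -- independence of the chosen expression is automatic and only expressions have to be treated.
  | h _ _ => rfl
  | f a =>
    induction a with
    | id X => exact id X
    | α_hom x y z => exact assoc x y z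
    | α_inv x y z =>
      exact of_inv (f := α_ ((ev A).obj x) ((ev A).obj y) ((ev A).obj z))
        (g := α_ ((ev (T.obj A)).obj x) ((ev (T.obj A)).obj y) ((ev (T.obj A)).obj z))
        (s := (x ⊗ y) ⊗ z) (t := x ⊗ (y ⊗ z)) (assoc x y z)
    | l_hom x => exact left x
    | l_inv x =>
      exact of_inv (s := 𝟙_ Word ⊗ x) (t := x) (f := λ_ ((ev A).obj x))
        (g := λ_ ((ev (T.obj A)).obj x)) (left x)
    | ρ_hom x => exact right x
    | ρ_inv x =>
      exact of_inv (s := x ⊗ 𝟙_ Word) (t := x) (f := ρ_ ((ev A).obj x))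
        (g := ρ_ ((ev (T.obj A)).obj x)) (right x)
    | comp f g hf hg => exact hf.comp hg
    | whiskerLeft x f hf => exact hf.whiskerLeft x
    | whiskerRight f x hf => exact hf.whiskerRight x
    | tensor f g hf hg => exact hf.tensor hg

/-- The morphism of words chosen in the definition of the canonical isomorphism depends only on the
words, not on the object or the category. Both sides are therefore images of one and the same
morphism, and `map` applies to it. -/
lemma can {s t : Word} (h : s.len = t.len) :
    Corr T A (QuasiCyclic.can A h) (QuasiCyclic.can (T.obj A) h) := map _

end Corr

end MonoidalTransport

/-! ### Transport of the strictified morphisms along a fully faithful linear monoidal functor. -/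

section CochainTransport

open Functor.LaxMonoidal Functor.OplaxMonoidal Functor.Monoidal BPow MonObj

variable {k : Type u} [Field k]
  {C D : Type*} [Category C] [Preadditive C] [Linear k C] [MonoidalCategory C]
  [Category D] [Preadditive D] [Linear k D] [MonoidalCategory D]
  (T : C ⥤ D) [T.Monoidal] [T.Full] [T.Faithful] [T.Additive] [T.Linear k] {A : C}

namespace TPow

/-- A fully faithful linear monoidal functor `T` identifies the morphisms between tensor powers of
`A` with those between tensor powers of `T A`. -/
noncomputable def transport (m n : ℕ) :
    (tpow k A m ⟶ tpow k A n) ≃ₗ[k] (tpow k (T.obj A) m ⟶ tpow k (T.obj A) n) where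
  toFun f := ⟨fun s t => (powIso T A s.1).hom ≫ T.map (rep f s t) ≫ (powIso T A t.1).inv,
    fun s t s' t' => by
      -- Changing the bracketing before or after conjugation by the iterated tensorators gives the
      -- same result; hence the conjugated family is again compatible, and defines a morphism of the
      -- strictification.
      have h1 := Corr.can (T := T) (A := A) (s'.len_eq s)
      have h2 := Corr.can (T := T) (A := A) (t.len_eq t')
      unfold Corr at h1 h2
      beta_reduce
      rw [rep_eq f s t s' t', T.map_comp, T.map_comp, ← Category.assoc, ← Category.assoc, h1]
      simp only [Category.assoc]
      -- The square for the target bracketings, rewritten for the inverse iterated tensorators that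
      -- occur on that side.
      have h3 : T.map (can A (t.len_eq t')) ≫ (powIso T A t'.1).inv =
          (powIso T A t.1).inv ≫ can (T.obj A) (t.len_eq t') := by
        rw [Iso.eq_inv_comp, ← Category.assoc, h2, Category.assoc, Iso.hom_inv_id,
          Category.comp_id]
      rw [h3]⟩
  map_add' f g := by
    apply Subtype.ext
    funext s t
    change _ ≫ T.map (rep f s t + rep g s t) ≫ _ = _
    simp
    rfl
  map_smul' c f := by
    apply Subtype.ext
    funext s t
    change _ ≫ T.map (c • rep f s t) ≫ _ = _
    simp
    rfl
  invFun g := ⟨fun s t => T.preimage ((powIso T A s.1).inv ≫ rep g s t ≫ (powIso T A t.1).hom),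
    fun s t s' t' => by
      have h1 := Corr.can (T := T) (A := A) (s'.len_eq s)
      have h2 := Corr.can (T := T) (A := A) (t.len_eq t')
      unfold Corr at h1 h2
      -- Compatibility of the family of preimages is tested after applying `T`, where the preimages
      -- disappear and only the squares for the canonical isomorphisms remain.
      apply T.map_injective
      simp only [T.map_comp, T.map_preimage, Category.assoc]
      rw [rep_eq g s t s' t']
      simp only [Category.assoc]
      rw [h2, ← Iso.eq_inv_comp] at *
      simp [h1]⟩
  left_inv f := by
    apply Subtype.ext
    funext s t
    apply T.map_injective
    change T.map (T.preimage (_ ≫ (_ ≫ T.map (rep f s t) ≫ _) ≫ _)) = T.map (rep f s t)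
    simp
  right_inv g := by
    apply Subtype.ext
    funext s t
    change _ ≫ T.map (T.preimage (_ ≫ rep g s t ≫ _)) ≫ _ = rep g s t
    simp

lemma rep_transport {m n : ℕ} (f : tpow k A m ⟶ tpow k A n) (s : Bracketing m)
    (t : Bracketing n) : rep (transport T m n f) s t =
      (powIso T A s.1).hom ≫ T.map (rep f s t) ≫ (powIso T A t.1).inv := rfl

/-- The iterated tensorators on the middle object cancel. One bracketing of it suffices, the
composite in the strictification being independent of that choice. -/
lemma transport_comp {l m n : ℕ} (f : tpow k A l ⟶ tpow k A m) (g : tpow k A m ⟶ tpow k A n) :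
    transport T l n (f ≫ g) = transport T l m f ≫ transport T m n g := by
  apply hom_ext (.lr l) (.lr n)
  rw [rep_comp _ _ _ (.lr m), rep_transport, rep_transport, rep_transport,
    rep_comp _ _ _ (.lr m)]
  simp

/-- Reduces every computation of a transported operator to one convenient representative: once a
square holds for one pair of bracketings, the two classes correspond for all of them. -/
lemma transport_cls {m n : ℕ} {s t : Word} {f : (ev A).obj s ⟶ (ev A).obj t}
    {g : (ev (T.obj A)).obj s ⟶ (ev (T.obj A)).obj t} (h : Corr T A f g)
    (hs : s.len = m) (ht : t.len = n) :
    transport (k := k) T m n (cls (s := ⟨s⟩) (t := ⟨t⟩) f hs ht) =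
      cls (s := ⟨s⟩) (t := ⟨t⟩) g hs ht := by
  apply hom_ext ⟨s, hs⟩ ⟨t, ht⟩
  have h' : (powIso T A s).hom ≫ T.map f ≫ (powIso T A t).inv = g := by
    rw [← Category.assoc, h, Category.assoc, Iso.hom_inv_id, Category.comp_id]
  have e1 : rep (cls (k := k) (s := ⟨s⟩) (t := ⟨t⟩) f hs ht) ⟨s, hs⟩ ⟨t, ht⟩ = f := rep_ofRep _ _ _
  have e2 : rep (cls (k := k) (s := ⟨s⟩) (t := ⟨t⟩) g hs ht) ⟨s, hs⟩ ⟨t, ht⟩ = g := rep_ofRep _ _ _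
  rw [rep_transport, e1, e2, h']

variable [MonObj A] [MonObj (T.obj A)]

/-- On one letter the iterated tensorator is the identity and on two letters it is the tensorator,
so the hypothesis `hμ` says exactly that the two products correspond; whiskering by the untouched
factors preserves this. The algebra structure on `T.obj A` is a free parameter constrained by `hμ`,
so that the cotwisted algebra can be inserted with the structure it already has. -/
lemma transport_mulAt (hμ : (μ[T.obj A] : T.obj A ⊗ T.obj A ⟶ T.obj A) =
      Functor.LaxMonoidal.μ T A A ≫ T.map μ[A]) {n i : ℕ} (hi : i ≤ n) :
    transport (k := k) T (n + 2) (n + 1) (mulAt (A := A) n i hi) = mulAt n i hi := by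
  have h : Corr T A (s := Word.letter ⊗ Word.letter) (t := Word.letter) μ[A] μ[T.obj A] := by
    change ((𝟙 _ ⊗ₘ 𝟙 _) ≫ Functor.LaxMonoidal.μ T A A) ≫ T.map μ[A] = μ[T.obj A] ≫ 𝟙 _
    rw [hμ]
    simp
  exact transport_cls T ((h.whiskerRight (Word.lr (n - i))).whiskerLeft (Word.lr i)) _ _

/-- The empty word is compared by `ε T`, so the hypothesis `hη` is the square for the units; it
remains to whisker it. -/
lemma transport_unitAt (hη : (η[T.obj A] : 𝟙_ D ⟶ T.obj A) = ε T ≫ T.map η[A])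
    {n i : ℕ} (hi : i ≤ n) :
    transport (k := k) T (n + 1) (n + 2) (unitAt (A := A) n i hi) = unitAt n i hi := by
  have h : Corr T A (s := 𝟙_ Word) (t := Word.letter) η[A] η[T.obj A] := by
    change ε T ≫ T.map η[A] = η[T.obj A] ≫ 𝟙 _
    rw [hη, Category.comp_id]
  exact transport_cls T ((h.whiskerRight (Word.lr (n - i))).whiskerLeft (Word.lr (i + 1))) _ _

end TPow

end CochainTransport

/-! ### Transport of ribbon structures and cocyclic modules along a braided functor. -/

section BraidedTransport

open Functor.LaxMonoidal BPow MonObj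

variable {k : Type u} [Field k]
  {C D : Type*} [Category C] [Preadditive C] [Linear k C] [MonoidalCategory C] [BraidedCategory C]
  [Category D] [Preadditive D] [Linear k D] [MonoidalCategory D] [BraidedCategory D]
  (T : C ⥤ D) [T.Braided] {A : C}

/-- The braided functor axiom for the tensorator, preceded by naturality of the braiding in the
target category. It is the one further square that the cyclicity map requires. -/
lemma square_braiding {X Y : C} {U V : D} (i : U ⟶ T.obj X) (j : V ⟶ T.obj Y) :
    ((i ⊗ₘ j) ≫ Functor.LaxMonoidal.μ T X Y) ≫ T.map (β_ X Y).hom =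
      (β_ U V).hom ≫ (j ⊗ₘ i) ≫ Functor.LaxMonoidal.μ T Y X := by
  rw [Category.assoc, Functor.LaxBraided.braided, BraidedCategory.braiding_naturality_assoc]

lemma Corr.braiding (x y : Word) :
    Corr T A (s := x ⊗ y) (t := y ⊗ x) (β_ ((ev A).obj x) ((ev A).obj y)).hom
      (β_ ((ev (T.obj A)).obj x) ((ev (T.obj A)).obj y)).hom := square_braiding T _ _

section

variable [MonObj A] [MonObj (T.obj A)] {σ : A ≅ A} {σ' : T.obj A ≅ T.obj A}

/-- Precomposing the image of the ribbon equation with the tensorator gives the ribbon equation for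
the product `hμ`: the tensorator can be moved past the image of the double braiding and past that of
σ ⊗ σ. -/
lemma IsRibbon.transport (hμ : (μ[T.obj A] : T.obj A ⊗ T.obj A ⟶ T.obj A) =
      Functor.LaxMonoidal.μ T A A ≫ T.map μ[A])
    (hη : (η[T.obj A] : 𝟙_ D ⟶ T.obj A) = ε T ≫ T.map η[A]) (hσ' : σ'.hom = T.map σ.hom)
    (hσ : IsRibbon σ) : IsRibbon σ' where
  mul := by
    rw [hμ, hσ', Category.assoc, Category.assoc, ← T.map_comp, ← hσ.mul]
    simp only [T.map_comp, Category.assoc]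
    -- One use of the braided axiom for each factor of Ψ², then naturality of the tensorator for σ ⊗
    -- σ.
    rw [Functor.LaxBraided.braided_assoc, Functor.LaxBraided.braided_assoc, ← μ_natural_assoc]
  unit := by
    rw [hη, hσ', Category.assoc, ← T.map_comp, hσ.unit]

end

variable [T.Full] [T.Faithful] [T.Additive] [T.Linear k] {σ : A ≅ A} {σ' : T.obj A ≅ T.obj A}

namespace TPow

/-- On the left-to-right representative the operator is a braiding followed by a whiskered σ. The
squares of these two constituents are pasted. -/
lemma transport_rot (hσ' : σ'.hom = T.map σ.hom) (n : ℕ) :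
    transport (k := k) T (n + 1) (n + 1) (rot σ n) = rot σ' n := by
  have h : Corr T A (s := Word.letter) (t := Word.letter) σ.hom σ'.hom := by
    change 𝟙 _ ≫ T.map σ.hom = σ'.hom ≫ 𝟙 _
    rw [hσ', Category.id_comp, Category.comp_id]
  exact transport_cls T ((Corr.braiding T (Word.lr n) Word.letter).comp
    (h.whiskerRight (Word.lr n))) _ _

/-- The sign in λ is a scalar, so linearity of the transport reduces the claim to the unsigned
operator. -/
lemma transport_cycMap (hσ' : σ'.hom = T.map σ.hom) (n : ℕ) (φ : tpow k A (n + 1) ⟶ tpow k A 0) :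
    transport (k := k) T (n + 1) 0 (cycMap σ n φ) = cycMap σ' n (transport T (n + 1) 0 φ) := by
  simp only [cycMap, Linear.leftComp_apply, lam, transport_comp, map_smul, transport_rot T hσ']

/-- Transport intertwines the cyclicity maps, hence also their powers; being injective, it preserves
and reflects the equation φ λⁿ⁺¹ = φ. -/
lemma transport_mem_cochains (hσ' : σ'.hom = T.map σ.hom) (n : ℕ)
    (φ : tpow k A (n + 1) ⟶ tpow k A 0) :
    transport (k := k) T (n + 1) 0 φ ∈ cochains σ' n ↔ φ ∈ cochains σ n := by
  have h : ∀ m, transport (k := k) T (n + 1) 0 ((cycMap σ n ^ m) φ) =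
      (cycMap σ' n ^ m) (transport T (n + 1) 0 φ) := by
    intro m
    induction m with
    | zero => rfl
    | succ m ih =>
      rw [pow_succ', Module.End.mul_apply, pow_succ', Module.End.mul_apply, ← ih,
        transport_cycMap T hσ']
  change (cycMap σ' n ^ (n + 1)) _ = transport T (n + 1) 0 φ ↔ (cycMap σ n ^ (n + 1)) φ = φ
  rw [← h]
  exact (transport T (n + 1) 0).injective.eq_iff

variable [MonObj A] [MonObj (T.obj A)]

/-- An inner face is a product of neighbours. The last face is the composite of the rotation with
the product of the first two factors, so it needs both correspondences. -/
lemma transport_face (hμ : (μ[T.obj A] : T.obj A ⊗ T.obj A ⟶ T.obj A) =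
      Functor.LaxMonoidal.μ T A A ≫ T.map μ[A]) (hσ' : σ'.hom = T.map σ.hom) (n i : ℕ) :
    transport (k := k) T (n + 2) (n + 1) (face σ n i) = face σ' n i := by
  unfold face
  split_ifs with h
  · exact transport_mulAt T hμ h
  · rw [transport_comp, transport_rot T hσ', transport_mulAt T hμ]

end TPow

open TPow

variable [MonObj A] [MonObj (T.obj A)]

/-- A fully faithful linear braided monoidal functor `T` identifies the cocyclic module of `A` with
that of `T A`. -/
noncomputable def cocyclicModuleIso (hμ : (μ[T.obj A] : T.obj A ⊗ T.obj A ⟶ T.obj A) =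
      Functor.LaxMonoidal.μ T A A ≫ T.map μ[A])
    (hη : (η[T.obj A] : 𝟙_ D ⟶ T.obj A) = ε T ≫ T.map η[A]) (hσ' : σ'.hom = T.map σ.hom)
    (hσ : IsRibbon σ) (hT : IsRibbon σ') :
    (cocyclicModule (k := k) σ hσ).Iso (cocyclicModule (k := k) σ' hT) where
  -- The image of the cochains for A must be all of the cochains for T A; applying the membership
  -- criterion to the preimage of an arbitrary ψ gives both inclusions at once.
  equiv n := LinearEquiv.ofSubmodules (transport T (n + 1) 0) (cochains σ n) (cochains σ' n) (by
    ext ψ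
    rw [Submodule.mem_map_equiv, ← transport_mem_cochains T hσ', LinearEquiv.apply_symm_apply])
  map_d n i φ := by
    apply Subtype.ext
    change transport T (n + 2) 0 (face σ n i ≫ φ.1) = face σ' n i ≫ transport T (n + 1) 0 φ.1
    rw [transport_comp, transport_face T hμ hσ']
  map_s n i φ := by
    apply Subtype.ext
    change transport T (n + 1) 0 (unitAt n i (by omega) ≫ φ.1) =
      unitAt n i (by omega) ≫ transport T (n + 2) 0 φ.1
    rw [transport_comp, transport_unitAt T hη]
  map_cyc n φ := Subtype.ext (transport_cycMap T hσ' n φ.1)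

end BraidedTransport

/-! ### Coherence of the 2-cochain as a tensorator: linear identities. -/

section CotwistFunctor

open Coaction CoquasitriangularCoquasibialgebra

variable {k : Type u} {H : Type v} [Field k] [AddCommGroup H] [Module k H] [Coalgebra k H]
  {S : CoquasitriangularCoquasibialgebra k H} (F : TwoCochain S)

section Linear

variable {U V W : Type*} [AddCommMonoid U] [Module k U] [AddCommMonoid V] [Module k V]
  [AddCommMonoid W] [Module k W]
  (ρU : Coaction k H U) (ρV : Coaction k H V) (ρW : Coaction k H W)

/-- A functional on H ⊗ H sees vectors only through their coaction components, which colinear maps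
do not touch. This is naturality of the tensorator in both variables. -/
lemma act_map {U' V' : Type*} [AddCommMonoid U'] [Module k U'] [AddCommMonoid V'] [Module k V']
    {ρU : Coaction k H U} {ρV : Coaction k H V} {ρU' : Coaction k H U'} {ρV' : Coaction k H V'}
    {L : U →ₗ[k] U'} {M : V →ₗ[k] V'} (hL : Compat ρU ρU' (.id k H) L)
    (hM : Compat ρV ρV' (.id k H) M) (f : Functional k (H ⊗[k] H)) :
    (ρU'.ext ρV').act f ∘ₗ TensorProduct.map L M =
      TensorProduct.map L M ∘ₗ (ρU.ext ρV).act f := by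
  have h := (hL.ext hM).act f
  have e : pull (tmap (.id k H) (.id k H)) f = f := by
    apply WithConv.ext
    ext; rfl
  rwa [e] at h

/-- Compatibility of the cotwisted associativity constraint with the original one. -/
lemma act_assoc :
    (assocInvLin S ρU ρV ρW ∘ₗ ((tens S ρU ρV).ext ρW).act F.F.val) ∘ₗ
        LinearMap.rTensor W ((ρU.ext ρV).act F.F.val) =
      ((ρU.ext (tens S ρV ρW)).act F.F.val ∘ₗ
        LinearMap.lTensor U ((ρV.ext ρW).act F.F.val)) ∘ₗ
          assocInvLin (S.twist F) ρU ρV ρW := by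
  rw [LinearMap.comp_assoc, LinearMap.comp_assoc]
  have hL2 : LinearMap.rTensor W ((ρU.ext ρV).act F.F.val) =
      ((ρU.ext ρV).ext ρW).act (pull (dropR k (H ⊗[k] H) H) F.F.val) :=
    (ext_act_dropR _ _ _).symm
  have hR2 : LinearMap.lTensor U ((ρV.ext ρW).act F.F.val) =
      (ρU.ext (ρV.ext ρW)).act (S.f23 F).val :=
    (ext_act_dropL _ _ _).symm
  have hR : (ρU.ext (tens S ρV ρW)).act F.F.val =
      (ρU.ext (ρV.ext ρW)).act (S.f1_23 F).val := act_ext_tens_right ρV ρW ρU F.F.val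
  -- The two factors F(a,b) and F(ab,c) coming from the left-hand side, collected into one
  -- functional of (a ⊗ b) ⊗ c.
  have eP : pull (assocR k H H H) (S.f12 F * S.f12_3 F).val =
      pull (dropR k (H ⊗[k] H) H) F.F.val * pull (tmap S.mul (.id k H)) F.F.val := by
    rw [Units.val_mul, map_mul]
    congr 1
    · change pull _ (pull _ F.F.val) = _
      rw [pull_pull]
      apply pull_eq_pull
      ext a b c
      simp
    · change pull _ (pull _ F.F.val) = _
      rw [pull_pull]
      apply pull_eq_pull
      ext a b c
      simp
  -- The heart of the matter: φ_F = F(b,c) F(a,bc) φ F⁻¹(ab,c) F⁻¹(a,b), inverted and multiplied on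
  -- the right by F(b,c) F(a,bc). The left-hand functional belongs to cotwisted reassociation
  -- followed by the two uses of 𝓕 on a right-bracketed product, the right-hand one to the two uses
  -- of 𝓕 on a left-bracketed product followed by the original reassociation.
  have eφ : (S.twist F).φinv * (S.f23 F * S.f1_23 F).val =
      (S.f12 F * S.f12_3 F).val * S.φinv := by
    change ((S.twistφ F)⁻¹ * (S.f23 F * S.f1_23 F)).val = (S.f12 F * S.f12_3 F * (S.φu)⁻¹).val
    congr 1
    simp [twistφ, _root_.mul_assoc, ← _root_.mul_assoc (S.f23 F)⁻¹]
  -- All operators become actions of functionals on threefold tensor products. Successive actions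
  -- multiply in the convolution algebra with the operator applied first as the left factor.
  rw [act_ext_tens_left, hL2, hR2, hR, act_act, ← eP]
  unfold assocInvLin
  rw [LinearMap.comp_assoc, ← (compat_assocR ρU ρV ρW).act, ← LinearMap.comp_assoc, act_act,
    ← eφ, Units.val_mul, ← LinearMap.comp_assoc _ _ (act _ (S.f23 F).val), act_act,
    ← LinearMap.comp_assoc, act_act, _root_.mul_assoc]

/-- Compatibility of the cotwisted braiding with the original one. -/
lemma act_braid :
    braidLin S ρU ρV ∘ₗ (ρU.ext ρV).act F.F.val =
      (ρV.ext ρU).act F.F.val ∘ₗ braidLin (S.twist F) ρU ρV := by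
  -- The definition R_F(a,b) = F(b,a) R(a,b) F⁻¹(a,b), multiplied by F on the right: the trailing
  -- inverse cancels.
  have e : (S.twist F).R * F.F.val = pull (flip k H H) F.F.val * S.R := by
    change (S.twistR F * F.F).val = (Units.map (pull (flip k H H)) F.F * S.Ru).val
    congr 1
    simp [twistR]
  -- Passing the flip of the two factors exchanges the arguments of F, which accounts for the factor
  -- F(b,a) in R_F. Flipping twice then restores F itself.
  have h := (compat_flip ρU ρV).act (pull (flip k H H) F.F.val)
  have e2 : pull (flip k H H) (pull (flip k H H) F.F.val) = F.F.val := by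
    apply WithConv.ext
    ext; rfl
  rw [e2] at h
  unfold braidLin
  rw [LinearMap.comp_assoc, ← h, ← LinearMap.comp_assoc, act_act, ← e, ← act_act,
    LinearMap.comp_assoc]

end Linear

/-! ### The cotwisting functor as a braided monoidal functor. -/

namespace Comod

/-- The cotwisting functor `H-Com ⥤ H^F-Com`, the identity on underlying comodules and maps. -/
noncomputable def twistFunctor : Comod S ⥤ Comod (S.twist F) where
  obj X := X.twist F
  map f := twistHom F f

/-- Colinearity refers only to the coactions, and these are not changed by the cotwist; the two
spaces of morphisms consist of the same linear maps. The same remark gives faithfulness and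
linearity. -/
instance : (twistFunctor F).Full where
  map_surjective {X Y} f := ⟨homMk (X := X) (Y := Y) (lin f) f.2, rfl⟩

instance : (twistFunctor F).Faithful where
  map_injective h := hom_ext (congrArg lin h)

-- The internal structure of H^F is irrelevant to this statement and to the others so marked, which
-- hold on underlying linear maps or follow from identities already proved; it is therefore kept
-- opaque. The unit conditions are not so marked: they compare trivial comodules, which agree
-- because H and H^F share their unit element.
attribute [local irreducible] CoquasitriangularCoquasibialgebra.twist in
instance : (twistFunctor F).Additive where
  map_add := rfl

attribute [local irreducible] CoquasitriangularCoquasibialgebra.twist in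
instance : (twistFunctor F).Linear k where
  map_smul _ _ := rfl

attribute [local irreducible] CoquasitriangularCoquasibialgebra.twist in
/-- `cochainHom` is an isomorphism, with inverse `u ⊗ v ↦ F⁻¹(u₍₁₎,v₍₁₎) u₍₂₎ ⊗ v₍₂₎`. -/
noncomputable def cochainIso (X Y : Comod S) : X.twist F ⊗ Y.twist F ≅ (X ⊗ Y).twist F :=
  isoMk (X := X.twist F ⊗ Y.twist F) (Y := (X ⊗ Y).twist F) (cochainLin F X Y)
    ((X.ρ.ext Y.ρ).act F.F⁻¹.val) (cochainLin_colinear F X Y)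
    ((act_act _ _ _).trans ((congrArg (act _) F.F.inv_mul).trans (act_one _)))
    ((act_act _ _ _).trans ((congrArg (act _) F.F.mul_inv).trans (act_one _)))

/-- The unit comodules of `H` and of `H^F` agree. -/
noncomputable def twistUnitIso : 𝟙_ (Comod (S.twist F)) ≅ (𝟙_ (Comod S)).twist F := Iso.refl _

attribute [local irreducible] CoquasitriangularCoquasibialgebra.twist in
-- The tensorator inherits naturality from `act_map`, with an identity in the second variable.
lemma cochainHom_natural_left {X Y : Comod S} (f : X ⟶ Y) (Z : Comod S) :
    twistHom F f ▷ Z.twist F ≫ cochainHom F Y Z = cochainHom F X Z ≫ twistHom F (f ▷ Z) :=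
  hom_ext (act_map (compat_lin f) (compat_id Z.ρ) F.F.val)

attribute [local irreducible] CoquasitriangularCoquasibialgebra.twist in
lemma cochainHom_natural_right {X Y : Comod S} (Z : Comod S) (f : X ⟶ Y) :
    Z.twist F ◁ twistHom F f ≫ cochainHom F Z Y = cochainHom F Z X ≫ twistHom F (Z ◁ f) :=
  hom_ext (act_map (compat_id Z.ρ) (compat_lin f) F.F.val)

attribute [local irreducible] CoquasitriangularCoquasibialgebra.twist in
-- On underlying maps this is `act_assoc`: the cotwisted cocycle φ_F was chosen so that this hexagon
-- commutes.
lemma cochainHom_assoc (X Y Z : Comod S) :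
    cochainHom F X Y ▷ Z.twist F ≫ cochainHom F (X ⊗ Y) Z ≫ twistHom F (α_ X Y Z).hom =
      (α_ (X.twist F) (Y.twist F) (Z.twist F)).hom ≫ X.twist F ◁ cochainHom F Y Z ≫
        cochainHom F X (Y ⊗ Z) :=
  hom_ext (act_assoc F X.ρ Y.ρ Z.ρ)

/-- Since 1 ∈ k coacts through the unit element of H, the tensorator evaluates F at (1,a), where it
is the counit; hence it is the identity on k ⊗ X. The right-hand version uses F(a,1) = ε(a) instead.
-/
lemma cochainHom_left (X : Comod S) : (λ_ (X.twist F)).hom =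
    (twistUnitIso F).hom ▷ X.twist F ≫ cochainHom F (𝟙_ _) X ≫ twistHom F (λ_ X).hom := by
  apply hom_ext
  change (TensorProduct.lid k X).toLinearMap = ((TensorProduct.lid k X).toLinearMap ∘ₗ
    ((triv S).ext X.ρ).act F.F.val) ∘ₗ TensorProduct.map LinearMap.id LinearMap.id
  rw [act_triv_left F X.ρ, TensorProduct.map_id]
  rfl

lemma cochainHom_right (X : Comod S) : (ρ_ (X.twist F)).hom =
    X.twist F ◁ (twistUnitIso F).hom ≫ cochainHom F X (𝟙_ _) ≫ twistHom F (ρ_ X).hom := by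
  apply hom_ext
  change (TensorProduct.rid k X).toLinearMap = ((TensorProduct.rid k X).toLinearMap ∘ₗ
    (X.ρ.ext (triv S)).act F.F.val) ∘ₗ TensorProduct.map LinearMap.id LinearMap.id
  rw [act_triv_right F X.ρ, TensorProduct.map_id]
  rfl

attribute [local irreducible] CoquasitriangularCoquasibialgebra.twist in
-- On underlying maps this is `act_braid`, the relation between R_F and R.
lemma cochainHom_braiding (X Y : Comod S) : cochainHom F X Y ≫ twistHom F (β_ X Y).hom =
    (β_ (X.twist F) (Y.twist F)).hom ≫ cochainHom F Y X :=
  hom_ext (act_braid F X.ρ Y.ρ)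

/-- The 2-cochain serves as tensorator; convolution invertibility of F makes the monoidal structure
strong. The direction is from the tensor product in H^F-Com to that in H-Com, the direction of the
maps S_α. -/
noncomputable instance : (twistFunctor F).Monoidal :=
  Functor.CoreMonoidal.toMonoidal
    { εIso := twistUnitIso F
      μIso := cochainIso F
      μIso_hom_natural_left := cochainHom_natural_left F
      μIso_hom_natural_right := cochainHom_natural_right F
      associativity := cochainHom_assoc F
      left_unitality := cochainHom_left F
      right_unitality := cochainHom_right F }

noncomputable instance : (twistFunctor F).Braided where
  braided := cochainHom_braiding F

/-! ### The gauge maps S_α and their left-to-right form. -/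

/-- The iterated tensorator of the cotwisting functor. -/
noncomputable def gaugeHom (A : Comod S) (w : Word) :
    (ev (A.twist F)).obj w ⟶ ((ev A).obj w).twist F := (powIso (twistFunctor F) A w).hom

/-- Both sides are the identity on a letter and on the unit, and both are built on a tensor word by
applying 𝓕 after the maps of the two parts. The coactions in 𝓕 are those of H-Com, because the
tensorator is formed at the bracketed powers of A and not at those of A_F. -/
lemma lin_gaugeHom (A : Comod S) : ∀ w : Word, lin (gaugeHom F A w) = gauge F A w
  | .of _ => rfl
  | .unit => rfl
  | .tensor x y => by
    change cochainLin F ((ev A).obj x) ((ev A).obj y) ∘ₗ TensorProduct.map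
      (lin (S := S.twist F) (gaugeHom F A x)) (lin (S := S.twist F) (gaugeHom F A y)) = _
    rw [lin_gaugeHom A x, lin_gaugeHom A y]
    rfl

/-- H coacts on a tensor product by multiplying the coaction components. Keeping the components
separate gives `lrCoaction`, and multiplying them from left to right recovers the coaction in H-Com.
This converts a value of F on a tensor power into a value of F on a product of components. -/
lemma compat_lrCoaction (A : Comod S) (n : ℕ) :
    Compat (lrCoaction A n) ((ev A).obj (Word.lr (n + 1))).ρ (lrMul S n) LinearMap.id := by
  induction n with
  | zero => exact compat_id A.ρ
  | succ n ih =>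
    -- First the components of the first n + 1 factors are multiplied together, then that product is
    -- multiplied by the component of the new factor, as in the recursion of `lrMul`.
    have h := (ih.ext (compat_id A.ρ)).comp (compat_cores _ S.mul)
    rw [LinearMap.id_comp, TensorProduct.map_id] at h
    exact h

/-- Adding a factor on the right applies 𝓕 once more, to the left-to-right power and the new copy of
A; this contributes F evaluated on the product of the preceding coaction components and on the new
component. The map `samePow` only identifies the underlying spaces of the two tensor powers, which
are recursively the same. -/
lemma gauge_lr (A : Comod S) (n : ℕ) : gauge F A (Word.lr (n + 1)) =
    (lrCoaction A n).act (lrFactor F n) ∘ₗ (samePow F A (Word.lr (n + 1))).toLinearMap := by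
  induction n with
  | zero =>
    -- Degree n means n + 1 letters, so the induction starts with one letter, where the product of
    -- values of F is empty and the functional is the counit.
    change LinearMap.id = A.ρ.act 1 ∘ₗ LinearMap.id
    rw [act_one]
    rfl
  | succ n ih =>
    -- Expresses the outer 𝓕 through separate coaction components, so that it acts by a functional
    -- on the same coalgebra as the factor from the induction hypothesis.
    have h := ((compat_lrCoaction A n).ext (compat_id A.ρ)).act F.F.val
    rw [TensorProduct.map_id] at h
    have h1 : LinearMap.rTensor A ((lrCoaction A n).act (lrFactor F n)) =
        ((lrCoaction A n).ext A.ρ).act (pull (dropR k (lrPow k H n) H) (lrFactor F n)) :=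
      (ext_act_dropR _ _ _).symm
    have h2 : ((lrCoaction A n).ext A.ρ).act (pull (tmap (lrMul S n) (.id k H)) F.F.val) =
      (((ev A).obj (Word.lr (n + 1))).ρ.ext A.ρ).act F.F.val := h.symm
    change (((ev A).obj (Word.lr (n + 1))).ρ.ext A.ρ).act F.F.val ∘ₗ
      TensorProduct.map (gauge F A (Word.lr (n + 1))) LinearMap.id =
      ((lrCoaction A n).ext A.ρ).act (pull (dropR k (lrPow k H n) H) (lrFactor F n) *
        pull (tmap (lrMul S n) (.id k H)) F.F.val) ∘ₗ
        TensorProduct.map (samePow F A (Word.lr (n + 1))).toLinearMap LinearMap.id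
    -- The newest value of F is the right factor of the convolution product because 𝓕 is applied
    -- after the gauge map of the left part.
    rw [ih, ← act_act, h2, ← h1, LinearMap.comp_assoc]
    congr 1
    exact LinearMap.rTensor_comp _ _ _

end Comod

end CotwistFunctor

end QuasiCyclic

/-! ### The cocyclic modules of an algebra and of its cotwist. -/

namespace QuasiCyclic.Comod

variable {k : Type u} {H : Type v} [Field k] [AddCommGroup H] [Module k H] [Coalgebra k H]
  {S : CoquasitriangularCoquasibialgebra k H} (F : TwoCochain S) (A : Comod S) [MonObj A]

/-- The general transport speaks of an algebra structure on the image object; the one meant here is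
the structure of A_F, and the next two lemmas show that it is the image of that of A. -/
noncomputable instance : MonObj ((twistFunctor F).obj A) := inferInstanceAs (MonObj (A.twist F))

open MonObj in
-- True by definition, since the product a ⊗ b ↦ F(a₍₁₎,b₍₁₎) a₍₂₎b₍₂₎ was introduced as the product
-- of A composed with the tensorator.
lemma twistFunctor_mul :
    (μ[(twistFunctor F).obj A] : (twistFunctor F).obj A ⊗ (twistFunctor F).obj A ⟶ _) =
      Functor.LaxMonoidal.μ (twistFunctor F) A A ≫ (twistFunctor F).map μ[A] := rfl

open MonObj in
lemma twistFunctor_one : (η[(twistFunctor F).obj A] : _ ⟶ (twistFunctor F).obj A) =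
    Functor.LaxMonoidal.ε (twistFunctor F) ≫ (twistFunctor F).map η[A] := rfl

variable {A} {σ : A ≅ A} (hσ : IsRibbon σ)

lemma isRibbon_twistIso (hσ : IsRibbon σ) : IsRibbon (twistIso F σ) :=
  IsRibbon.transport (twistFunctor F) (σ' := twistIso F σ) (twistFunctor_mul F A)
    (twistFunctor_one F A) rfl hσ

/-- The isomorphism between the cocyclic modules of `A` and of its cotwist `A_F`. -/
noncomputable def cotwistCocyclicIso : (cocyclicModule (k := k) σ hσ).Iso
    (cocyclicModule (k := k) (twistIso F σ) (isRibbon_twistIso F hσ)) :=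
  cocyclicModuleIso (twistFunctor F) (σ' := twistIso F σ) (twistFunctor_mul F A)
    (twistFunctor_one F A) rfl hσ (isRibbon_twistIso F hσ)

/-- The transported representative is T(φ^α) preceded by the iterated tensorator of the source and
followed by the inverse one of the target. The target is the empty word, where the comparison is the
identity of k, so only S_α on the source survives. -/
lemma cochainRep_cotwistCocyclicIso {n : ℕ} (φ : (cocyclicModule (k := k) σ hσ).obj n)
    (s : Bracketing (n + 1)) :
    cochainRep ((cotwistCocyclicIso F hσ).equiv n φ) s = cochainRep φ s ∘ₗ gauge F A s.1 := by
  rw [← lin_gaugeHom]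
  rfl

end QuasiCyclic.Comod

theorem theorem11 {k : Type u} {H : Type v} [Field k] [AddCommGroup H] [Module k H]
    [Coalgebra k H] (S : CoquasitriangularCoquasibialgebra k H) (F : TwoCochain S)
    (A : Comod S) [MonObj A] (σ : A ≅ A) (hσ : IsRibbon σ) :
    ∃ hσF : IsRibbon (Comod.twistIso F σ),
      ∃ e : (cocyclicModule (k := k) σ hσ).Iso
          (cocyclicModule (k := k) (Comod.twistIso F σ) hσF),
        ∀ (n : ℕ) (φ : (cocyclicModule (k := k) σ hσ).obj n),
          (∀ s : Bracketing (n + 1),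
            cochainRep (e.equiv n φ) s = cochainRep φ s ∘ₗ Comod.gauge F A s.1) ∧
          cochainRep (e.equiv n φ) (.lr (n + 1)) =
            cochainRep φ (.lr (n + 1)) ∘ₗ (lrCoaction A n).act (lrFactor F n) ∘ₗ
              (Comod.samePow F A (Word.lr (n + 1))).toLinearMap := by
  refine ⟨Comod.isRibbon_twistIso F hσ, Comod.cotwistCocyclicIso F hσ, fun n φ =>
    ⟨Comod.cochainRep_cotwistCocyclicIso F hσ φ, ?_⟩⟩
  -- The explicit formula is the case of the left-to-right bracketing, with S_α unrolled.
  rw [Comod.cochainRep_cotwistCocyclicIso, Comod.gauge_lr]
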